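/- Let $A=(a_{ij})_{1\le i,j\le r}$ be a symmetric generalized Cartan matrix with $\det A\neq 0$ that is of hyperbolic type (indecomposable, indefinite, every proper principal submatrix positive semidefinite), and let $\mathfrak g=\mathfrak g(A)$ be the complex Kac–Moody algebra with Chevalley generators $e_i,f_i,h_i$ (the quotient of the Lie algebra given by the Chevalley relations $[h_i,h_j]=0$, $[e_i,f_j]=\delta_{ij}h_i$, $[h_i,e_j]=a_{ij}e_j$, $[h_i,f_j]=-a_{ij}f_j$ by its largest ideal meeting $\mathfrak h=\bigoplus_i\mathbb C h_i$ trivially). Let $\omega$ be the Cartan–Chevalley involution, i.e. the antilinear automorphism with $e_i\mapsto -f_i$, $f_i\mapsto -e_i$, $h_i\mapsto -h_i$, and let $\langle\cdot|\cdot\rangle$ be the standard invariant symmetric bilinear form, $\langle e_i|f_j\rangle=\delta_{ij}$, $\langle h_i|h_j\rangle=a_{ij}$. Let $\alpha=\sum_i n_i\alpha_i$ ($n_i\in\mathbb Z_{\ge 0}$) be a positive root with $\alpha^2=\sum_{i,j}n_ia_{ij}n_j<0$, let $0\ne E\in\mathfrak g_\alpha$, and put $F=-\omega(E)$, $H(\alpha)=\sum_i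 n_ih_i$, $N=\langle E|F\rangle$; for a weight $\mu\in\mathfrak h^*$ write $\mu\cdot\alpha=\mu(H(\alpha))$. Then $N>0$, $[E,F]=N\,H(\alpha)$, and the elements $$J_3=(\alpha^2)^{-1}H(\alpha),\qquad J^+=(-N\alpha^2)^{-1/2}E,\qquad J^-=(-N\alpha^2)^{-1/2}F$$ satisfy $[J^+,J^-]=-J_3$, $[J_3,J^\pm]=\pm J^\pm$; they span $\mathfrak{so}(2,1)_\alpha$. For real $s>0$ let $\mathcal D^-_s$ be the highest weight discrete series module of $\mathfrak{so}(2,1)$: it has basis $v_0,v_1,v_2,\dots$ with $J_3v_k=-(s+k)v_k$, $J^-v_k=c_kv_{k+1}$, $J^+v_{k+1}=c_kv_k$, $J^+v_0=0$, where $c_k=\sqrt{(k+1)(2s+k)/2}$. Let $\mathcal D^+_s$ be the lowest weight discrete series module: $J_3v_k=(s+k)v_k$, $J^+v_k=c_kv_{k+1}$, $J^-v_{k+1}=c_kv_k$, $J^-v_0=0$. Let $\Lambda\neq 0$ be a dominant integral weight ($\Lambda(h_i)\in\mathbb Z_{\ge 0}$ for all $i$). 1. The irreducible highest weight module $V(\Lambda)$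 of $\mathfrak g$ is, as a module for $\mathfrak{so}(2,1)_\alpha$, a direct sum $$V(\Lambda)\;\cong\;\bigoplus_{s>0}\mathrm{Mult}^-_s\,\mathcal D^-_s$$ with all multiplicities $\mathrm{Mult}^-_s$ finite. The summands can be chosen such that each is generated by a weight vector for $\mathfrak h$ annihilated by $J^+$, and the parameter of a summand whose generator has weight $\Lambda'$ is $s=-\Lambda'\cdot\alpha/\alpha^2$. Moreover, every nonzero vector of $V(\Lambda)$ of weight $\Lambda'$ that is annihilated by $J^+$ generates, under $\mathfrak{so}(2,1)_\alpha$, a copy of $\mathcal D^-_s$ with $s=-\Lambda'\cdot\alpha/\alpha^2>0$, and this $s$ occurs in the decomposition. 2. Likewise, the irreducible lowest weight module of $\mathfrak g$ with lowest weight $-\Lambda$ is, as a module for $\mathfrak{so}(2,1)_\alpha$, a direct sum of modules $\mathcal D^+_s$, $s>0$, with finite multiplicities; the same statements hold with $J^-$ in place of $J^+$ and $s=\Lambda'\cdot\alpha/\alpha^2$. -/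

import Mathlib

noncomputable section

namespace KacMoody

open scoped DirectSum

/-! ### Hyperbolic generalized Cartan matrices (symmetric case) -/

/-- A symmetric generalized Cartan matrix of hyperbolic type: it is indecomposable, it is of
indefinite type (for a symmetric indecomposable generalized Cartan matrix: it is not positive
semidefinite), and every proper subdiagram is a union of diagrams of finite and affine type
(for symmetric matrices: every proper principal submatrix is positive semidefinite). -/
structure IsHyperbolic {ι : Type*} (A : Matrix ι ι ℤ) : Prop where
  symm : A.IsSymm
  diag : ∀ i, A i i = 2
  offDiag : ∀ i j, i ≠ j → A i j ≤ 0
  indecomposable : ∀ S : Set ι, S.Nonempty → S ≠ Set.univ → ∃ i ∈ S, ∃ j ∉ S, A i j ≠ 0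
  indefinite : ¬ (A.map (Int.cast : ℤ → ℝ)).PosSemidef
  proper : ∀ S : Set ι, S ≠ Set.univ →
    ((A.map (Int.cast : ℤ → ℝ)).submatrix (Subtype.val : S → ι) (Subtype.val : S → ι)).PosSemidef

/-! ### The Kac-Moody algebra of a matrix of full rank -/

section KM

variable {ι : Type*} [DecidableEq ι] (A : Matrix ι ι ℤ)

/-- The Chevalley relations `[h_i, h_j] = 0`, `[e_i, f_j] = δ_ij h_i`, `[h_i, e_j] = a_ij e_j`,
`[h_i, f_j] = - a_ij f_j`, as an ideal of the free Lie algebra on the `h_i`, `e_i`, `f_i`. -/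
def chevalleyIdeal : LieIdeal ℂ (FreeLieAlgebra ℂ (CartanMatrix.Generators ι)) :=
  LieSubmodule.lieSpan ℂ _
    (Set.range (CartanMatrix.Relations.HH ℂ) ∪ Set.range (CartanMatrix.Relations.EF ℂ) ∪
      Set.range (CartanMatrix.Relations.HE ℂ A) ∪ Set.range (CartanMatrix.Relations.HF ℂ A))

/-- The auxiliary Lie algebra given by the Chevalley generators and the Chevalley relations. -/
abbrev PreAlgebra : Type _ :=
  FreeLieAlgebra ℂ (CartanMatrix.Generators ι) ⧸ chevalleyIdeal A

/-- The class of a generator in the auxiliary Lie algebra. -/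
def preGen (x : CartanMatrix.Generators ι) : PreAlgebra A :=
  LieSubmodule.Quotient.mk (FreeLieAlgebra.of ℂ x)

/-- The span of the `h_i` in the auxiliary Lie algebra. -/
def preCartan : Submodule ℂ (PreAlgebra A) :=
  Submodule.span ℂ (Set.range fun i => preGen A (.H i))

/-- The largest ideal of the auxiliary Lie algebra that meets the span of the `h_i` trivially,
as the sum of all such ideals. -/
def radical : LieIdeal ℂ (PreAlgebra A) :=
  sSup {I : LieIdeal ℂ (PreAlgebra A) | Disjoint I.toSubmodule (preCartan A)}

/-- The complex Kac-Moody algebra `𝔤(A)` of a matrix `A` with `det A ≠ 0` (so that the Cartan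
subalgebra is spanned by the `h_i`): the quotient of the Lie algebra given by the Chevalley
generators and relations by its largest ideal that meets the Cartan subalgebra trivially. -/
abbrev KMAlgebra : Type _ := PreAlgebra A ⧸ radical A

/-- The Chevalley generators `h_i`. -/
def genH (i : ι) : KMAlgebra A := LieSubmodule.Quotient.mk (preGen A (.H i))

/-- The Chevalley generators `e_i`. -/
def genE (i : ι) : KMAlgebra A := LieSubmodule.Quotient.mk (preGen A (.E i))

/-- The Chevalley generators `f_i`. -/
def genF (i : ι) : KMAlgebra A := LieSubmodule.Quotient.mk (preGen A (.F i))

end KM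

/-! ### The Cartan-Chevalley involution

It is antilinear; it is obtained from the universal properties by viewing it as a linear map to the
complex conjugate Lie algebra. -/

/-- The complex conjugate of a complex Lie algebra: the same Lie ring, with the scalar `z` acting
as its conjugate. -/
def Conj (L : Type*) : Type _ := L

instance {L : Type*} [LieRing L] : LieRing (Conj L) := inferInstanceAs (LieRing L)

instance {L : Type*} [LieRing L] [LieAlgebra ℂ L] : Module ℂ (Conj L) :=
  Module.compHom L (starRingEnd ℂ)

instance {L : Type*} [LieRing L] [LieAlgebra ℂ L] : LieAlgebra ℂ (Conj L) where
  lie_smul t x y := lie_smul (starRingEnd ℂ t) (show L from x) (show L from y)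

section Involution

variable {ι : Type*} [DecidableEq ι] (A : Matrix ι ι ℤ)

/-- The values of the involution on the generators: `h_i ↦ - h_i`, `e_i ↦ - f_i`,
`f_i ↦ - e_i`. -/
def omegaGen : CartanMatrix.Generators ι → PreAlgebra A
  | .H i => - preGen A (.H i)
  | .E i => - preGen A (.F i)
  | .F i => - preGen A (.E i)

/-- The involution on the free Lie algebra. -/
def omegaFree :
    FreeLieAlgebra ℂ (CartanMatrix.Generators ι) →ₗ⁅ℂ⁆ Conj (PreAlgebra A) :=
  FreeLieAlgebra.lift ℂ (L := Conj (PreAlgebra A)) (omegaGen A)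

theorem omegaFree_of (x : CartanMatrix.Generators ι) :
    omegaFree A (FreeLieAlgebra.of ℂ x) = omegaGen A x :=
  FreeLieAlgebra.lift_of_apply (R := ℂ) (L := Conj (PreAlgebra A)) (omegaGen A) x

/-- The involution on the free Lie algebra, as an antilinear map. -/
def omegaFreeSemi :
    FreeLieAlgebra ℂ (CartanMatrix.Generators ι) →ₛₗ[starRingEnd ℂ] PreAlgebra A where
  toFun x := omegaFree A x
  map_add' x y := (omegaFree A).map_add x y
  map_smul' t x := (omegaFree A).map_smul t x

theorem omegaFreeSemi_lie (x y : FreeLieAlgebra ℂ (CartanMatrix.Generators ι)) :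
    omegaFreeSemi A ⁅x, y⁆ = ⁅omegaFreeSemi A x, omegaFreeSemi A y⁆ :=
  (omegaFree A).map_lie x y

theorem omegaFreeSemi_of (x : CartanMatrix.Generators ι) :
    omegaFreeSemi A (FreeLieAlgebra.of ℂ x) = omegaGen A x :=
  omegaFree_of A x

theorem preGen_relations (i j : ι) :
    ⁅preGen A (.H i), preGen A (.H j)⁆ = 0 ∧
    ⁅preGen A (.E i), preGen A (.F j)⁆ = (if i = j then preGen A (.H i) else 0) ∧
    ⁅preGen A (.H i), preGen A (.E j)⁆ = A i j • preGen A (.E j) ∧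
    ⁅preGen A (.H i), preGen A (.F j)⁆ = - (A i j • preGen A (.F j)) := by
  have key : ∀ x ∈ (Set.range (CartanMatrix.Relations.HH (B := ι) ℂ) ∪
      Set.range (CartanMatrix.Relations.EF ℂ) ∪ Set.range (CartanMatrix.Relations.HE ℂ A) ∪
      Set.range (CartanMatrix.Relations.HF ℂ A)),
      (LieSubmodule.Quotient.mk' (chevalleyIdeal A)) x = 0 := fun x hx =>
    (LieSubmodule.Quotient.mk_eq_zero (N := chevalleyIdeal A)).mpr (LieSubmodule.subset_lieSpan hx)
  refine ⟨?_, ?_, ?_, ?_⟩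
  · exact key _ (Or.inl (Or.inl (Or.inl ⟨(i, j), rfl⟩)))
  · have := key _ (Or.inl (Or.inl (Or.inr ⟨(i, j), rfl⟩)))
    by_cases hij : i = j
    · simp only [CartanMatrix.Relations.EF, Function.uncurry, hij, if_true, map_sub] at this
      rw [if_pos hij, hij]
      exact sub_eq_zero.mp this
    · simp only [CartanMatrix.Relations.EF, Function.uncurry, hij, if_false] at this
      rw [if_neg hij]
      exact this
  · have := key _ (Or.inl (Or.inr ⟨(i, j), rfl⟩))
    simp only [CartanMatrix.Relations.HE, Function.uncurry, map_sub, map_zsmul] at this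
    exact sub_eq_zero.mp this
  · have := key _ (Or.inr ⟨(i, j), rfl⟩)
    simp only [CartanMatrix.Relations.HF, Function.uncurry, map_add, map_zsmul] at this
    exact eq_neg_of_add_eq_zero_left this

theorem chevalleyIdeal_le_ker :
    (chevalleyIdeal A).toSubmodule ≤ LinearMap.ker (omegaFreeSemi A) := by
  let K : LieIdeal ℂ (FreeLieAlgebra ℂ (CartanMatrix.Generators ι)) :=
    { LinearMap.ker (omegaFreeSemi A) with
      lie_mem := by
        intro x m hm
        have hm' : omegaFreeSemi A m = 0 := hm
        change omegaFreeSemi A ⁅x, m⁆ = 0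
        rw [omegaFreeSemi_lie, hm', lie_zero] }
  suffices H : chevalleyIdeal A ≤ K from H
  refine LieSubmodule.lieSpan_le.mpr ?_
  rintro x (((⟨⟨i, j⟩, rfl⟩ | ⟨⟨i, j⟩, rfl⟩) | ⟨⟨i, j⟩, rfl⟩) | ⟨⟨i, j⟩, rfl⟩)
  all_goals change omegaFreeSemi A _ = 0
  · simp [CartanMatrix.Relations.HH, omegaFreeSemi_lie, omegaFreeSemi_of, omegaGen,
      (preGen_relations A i j).1]
  · have h1 := (preGen_relations A j i).2.1
    rw [← lie_skew] at h1
    by_cases hij : i = j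
    · subst hij
      simp only [if_true] at h1
      simp [CartanMatrix.Relations.EF, omegaFreeSemi_lie, omegaFreeSemi_of, omegaGen, ← h1]
    · simp only [if_neg (Ne.symm hij), neg_eq_zero] at h1
      simp [CartanMatrix.Relations.EF, omegaFreeSemi_lie, omegaFreeSemi_of, omegaGen, h1, hij]
  · simp [CartanMatrix.Relations.HE, omegaFreeSemi_lie, omegaFreeSemi_of, omegaGen,
      (preGen_relations A i j).2.2.2]
  · simp [CartanMatrix.Relations.HF, omegaFreeSemi_lie, omegaFreeSemi_of, omegaGen,
      (preGen_relations A i j).2.2.1]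

/-- The involution on the auxiliary Lie algebra. -/
def omegaPre : PreAlgebra A →ₛₗ[starRingEnd ℂ] PreAlgebra A :=
  (chevalleyIdeal A).toSubmodule.liftQ (omegaFreeSemi A) (chevalleyIdeal_le_ker A)

theorem omegaPre_mk (x : FreeLieAlgebra ℂ (CartanMatrix.Generators ι)) :
    omegaPre A (LieSubmodule.Quotient.mk x) = omegaFreeSemi A x := rfl

theorem omegaPre_gen (x : CartanMatrix.Generators ι) :
    omegaPre A (preGen A x) = omegaGen A x :=
  omegaFreeSemi_of A x

theorem omegaPre_lie (x y : PreAlgebra A) :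
    omegaPre A ⁅x, y⁆ = ⁅omegaPre A x, omegaPre A y⁆ := by
  obtain ⟨x, rfl⟩ := LieSubmodule.Quotient.surjective_mk' _ x
  obtain ⟨y, rfl⟩ := LieSubmodule.Quotient.surjective_mk' _ y
  exact omegaFreeSemi_lie A x y

theorem omegaPre_omegaPre (x : PreAlgebra A) : omegaPre A (omegaPre A x) = x := by
  obtain ⟨x, rfl⟩ := LieSubmodule.Quotient.surjective_mk' _ x
  let F₁ : FreeLieAlgebra ℂ (CartanMatrix.Generators ι) →ₗ⁅ℂ⁆ PreAlgebra A :=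
    { toFun := fun x => omegaPre A (omegaFreeSemi A x)
      map_add' := by intro x y; simp only [map_add]
      map_smul' := by intro t x; simp
      map_lie' := by intro x y; simp only [omegaFreeSemi_lie, omegaPre_lie] }
  let F₂ : FreeLieAlgebra ℂ (CartanMatrix.Generators ι) →ₗ⁅ℂ⁆ PreAlgebra A :=
    { toFun := fun x => LieSubmodule.Quotient.mk x
      map_add' := by intro x y; rfl
      map_smul' := by intro t x; rfl
      map_lie' := by intro x y; rfl }
  have H : F₁ = F₂ := FreeLieAlgebra.hom_ext fun g => by
    change omegaPre A (omegaFreeSemi A (FreeLieAlgebra.of ℂ g)) = preGen A g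
    rw [omegaFreeSemi_of]
    cases g <;> simp [omegaGen, omegaPre_gen]
  exact DFunLike.congr_fun H x

theorem omegaPre_mem_preCartan {x : PreAlgebra A} (hx : x ∈ preCartan A) :
    omegaPre A x ∈ preCartan A := by
  refine Submodule.span_induction ?_ ?_ ?_ ?_ hx
  · rintro _ ⟨i, rfl⟩
    rw [omegaPre_gen]
    exact neg_mem (Submodule.subset_span ⟨i, rfl⟩)
  · simp
  · intro x y _ _ h1 h2
    simpa using add_mem h1 h2
  · intro t x _ h1
    simpa using Submodule.smul_mem _ _ h1

/-- The preimage of an ideal under the involution. -/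
def omegaComap (I : LieIdeal ℂ (PreAlgebra A)) : LieIdeal ℂ (PreAlgebra A) :=
  { I.toSubmodule.comap (omegaPre A) with
    lie_mem := by
      intro x m hm
      change omegaPre A ⁅x, m⁆ ∈ I
      rw [omegaPre_lie]
      exact I.lie_mem hm }

theorem radical_le_omegaComap : radical A ≤ omegaComap A (radical A) := by
  refine sSup_le fun I hI x hx => ?_
  have hd : omegaComap A I ≤ radical A := by
    refine le_sSup ?_
    refine Submodule.disjoint_def.mpr fun y hy hy' => ?_
    have := Submodule.disjoint_def.mp hI (omegaPre A y) hy (omegaPre_mem_preCartan A hy')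
    rw [← omegaPre_omegaPre A y, this, map_zero]
  refine hd ?_
  change omegaPre A (omegaPre A x) ∈ I
  rwa [omegaPre_omegaPre]

/-- The Cartan-Chevalley involution `ω` of `𝔤(A)`: the antilinear automorphism with
`e_i ↦ - f_i`, `f_i ↦ - e_i`, `h_i ↦ - h_i`. -/
def omega : KMAlgebra A →ₛₗ[starRingEnd ℂ] KMAlgebra A :=
  (radical A).toSubmodule.mapQ (radical A).toSubmodule (omegaPre A) (radical_le_omegaComap A)

theorem omega_lie (x y : KMAlgebra A) : omega A ⁅x, y⁆ = ⁅omega A x, omega A y⁆ := by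
  obtain ⟨x, rfl⟩ := LieSubmodule.Quotient.surjective_mk' _ x
  obtain ⟨y, rfl⟩ := LieSubmodule.Quotient.surjective_mk' _ y
  exact congrArg (LieSubmodule.Quotient.mk' (radical A)) (omegaPre_lie A x y)

theorem omega_genH (i : ι) : omega A (genH A i) = - genH A i :=
  congrArg (LieSubmodule.Quotient.mk' (radical A)) (omegaPre_gen A (.H i))

theorem omega_genE (i : ι) : omega A (genE A i) = - genF A i :=
  congrArg (LieSubmodule.Quotient.mk' (radical A)) (omegaPre_gen A (.E i))

theorem omega_genF (i : ι) : omega A (genF A i) = - genE A i :=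
  congrArg (LieSubmodule.Quotient.mk' (radical A)) (omegaPre_gen A (.F i))

end Involution

/-! ### Roots, the bilinear form, and the generators of `so(2,1)_α`

An element `α = ∑ n_i α_i` of the positive root lattice is given by its coefficients
`n : ι → ℕ`. A weight `μ` is given by its values `μ i = μ(h_i)`. -/

section Roots

variable {ι : Type*} [Fintype ι] [DecidableEq ι] (A : Matrix ι ι ℤ)

/-- `α² = ∑ n_i a_ij n_j`. -/
def normSq (n : ι → ℕ) : ℤ := ∑ i, ∑ j, (n i : ℤ) * A i j * (n j : ℤ)

/-- The root space `𝔤_α`, where `α(h_i) = ∑ a_ij n_j`. -/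
def rootSpace (n : ι → ℕ) : Submodule ℂ (KMAlgebra A) where
  carrier := {x | ∀ i, ⁅genH A i, x⁆ = ((∑ j, A i j * (n j : ℤ) : ℤ) : ℂ) • x}
  add_mem' := by
    intro x y hx hy i
    rw [lie_add, hx i, hy i, smul_add]
  zero_mem' := by
    intro i
    rw [lie_zero, smul_zero]
  smul_mem' := by
    intro c x hx i
    rw [lie_smul, hx i, smul_comm]

/-- `H(α) = ∑ n_i h_i`. -/
def rootH (n : ι → ℕ) : KMAlgebra A := ∑ i, (n i : ℂ) • genH A i

/-- `μ · α = μ(H(α)) = ∑ n_i μ(h_i)`. -/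
def pairing (μ : ι → ℂ) (n : ι → ℕ) : ℂ := ∑ i, (n i : ℂ) * μ i

/-- The standard bilinear form of `𝔤(A)` for symmetric `A`: the invariant symmetric bilinear form
with `⟨e_i | f_j⟩ = δ_ij` and `⟨h_i | h_j⟩ = a_ij`. -/
structure IsStandardForm (B : LinearMap.BilinForm ℂ (KMAlgebra A)) : Prop where
  symm : ∀ x y, B x y = B y x
  invariant : ∀ x y z, B ⁅x, y⁆ z = B x ⁅y, z⁆
  e_f : ∀ i j, B (genE A i) (genF A j) = if i = j then 1 else 0
  h_h : ∀ i j, B (genH A i) (genH A j) = (A i j : ℂ)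

/-- Three elements `J₃`, `J⁺`, `J⁻` of a complex Lie algebra with the commutation relations of
`so(2,1)`. -/
structure So21Triple (L : Type*) [LieRing L] [LieAlgebra ℂ L] where
  J3 : L
  Jp : L
  Jm : L
  lie_Jp_Jm : ⁅Jp, Jm⁆ = - J3
  lie_J3_Jp : ⁅J3, Jp⁆ = Jp
  lie_J3_Jm : ⁅J3, Jm⁆ = - Jm

/-- `J` is the triple that spans `so(2,1)_α`: `J₃ = (α²)⁻¹ H(α)`, `J⁺ = (-N α²)^(-1/2) E(α)`,
`J⁻ = (-N α²)^(-1/2) F(α)` with `F(α) = - ω(E(α))`. -/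
def IsRootTriple (n : ι → ℕ) (E : KMAlgebra A) (N : ℝ) (J : So21Triple (KMAlgebra A)) : Prop :=
  J.J3 = ((normSq A n : ℂ))⁻¹ • rootH A n ∧
  J.Jp = (((√(-N * (normSq A n : ℝ)))⁻¹ : ℝ) : ℂ) • E ∧
  J.Jm = (((√(-N * (normSq A n : ℝ)))⁻¹ : ℝ) : ℂ) • (- omega A E)

end Roots

/-! ### The discrete series modules

A representation of `so(2,1)` on a complex vector space is given by three operators `J₃`, `J⁺`, `J⁻`
with the commutation relations of `so(2,1)`. -/

/-- A representation of `so(2,1)` on `W`. -/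
structure So21Rep (W : Type*) [AddCommGroup W] [Module ℂ W] where
  J3 : W →ₗ[ℂ] W
  Jp : W →ₗ[ℂ] W
  Jm : W →ₗ[ℂ] W
  lie_Jp_Jm : ∀ w, Jp (Jm w) - Jm (Jp w) = - J3 w
  lie_J3_Jp : ∀ w, J3 (Jp w) - Jp (J3 w) = Jp w
  lie_J3_Jm : ∀ w, J3 (Jm w) - Jm (J3 w) = - Jm w

/-! The modules `𝒟_s⁻` and `𝒟_s⁺` have the (algebraic) orthonormal basis `v_0, v_1, v_2, …`,
realized as the standard basis of `ℕ →₀ ℂ`; `v_0` is the highest, respectively lowest, weight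
vector. -/

/-- `c_k = ((k+1)(2s+k)/2)^(1/2)`, the quotient of the norms of `(J^∓)^(k+1) v_0` and
`(J^∓)^k v_0` in the highest, respectively lowest, weight module with parameter `s`. -/
def ladderCoeff (s : ℝ) (k : ℕ) : ℝ := √((k + 1) * (2 * s + k) / 2)

/-- `v_k ↦ (s + k) v_k`. -/
def ladderWeight (s : ℝ) : (ℕ →₀ ℂ) →ₗ[ℂ] (ℕ →₀ ℂ) :=
  Finsupp.linearCombination ℂ fun k => Finsupp.single k ((s + k : ℝ) : ℂ)

/-- `v_k ↦ c_k v_(k+1)`. -/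
def ladderAway (s : ℝ) : (ℕ →₀ ℂ) →ₗ[ℂ] (ℕ →₀ ℂ) :=
  Finsupp.linearCombination ℂ fun k => Finsupp.single (k + 1) (ladderCoeff s k : ℂ)

/-- `v_0 ↦ 0` and `v_(k+1) ↦ c_k v_k`. -/
def ladderBack (s : ℝ) : (ℕ →₀ ℂ) →ₗ[ℂ] (ℕ →₀ ℂ) :=
  Finsupp.linearCombination ℂ fun k =>
    match k with
    | 0 => 0
    | k + 1 => Finsupp.single k (ladderCoeff s k : ℂ)

theorem ladderWeight_single (s : ℝ) (k : ℕ) (a : ℂ) :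
    ladderWeight s (Finsupp.single k a) = Finsupp.single k (a * ((s + k : ℝ) : ℂ)) := by
  rw [ladderWeight, Finsupp.linearCombination_single, Finsupp.smul_single, smul_eq_mul]

theorem ladderAway_single (s : ℝ) (k : ℕ) (a : ℂ) :
    ladderAway s (Finsupp.single k a) = Finsupp.single (k + 1) (a * (ladderCoeff s k : ℂ)) := by
  simp [ladderAway, Finsupp.linearCombination_single]

theorem ladderBack_single_zero (s : ℝ) (a : ℂ) : ladderBack s (Finsupp.single 0 a) = 0 := by
  simp [ladderBack, Finsupp.linearCombination_single]

theorem ladderBack_single_succ (s : ℝ) (k : ℕ) (a : ℂ) :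
    ladderBack s (Finsupp.single (k + 1) a) = Finsupp.single k (a * (ladderCoeff s k : ℂ)) := by
  simp [ladderBack, Finsupp.linearCombination_single]

theorem ladderCoeff_mul_self {s : ℝ} (hs : 0 < s) (k : ℕ) :
    (ladderCoeff s k : ℂ) * (ladderCoeff s k : ℂ) = (k + 1) * (2 * s + k) / 2 := by
  rw [← Complex.ofReal_mul, ladderCoeff, Real.mul_self_sqrt (by positivity)]
  push_cast
  ring

theorem ladder_away_back {s : ℝ} (hs : 0 < s) (w : ℕ →₀ ℂ) :
    ladderAway s (ladderBack s w) - ladderBack s (ladderAway s w) = - ladderWeight s w := by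
  induction w using Finsupp.induction_linear with
  | zero => simp
  | add x y hx hy =>
    simp only [map_add, neg_add, ← hx, ← hy]
    abel
  | single k a =>
    rw [ladderAway_single, ladderBack_single_succ, ladderWeight_single, mul_assoc,
      ladderCoeff_mul_self hs, ← Finsupp.single_neg]
    cases k with
    | zero =>
      rw [ladderBack_single_zero, map_zero, zero_sub, ← Finsupp.single_neg]
      refine congrArg (Finsupp.single 0) ?_
      push_cast
      ring
    | succ k =>
      rw [ladderBack_single_succ, ladderAway_single, mul_assoc, ladderCoeff_mul_self hs,
        ← Finsupp.single_sub]
      refine congrArg (Finsupp.single (k + 1)) ?_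
      push_cast
      ring

theorem ladder_weight_away (s : ℝ) (w : ℕ →₀ ℂ) :
    ladderWeight s (ladderAway s w) - ladderAway s (ladderWeight s w) = ladderAway s w := by
  induction w using Finsupp.induction_linear with
  | zero => simp
  | add x y hx hy =>
    rw [map_add (ladderAway s) x y]
    conv_rhs => rw [← hx, ← hy]
    simp only [map_add]
    abel
  | single k a =>
    rw [ladderAway_single, ladderWeight_single, ladderWeight_single, ladderAway_single,
      ← Finsupp.single_sub]
    refine congrArg (Finsupp.single (k + 1)) ?_
    push_cast
    ring

theorem ladder_weight_back (s : ℝ) (w : ℕ →₀ ℂ) :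
    ladderWeight s (ladderBack s w) - ladderBack s (ladderWeight s w) = - ladderBack s w := by
  induction w using Finsupp.induction_linear with
  | zero => simp
  | add x y hx hy =>
    simp only [map_add, neg_add, ← hx, ← hy]
    abel
  | single k a =>
    cases k with
    | zero =>
      rw [ladderBack_single_zero, ladderWeight_single, ladderBack_single_zero, map_zero, sub_zero,
        neg_zero]
    | succ k =>
      rw [ladderBack_single_succ, ladderWeight_single, ladderWeight_single, ladderBack_single_succ,
        ← Finsupp.single_sub, ← Finsupp.single_neg]
      refine congrArg (Finsupp.single k) ?_
      push_cast
      ring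

/-- The lowest weight discrete series module `𝒟_s⁺`, `s > 0`: `J₃ v_k = (s + k) v_k`,
`J⁺ v_k = c_k v_(k+1)`, `J⁻ v_(k+1) = c_k v_k`, `J⁻ v_0 = 0`. -/
def discretePlus (s : {s : ℝ // 0 < s}) : So21Rep (ℕ →₀ ℂ) where
  J3 := ladderWeight s
  Jp := ladderAway s
  Jm := ladderBack s
  lie_Jp_Jm := ladder_away_back s.2
  lie_J3_Jp := ladder_weight_away s
  lie_J3_Jm := ladder_weight_back s

/-- The highest weight discrete series module `𝒟_s⁻`, `s > 0`: `J₃ v_k = - (s + k) v_k`,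
`J⁻ v_k = c_k v_(k+1)`, `J⁺ v_(k+1) = c_k v_k`, `J⁺ v_0 = 0`. -/
def discreteMinus (s : {s : ℝ // 0 < s}) : So21Rep (ℕ →₀ ℂ) where
  J3 := - ladderWeight s
  Jp := ladderBack s
  Jm := ladderAway s
  lie_Jp_Jm w := by
    rw [LinearMap.neg_apply, ← ladder_away_back s.2, neg_sub]
  lie_J3_Jp w := by
    rw [LinearMap.neg_apply, LinearMap.neg_apply, map_neg, neg_sub_neg, ← neg_sub,
      ladder_weight_back, neg_neg]
  lie_J3_Jm w := by
    rw [LinearMap.neg_apply, LinearMap.neg_apply, map_neg, neg_sub_neg, ← neg_sub,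
      ladder_weight_away]

/-! ### Highest and lowest weight modules and their decompositions -/

section Modules

variable {ι : Type*} [Fintype ι] [DecidableEq ι] (A : Matrix ι ι ℤ)
variable {V : Type*} [AddCommGroup V] [Module ℂ V] [LieRingModule (KMAlgebra A) V]

/-- `v` is a vector of weight `μ`. -/
def HasWeight (μ : ι → ℂ) (v : V) : Prop := ∀ i, ⁅genH A i, v⁆ = μ i • v

/-- `v` is a highest weight vector of weight `Λ`. -/
def IsHighestWeightVector (Λ : ι → ℂ) (v : V) : Prop :=
  v ≠ 0 ∧ HasWeight A Λ v ∧ ∀ i, ⁅genE A i, v⁆ = 0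

/-- `v` is a lowest weight vector of weight `Λ`. -/
def IsLowestWeightVector (Λ : ι → ℂ) (v : V) : Prop :=
  v ≠ 0 ∧ HasWeight A Λ v ∧ ∀ i, ⁅genF A i, v⁆ = 0

/-- `φ` is a homomorphism of `so(2,1)`-modules from the module `D`
to `V`, on which `so(2,1)` acts through the triple `J` in `𝔤(A)`. -/
def IsSo21Hom {A : Matrix ι ι ℤ} {V : Type*} [AddCommGroup V] [Module ℂ V]
    [LieRingModule (KMAlgebra A) V] (J : So21Triple (KMAlgebra A))
    (D : So21Rep (ℕ →₀ ℂ)) (φ : (ℕ →₀ ℂ) →ₗ[ℂ] V) : Prop :=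
  ∀ x, φ (D.J3 x) = ⁅J.J3, φ x⁆ ∧ φ (D.Jp x) = ⁅J.Jp, φ x⁆ ∧ φ (D.Jm x) = ⁅J.Jm, φ x⁆

/-- `V` is, under the triple `J`, the direct sum over `s > 0` of `mult s` (a finite number) copies
of the modules `D s`. Moreover, the generators `v_0` of the summands are weight vectors for the
Cartan subalgebra of `𝔤(A)`, and the parameter of each summand is `param μ`, where `μ` is the weight
of its generator; and each weight vector `v ≠ 0` of weight `μ` annihilated by `Jtop` generates a copy
of `D s` with `s = param μ`, and this `s` occurs in the decomposition. -/
def DecomposesInto (J : So21Triple (KMAlgebra A)) (Jtop : KMAlgebra A)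
    (D : {s : ℝ // 0 < s} → So21Rep (ℕ →₀ ℂ)) (param : (ι → ℂ) → ℂ)
    (V : Type*) [AddCommGroup V] [Module ℂ V] [LieRingModule (KMAlgebra A) V] : Prop :=
  ∃ (mult : {s : ℝ // 0 < s} → ℕ)
    (Φ : (⨁ _ : (Σ s : {s : ℝ // 0 < s}, Fin (mult s)), ℕ →₀ ℂ) ≃ₗ[ℂ] V),
    (∀ p, IsSo21Hom J (D p.1) (Φ.toLinearMap ∘ₗ DirectSum.lof ℂ _ (fun _ => ℕ →₀ ℂ) p)) ∧
    (∀ p, ∃ μ : ι → ℂ,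
      HasWeight A μ (Φ (DirectSum.lof ℂ _ (fun _ => ℕ →₀ ℂ) p (Finsupp.single 0 1))) ∧
      ((p.1 : ℝ) : ℂ) = param μ) ∧
    (∀ (μ : ι → ℂ) (v : V), v ≠ 0 → HasWeight A μ v → ⁅Jtop, v⁆ = 0 →
      ∃ s : {s : ℝ // 0 < s}, ((s : ℝ) : ℂ) = param μ ∧ 0 < mult s ∧
        ∃ φ : (ℕ →₀ ℂ) →ₗ[ℂ] V, IsSo21Hom J (D s) φ ∧ Function.Injective φ ∧
          φ (Finsupp.single 0 1) = v)

end Modules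

end KacMoody

end

open KacMoody

/-! The proof has two halves, the positivity of `N` and the decomposition of `V`.

Positivity. Since `det A ≠ 0`, the eigenvalues of the `h_i` determine the degree in the root
lattice. The algebra is therefore graded, with the Cartan subalgebra in degree zero, and ideals are
graded too. So the radical still meets the Cartan subalgebra trivially, and the `h_i` stay
independent, as their action on a Verma module shows. An induction on height gives `[x, y] ∈ ℂ H(β)`
for `x ∈ 𝔤_β`, `y ∈ 𝔤_{-β}` (`exists_lie_eq_smul_hVec`). The factor of proportionality defines a
bilinear form, whose invariance and symmetry are then checked (`IsRootForm`). With dual bases `a_i`,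
`b_i` of `𝔤_β`, `𝔤_{-β}`, it satisfies a Casimir-type identity (`casimir_identity`): the sum of
`-⟨[b_i, x] | [a_i, y]⟩` over all `0 < β < α` equals `(2 ht α - (α|α)) ⟨x|y⟩`. For `y = -ω(x)` and
orthonormal `a_i`, the sum consists of squared norms in root spaces of lower height. Real roots and
imaginary roots alike satisfy `(α|α) ≤ 2`, so the factor on the right is positive unless `α` is
simple. Induction on height makes `⟨x | -ω(y)⟩` positive definite on `𝔤_α` (`apply_pos`), and `N` is
the squared norm of `E`.

Decomposition. A weight vector killed by `J⁺` generates a ladder that matches `𝒟_s⁻` after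
normalization, provided that `s > 0`. Take a basis of `ker J⁺` made of weight vectors and map the
direct sum of the corresponding modules `𝒟_s⁻` to `V`. `J⁺` is locally nilpotent on both sides and
surjective on the source. The map is injective because it is injective on the kernel of `J⁺`, and
surjective because a vector can be corrected, after lifting its image under `J⁺`, by an element of
`ker J⁺`. No hermitian form on `V` is needed.

Hyperbolicity enters twice, in each case with reflections realized by `sl₂`-strings. First, `s > 0`:
simultaneous reflection of `α` and of the weight reduces to the case that `α` is antidominant, where
the claim follows from the full support of `α` (`level_pos`). Second, multiplicities are finite:
weights `Λ - β` satisfy `(β|β) ≤ 2 Λ·β`, while the form is positive definite on the orthogonal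
complement of the timelike `α`, so only finitely many weights have a given pairing with `α`
(`finite_level`).

Lowest weight modules become highest weight modules when the `e_i` and `f_i` are exchanged. -/

set_option linter.unusedSectionVars false

noncomputable section

namespace KacMoody

/-! ### Joint eigenvectors of a family of operators -/

section JointEigenvectors

variable {ι V K : Type*} [AddCommGroup V] [Module ℂ V] (T : ι → V →ₗ[ℂ] V)

/-- Lagrange interpolation: `R` is a product of factors `(μ_i - w_k(i))⁻¹ (T_i - w_k(i))`, one for
each `k ∈ t`, with `i` chosen so that the two eigenvalues differ. As a polynomial in the `T_i` it
preserves every stable subspace. -/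
theorem exists_isolating_operator (x : K → V) (w : K → ι → ℂ)
    (hx : ∀ k i, T i (x k) = w k i • x k) (μ : ι → ℂ) (t : Finset K) (ht : ∀ k ∈ t, w k ≠ μ) :
    ∃ R : V →ₗ[ℂ] V, (∀ v, (∀ i, T i v = μ i • v) → R v = v) ∧ (∀ k ∈ t, R (x k) = 0) ∧
      ∀ p : Submodule ℂ V, (∀ i, ∀ y ∈ p, T i y ∈ p) → ∀ y ∈ p, R y ∈ p := by
  classical
  induction t using Finset.induction_on with
  | empty => exact ⟨LinearMap.id, fun _ _ => rfl, by simp, fun _ _ y hy => hy⟩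
  | insert k t hk ih =>
    obtain ⟨R, h1, h2, h3⟩ := ih fun k hk => ht k (Finset.mem_insert_of_mem hk)
    obtain ⟨i, hi⟩ : ∃ i, w k i ≠ μ i := by
      by_contra! hcon
      exact ht k (Finset.mem_insert_self k t) (funext hcon)
    have hi' : μ i - w k i ≠ 0 := sub_ne_zero.mpr hi.symm
    refine ⟨R ∘ₗ ((μ i - w k i)⁻¹ • (T i - w k i • LinearMap.id)), ?_, ?_, ?_⟩
    · intro v hv
      simp only [LinearMap.comp_apply, LinearMap.smul_apply, LinearMap.sub_apply,
        LinearMap.id_apply, hv i, ← sub_smul, smul_smul, inv_mul_cancel₀ hi', one_smul]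
      exact h1 v hv
    · intro l hl
      simp only [LinearMap.comp_apply, LinearMap.smul_apply, LinearMap.sub_apply,
        LinearMap.id_apply, hx l i, ← sub_smul, smul_smul, map_smul]
      rcases Finset.mem_insert.mp hl with rfl | hl
      · simp
      · rw [h2 l hl, smul_zero]
    · intro p hp y hy
      exact h3 p hp _ (p.smul_mem _ (p.sub_mem (hp i y hy) (p.smul_mem _ hy)))

/-- The last clause is the reason that ideals, submodules and kernels are graded: an isolating
operator extracts each component without leaving a stable subspace. -/
theorem exists_weight_decomposition (x : K → V) (w : K → ι → ℂ)
    (hx : ∀ k i, T i (x k) = w k i • x k) {v : V} (hv : v ∈ Submodule.span ℂ (Set.range x)) :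
    ∃ (F : Finset (ι → ℂ)) (c : (ι → ℂ) → V), v = ∑ μ ∈ F, c μ ∧
      (∀ μ, c μ ∈ Submodule.span ℂ (x '' {k | w k = μ})) ∧
      ∀ p : Submodule ℂ V, (∀ i, ∀ y ∈ p, T i y ∈ p) → v ∈ p → ∀ μ ∈ F, c μ ∈ p := by
  classical
  obtain ⟨a, rfl⟩ := (Finsupp.mem_span_range_iff_exists_finsupp).mp hv
  refine ⟨a.support.image w, fun μ => ∑ k ∈ a.support with w k = μ, a k • x k, ?_, ?_, ?_⟩
  · rw [Finsupp.sum]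
    exact (Finset.sum_fiberwise_of_maps_to (fun k hk => Finset.mem_image_of_mem w hk) _).symm
  · intro μ
    refine Submodule.sum_mem _ fun k hk => Submodule.smul_mem _ _ (Submodule.subset_span ?_)
    exact ⟨k, (Finset.mem_filter.mp hk).2, rfl⟩
  · intro p hp hvp μ _
    obtain ⟨R, h1, h2, h3⟩ := exists_isolating_operator T x w hx μ
      (a.support.filter fun k => w k ≠ μ) fun k hk => (Finset.mem_filter.mp hk).2
    have h4 := h3 p hp _ hvp
    rw [Finsupp.sum, ← Finset.sum_filter_add_sum_filter_not a.support (fun k => w k = μ), map_add,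
      map_sum, map_sum] at h4
    rw [Finset.sum_eq_zero (s := a.support.filter fun k => w k ≠ μ)
      (fun k hk => by rw [map_smul, h2 k hk, smul_zero]), add_zero] at h4
    convert h4 using 2 with k hk
    rw [map_smul, h1 (x k)]
    intro i
    rw [hx, (Finset.mem_filter.mp hk).2]

theorem apply_eq_smul_of_mem_span (x : K → V) (w : K → ι → ℂ)
    (hx : ∀ k i, T i (x k) = w k i • x k) {μ : ι → ℂ} {v : V}
    (hv : v ∈ Submodule.span ℂ (x '' {k | w k = μ})) (i : ι) : T i v = μ i • v := by
  induction hv using Submodule.span_induction with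
  | mem _ h => obtain ⟨k, hk, rfl⟩ := h; rw [hx, hk]
  | zero => simp
  | add y z _ _ hy hz => rw [map_add, hy, hz, smul_add]
  | smul a y _ hy => rw [map_smul, hy, smul_comm]

theorem eq_zero_of_two_weights {μ ν : ι → ℂ} (hμν : μ ≠ ν) {v : V} (h1 : ∀ i, T i v = μ i • v)
    (h2 : ∀ i, T i v = ν i • v) : v = 0 := by
  by_contra hv
  exact hμν (funext fun i => smul_left_injective ℂ hv ((h1 i).symm.trans (h2 i)))

theorem mem_span_of_weight (x : K → V) (w : K → ι → ℂ)
    (hx : ∀ k i, T i (x k) = w k i • x k) {v : V} (hv : v ∈ Submodule.span ℂ (Set.range x))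
    {μ : ι → ℂ} (hμ : ∀ i, T i v = μ i • v) : v ∈ Submodule.span ℂ (x '' {k | w k = μ}) := by
  obtain ⟨F, c, rfl, h2, h3⟩ := exists_weight_decomposition T x w hx hv
  -- Applied to the eigenspace of `μ` itself as stable subspace, the decomposition puts every
  -- component of weight `ν ≠ μ` in two eigenspaces.
  let p : Submodule ℂ V :=
    { carrier := {y | ∀ i, T i y = μ i • y}
      add_mem' := fun {a b} ha hb i => by rw [map_add, ha i, hb i, smul_add]
      zero_mem' := fun i => by simp
      smul_mem' := fun a y hy i => by rw [map_smul, hy i, smul_comm] }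
  have hp : ∀ i, ∀ y ∈ p, T i y ∈ p := fun i y hy => by
    rw [show T i y = μ i • y from hy i]
    exact p.smul_mem _ hy
  refine Submodule.sum_mem _ fun ν hν => ?_
  by_cases h : ν = μ
  · exact h ▸ h2 ν
  · have h5 : c ν = 0 := eq_zero_of_two_weights T h
      (apply_eq_smul_of_mem_span T x w hx (h2 ν)) (h3 p hp hμ ν hν)
    rw [h5]
    exact zero_mem _

end JointEigenvectors

/-! ### Weight spaces -/

section WeightSpaces

variable {ι L V : Type*} [LieRing L] [LieAlgebra ℂ L] [AddCommGroup V] [Module ℂ V]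
  [LieRingModule L V] [LieModule ℂ L V]

/-- The space of vectors on which each `h i` acts as the scalar `μ i`. -/
def wtSpace (V : Type*) [AddCommGroup V] [Module ℂ V] [LieRingModule L V] [LieModule ℂ L V]
    (h : ι → L) (μ : ι → ℂ) : Submodule ℂ V where
  carrier := {v | ∀ i, ⁅h i, v⁆ = μ i • v}
  add_mem' := fun {a b} ha hb i => by rw [lie_add, ha i, hb i, smul_add]
  zero_mem' := fun i => by rw [lie_zero, smul_zero]
  smul_mem' := fun a y hy i => by rw [lie_smul, hy i, smul_comm]

theorem mem_wtSpace {h : ι → L} {μ : ι → ℂ} {v : V} :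
    v ∈ wtSpace V h μ ↔ ∀ i, ⁅h i, v⁆ = μ i • v := Iff.rfl

theorem wtSpace_neg (h : ι → L) (μ : ι → ℂ) :
    wtSpace V (fun i => - h i) μ = wtSpace V h (-μ) := by
  ext v
  simp only [mem_wtSpace, neg_lie, Pi.neg_apply, neg_smul, neg_eq_iff_eq_neg]

theorem lie_mem_wtSpace {h : ι → L} {μ ν : ι → ℂ} {x : L} {v : V} (hx : x ∈ wtSpace L h μ)
    (hv : v ∈ wtSpace V h ν) : ⁅x, v⁆ ∈ wtSpace V h (μ + ν) := by
  intro i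
  rw [leibniz_lie, hx i, hv i, smul_lie, lie_smul, Pi.add_apply, add_smul]

theorem mem_span_of_mem_wtSpace {K : Type*} {h : ι → L} {x : K → V} {w : K → ι → ℂ}
    (hx : ∀ k, x k ∈ wtSpace V h (w k)) (htop : Submodule.span ℂ (Set.range x) = ⊤)
    {μ : ι → ℂ} {v : V} (hv : v ∈ wtSpace V h μ) :
    v ∈ Submodule.span ℂ (x '' {k | w k = μ}) :=
  mem_span_of_weight (fun i => LieModule.toEnd ℂ L V (h i)) x w hx (htop ▸ Submodule.mem_top) hv

end WeightSpaces

/-! ### Lie algebras with Chevalley generators -/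

section Chevalley

variable {ι : Type*} [DecidableEq ι]

/-- The Lie algebra `L` is generated by elements `e i`, `f i` that satisfy, together with the
elements `h i`, the Chevalley relations for the matrix `A`. -/
structure IsChevalley {L : Type*} [LieRing L] [LieAlgebra ℂ L] (A : Matrix ι ι ℤ)
    (h e f : ι → L) : Prop where
  hh : ∀ i j, ⁅h i, h j⁆ = 0
  ef : ∀ i j, ⁅e i, f j⁆ = if i = j then h i else 0
  he : ∀ i j, ⁅h i, e j⁆ = (A i j : ℂ) • e j
  hf : ∀ i j, ⁅h i, f j⁆ = -((A i j : ℂ) • f j)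
  gen : ∀ K : LieSubalgebra ℂ L, (∀ i, e i ∈ K) → (∀ i, f i ∈ K) → K = ⊤

/-- The weight `∑ β_i α_i`, by its values on the `h_i`. -/
def rootWeight [Fintype ι] (A : Matrix ι ι ℤ) (β : ι → ℤ) : ι → ℂ := fun i => ((A.mulVec β i : ℤ) : ℂ)

/-- The vector obtained from `v` by applying the elements `x i`, for `i` in the list `l`. -/
def word {L V : Type*} [Bracket L V] (x : ι → L) (l : List ι) (v : V) : V :=
  l.foldr (fun i y => ⁅x i, y⁆) v

/-- The multiplicities of the letters of a list. -/
def content (l : List ι) : ι → ℤ := fun i => l.count i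

@[simp] theorem content_nil : content ([] : List ι) = 0 := by
  ext; simp [content]

@[simp] theorem content_cons (j : ι) (l : List ι) :
    content (j :: l) = content l + Pi.single j 1 := by
  ext i
  by_cases hij : j = i
  · subst hij; simp [content]
  · simp [content, List.count_cons_of_ne hij, Pi.single_eq_of_ne (Ne.symm hij)]

theorem content_nonneg (l : List ι) : 0 ≤ content l := fun i => by simp [content]

theorem finite_content_eq [Fintype ι] (β : ι → ℤ) : {l : List ι | content l = β}.Finite := by
  refine (List.finite_length_eq ι (∑ i, β i).toNat).subset fun l hl => ?_
  rw [Set.mem_ofPred_eq] at hl ⊢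
  have h1 : ∑ i, content l i = l.length := by
    clear hl
    induction l with
    | nil => simp
    | cons j l ih => simp [Finset.sum_add_distrib, ih]
  rw [← hl, h1, Int.toNat_natCast]

section

variable [Fintype ι] {A : Matrix ι ι ℤ}

@[simp] theorem rootWeight_zero : rootWeight A 0 = 0 := by ext; simp [rootWeight]

theorem rootWeight_add (β γ : ι → ℤ) :
    rootWeight A (β + γ) = rootWeight A β + rootWeight A γ := by
  ext; simp [rootWeight, Matrix.mulVec_add]

theorem rootWeight_neg (β : ι → ℤ) : rootWeight A (-β) = - rootWeight A β := by
  ext; simp [rootWeight, Matrix.mulVec_neg]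

theorem rootWeight_sub (β γ : ι → ℤ) :
    rootWeight A (β - γ) = rootWeight A β - rootWeight A γ := by
  rw [sub_eq_add_neg, rootWeight_add, rootWeight_neg, sub_eq_add_neg]

theorem rootWeight_single (i j : ι) : rootWeight A (Pi.single j 1) i = A i j := by
  simp [rootWeight]

/-- This is the role of the nondegeneracy of `A`: the joint eigenspaces of the `h_i` are exactly the
homogeneous parts for the root lattice grading, so no derivations have to be adjoined to the Cartan
subalgebra. -/
theorem rootWeight_injective (hdet : A.det ≠ 0) : Function.Injective (rootWeight A) := by
  intro β γ hβγ
  refine Matrix.mulVec_injective_of_det_ne_zero hdet ?_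
  funext i
  exact Int.cast_injective (α := ℂ) (congrFun hβγ i)

end

namespace IsChevalley

variable {L : Type*} [LieRing L] [LieAlgebra ℂ L] {A : Matrix ι ι ℤ} {h e f : ι → L}
  {V : Type*} [AddCommGroup V] [Module ℂ V] [LieRingModule L V] [LieModule ℂ L V]

theorem fe (T : IsChevalley A h e f) (i j : ι) : ⁅f i, e j⁆ = if i = j then - h i else 0 := by
  rw [← lie_skew, T.ef]
  by_cases hij : i = j
  · simp [hij]
  · simp [hij, Ne.symm hij]

/-- The roles of the `e i` and `f i` may be exchanged. -/
theorem swap (T : IsChevalley A h e f) : IsChevalley A (fun i => - h i) f e where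
  hh i j := by simp [T.hh]
  ef i j := T.fe i j
  he i j := by simp [T.hf]
  hf i j := by simp [T.he]
  gen K h1 h2 := T.gen K h2 h1

theorem lie_mem_of_forall (T : IsChevalley A h e f) (S : Submodule ℂ V)
    (he : ∀ i, ∀ y ∈ S, ⁅e i, y⁆ ∈ S) (hf : ∀ i, ∀ y ∈ S, ⁅f i, y⁆ ∈ S) (x : L) :
    ∀ y ∈ S, ⁅x, y⁆ ∈ S := by
  let K : LieSubalgebra ℂ L :=
    { carrier := {x | ∀ y ∈ S, ⁅x, y⁆ ∈ S}
      add_mem' := fun {a b} ha hb y hy => by rw [add_lie]; exact S.add_mem (ha y hy) (hb y hy)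
      zero_mem' := fun y _ => by rw [zero_lie]; exact S.zero_mem
      smul_mem' := fun c a ha y hy => by rw [smul_lie]; exact S.smul_mem c (ha y hy)
      lie_mem' := fun {a b} ha hb y hy => by
        rw [lie_lie]; exact S.sub_mem (ha _ (hb y hy)) (hb _ (ha y hy)) }
  have : x ∈ K := by rw [T.gen K he hf]; trivial
  exact this

theorem eq_top_of_forall (T : IsChevalley A h e f) (S : Submodule ℂ L)
    (he : ∀ i, ∀ y ∈ S, ⁅e i, y⁆ ∈ S) (hf : ∀ i, ∀ y ∈ S, ⁅f i, y⁆ ∈ S)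
    (he' : ∀ i, e i ∈ S) (hf' : ∀ i, f i ∈ S) : S = ⊤ := by
  let K : LieSubalgebra ℂ L :=
    { S with lie_mem' := fun {a b} _ hb => T.lie_mem_of_forall S he hf a b hb }
  have : K = ⊤ := T.gen K he' hf'
  exact congrArg LieSubalgebra.toSubmodule this

/-- Moving `e_i` to the right past each `f_j` costs only a term `h_i`, which acts on words by
scalars modulo vectors already in `S`. The subspace `S` is left free so that the same argument
serves modules and the adjoint representation. -/
theorem lie_e_words (T : IsChevalley A h e f) {μ : ι → ℂ} {v : V} (hv : v ∈ wtSpace V h μ)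
    (S : Submodule ℂ V) (hS : ∀ i, ∀ y ∈ S, ⁅f i, y⁆ ∈ S) (hvS : v ∈ S)
    (hev : ∀ i, ⁅e i, v⁆ ∈ S) (i : ι) (l : List ι) : ⁅e i, word f l v⁆ ∈ S := by
  have hw : ∀ l, word f l v ∈ S := fun l => by
    induction l with
    | nil => exact hvS
    | cons j l ih => exact hS j _ ih
  have hh : ∀ i l, ⁅h i, word f l v⁆ ∈ S := fun i l => by
    induction l with
    | nil => exact hv i ▸ S.smul_mem _ hvS
    | cons j l ih =>
      change ⁅h i, ⁅f j, word f l v⁆⁆ ∈ S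
      rw [leibniz_lie, T.hf, neg_lie, smul_lie]
      exact S.add_mem (S.neg_mem (S.smul_mem _ (hS _ _ (hw l)))) (hS _ _ ih)
  induction l with
  | nil => exact hev i
  | cons j l ih =>
    change ⁅e i, ⁅f j, word f l v⁆⁆ ∈ S
    rw [leibniz_lie, T.ef]
    refine S.add_mem ?_ (hS _ _ ih)
    split_ifs
    · exact hh i l
    · rw [zero_lie]
      exact S.zero_mem

theorem span_words_isLieStable (T : IsChevalley A h e f) {μ : ι → ℂ} {v : V}
    (hv : v ∈ wtSpace V h μ) (hev : ∀ i, ⁅e i, v⁆ = 0) (x : L) :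
    ∀ y ∈ Submodule.span ℂ (Set.range fun l => word f l v),
      ⁅x, y⁆ ∈ Submodule.span ℂ (Set.range fun l => word f l v) := by
  have hS : ∀ i, ∀ y ∈ Submodule.span ℂ (Set.range fun l => word f l v),
      ⁅f i, y⁆ ∈ Submodule.span ℂ (Set.range fun l => word f l v) := by
    intro i y hy
    induction hy using Submodule.span_induction with
    | mem _ h => obtain ⟨l, rfl⟩ := h; exact Submodule.subset_span ⟨i :: l, rfl⟩
    | zero => rw [lie_zero]; exact zero_mem _
    | add y z _ _ hy hz => rw [lie_add]; exact add_mem hy hz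
    | smul a y _ hy => rw [lie_smul]; exact Submodule.smul_mem _ _ hy
  refine T.lie_mem_of_forall _ ?_ hS x
  intro i y hy
  induction hy using Submodule.span_induction with
  | mem _ h =>
    obtain ⟨l, rfl⟩ := h
    refine T.lie_e_words hv _ hS (Submodule.subset_span ⟨[], rfl⟩) (fun i => ?_) i l
    rw [hev]
    exact zero_mem _
  | zero => rw [lie_zero]; exact zero_mem _
  | add y z _ _ hy hz => rw [lie_add]; exact add_mem hy hz
  | smul a y _ hy => rw [lie_smul]; exact Submodule.smul_mem _ _ hy

/-- The spanning set formed by the `e`-words, the `h i` and the `f`-words. -/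
def generator (h e f : ι → L) : (List ι × ι) ⊕ ι ⊕ (List ι × ι) → L
  | .inl (l, i) => word e l (e i)
  | .inr (.inl i) => h i
  | .inr (.inr (l, i)) => word f l (f i)

theorem lie_e_generator (T : IsChevalley A h e f) (i : ι) (k) :
    ⁅e i, generator h e f k⁆ ∈ Submodule.span ℂ (Set.range (generator h e f)) := by
  set S := Submodule.span ℂ (Set.range (generator h e f)) with hSdef
  rcases k with ⟨l, j⟩ | j | ⟨l, j⟩
  · exact Submodule.subset_span ⟨.inl (i :: l, j), rfl⟩
  · change ⁅e i, h j⁆ ∈ S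
    rw [← lie_skew, T.he]
    exact neg_mem (Submodule.smul_mem _ _ (Submodule.subset_span ⟨.inl ([], i), rfl⟩))
  -- An `e_i` applied to an `f`-word cannot leave the span of the `h_j` and the `f`-words; this is
  -- `lie_e_words` in the adjoint representation with starting vector `f j`.
  · let S' := Submodule.span ℂ (Set.range fun k => generator h e f (.inr k))
    have hle : S' ≤ S := Submodule.span_mono (by rintro _ ⟨k, rfl⟩; exact ⟨_, rfl⟩)
    refine hle (T.lie_e_words (V := L) (μ := fun i => -(A i j : ℂ)) ?_ S' ?_ ?_ ?_ i l)
    · intro i; rw [T.hf, neg_smul]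
    · intro i y hy
      induction hy using Submodule.span_induction with
      | mem _ h =>
        obtain ⟨k | ⟨l, k⟩, rfl⟩ := h
        · change ⁅f i, h k⁆ ∈ S'
          rw [← lie_skew, T.hf, neg_neg]
          exact Submodule.smul_mem _ _ (Submodule.subset_span ⟨.inr ([], i), rfl⟩)
        · exact Submodule.subset_span ⟨.inr (i :: l, k), rfl⟩
      | zero => rw [lie_zero]; exact zero_mem _
      | add y z _ _ hy hz => rw [lie_add]; exact add_mem hy hz
      | smul a y _ hy => rw [lie_smul]; exact Submodule.smul_mem _ _ hy
    · exact Submodule.subset_span ⟨.inr ([], j), rfl⟩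
    · intro i
      rw [T.ef]
      split_ifs
      · exact Submodule.subset_span ⟨.inl i, rfl⟩
      · exact zero_mem _

theorem span_generator_swap :
    Submodule.span ℂ (Set.range (generator (fun i => - h i) f e)) ≤
      Submodule.span ℂ (Set.range (generator h e f)) := by
  refine Submodule.span_le.mpr ?_
  rintro _ ⟨⟨l, j⟩ | j | ⟨l, j⟩, rfl⟩
  · exact Submodule.subset_span ⟨.inr (.inr (l, j)), rfl⟩
  · exact neg_mem (Submodule.subset_span ⟨.inr (.inl j), rfl⟩)
  · exact Submodule.subset_span ⟨.inl (l, j), rfl⟩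

/-- The spanning half of the triangular decomposition: the span contains the generators and is
stable under all `ad e_i` and, after exchanging the roles of `e` and `f`, under all `ad f_i`. -/
theorem span_generator (T : IsChevalley A h e f) :
    Submodule.span ℂ (Set.range (generator h e f)) = ⊤ := by
  have key : ∀ {h e f : ι → L}, IsChevalley A h e f → ∀ i,
      ∀ y ∈ Submodule.span ℂ (Set.range (generator h e f)),
        ⁅e i, y⁆ ∈ Submodule.span ℂ (Set.range (generator h e f)) := by
    intro h e f T i y hy
    induction hy using Submodule.span_induction with
    | mem _ h => obtain ⟨k, rfl⟩ := h; exact T.lie_e_generator i k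
    | zero => rw [lie_zero]; exact zero_mem _
    | add y z _ _ hy hz => rw [lie_add]; exact add_mem hy hz
    | smul a y _ hy => rw [lie_smul]; exact Submodule.smul_mem _ _ hy
  refine T.eq_top_of_forall _ (key T) (fun i y hy => ?_) (fun i => ?_) fun i => ?_
  · refine span_generator_swap (key T.swap i y ?_)
    have := span_generator_swap (h := fun i => - h i) (e := f) (f := e)
    simp only [neg_neg] at this
    exact this hy
  · exact Submodule.subset_span ⟨.inl ([], i), rfl⟩
  · exact Submodule.subset_span ⟨.inr (.inr ([], i)), rfl⟩

section

variable [Fintype ι]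

theorem e_mem (T : IsChevalley A h e f) (i : ι) :
    e i ∈ wtSpace L h (rootWeight A (Pi.single i 1)) := fun j => by
  rw [T.he, rootWeight_single]

theorem f_mem (T : IsChevalley A h e f) (i : ι) :
    f i ∈ wtSpace L h (rootWeight A (-Pi.single i 1)) := fun j => by
  rw [T.hf, rootWeight_neg, Pi.neg_apply, rootWeight_single, neg_smul]

theorem h_mem (T : IsChevalley A h e f) (i : ι) : h i ∈ wtSpace L h (rootWeight A 0) := fun j => by
  rw [T.hh, rootWeight_zero, Pi.zero_apply, zero_smul]

theorem word_e_mem (T : IsChevalley A h e f) {μ : ι → ℂ} {v : V} (hv : v ∈ wtSpace V h μ)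
    (l : List ι) : word e l v ∈ wtSpace V h (μ + rootWeight A (content l)) := by
  induction l with
  | nil => simpa [word] using hv
  | cons j l ih =>
    have := lie_mem_wtSpace (T.e_mem j) ih
    rw [content_cons, rootWeight_add, ← add_assoc, add_comm]
    exact this

theorem word_f_mem (T : IsChevalley A h e f) {μ : ι → ℂ} {v : V} (hv : v ∈ wtSpace V h μ)
    (l : List ι) : word f l v ∈ wtSpace V h (μ - rootWeight A (content l)) := by
  have := T.swap.word_e_mem (μ := -μ) (v := v) (by rwa [wtSpace_neg, neg_neg]) l
  rwa [wtSpace_neg, neg_add, neg_neg, ← sub_eq_add_neg] at this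

/-- The degree of a member of the spanning set. -/
def generatorDegree : (List ι × ι) ⊕ ι ⊕ (List ι × ι) → ι → ℤ
  | .inl (l, i) => Pi.single i 1 + content l
  | .inr (.inl _) => 0
  | .inr (.inr (l, i)) => - (Pi.single i 1 + content l)

theorem generator_mem (T : IsChevalley A h e f) (k) :
    generator h e f k ∈ wtSpace L h (rootWeight A (generatorDegree k)) := by
  rcases k with ⟨l, j⟩ | j | ⟨l, j⟩
  · have := T.word_e_mem (T.e_mem j) l
    rwa [← rootWeight_add] at this
  · exact T.h_mem j
  · have := T.word_f_mem (T.f_mem j) l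
    rwa [← rootWeight_sub, ← neg_add'] at this

theorem mem_span_generator (T : IsChevalley A h e f) (hdet : A.det ≠ 0) {β : ι → ℤ} {x : L}
    (hx : x ∈ wtSpace L h (rootWeight A β)) :
    x ∈ Submodule.span ℂ (generator h e f '' {k | generatorDegree k = β}) := by
  have := mem_span_of_mem_wtSpace T.generator_mem T.span_generator hx
  simpa only [(rootWeight_injective hdet).eq_iff] using this

theorem single_add_content_pos (i : ι) (l : List ι) : 0 < Pi.single i 1 + content l := by
  refine lt_of_lt_of_le ?_ (le_add_of_nonneg_right (content_nonneg l))
  exact Pi.single_pos.mpr one_pos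

theorem mem_span_h (T : IsChevalley A h e f) (hdet : A.det ≠ 0) {x : L}
    (hx : x ∈ wtSpace L h (rootWeight A 0)) : x ∈ Submodule.span ℂ (Set.range h) := by
  refine Submodule.span_mono ?_ (T.mem_span_generator hdet hx)
  rintro _ ⟨⟨l, j⟩ | j | ⟨l, j⟩, hk, rfl⟩
  · exact absurd hk (single_add_content_pos j l).ne'
  · exact ⟨j, rfl⟩
  · exact absurd (neg_eq_zero.mp hk) (single_add_content_pos j l).ne'

/-- No member of the spanning set has a degree with coefficients of both signs. -/
theorem pos_or_neg (T : IsChevalley A h e f) (hdet : A.det ≠ 0) {β : ι → ℤ} {x : L}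
    (hx : x ∈ wtSpace L h (rootWeight A β)) (hx0 : x ≠ 0) : β = 0 ∨ 0 < β ∨ β < 0 := by
  by_contra! hcon
  refine hx0 ?_
  have := T.mem_span_generator hdet hx
  rw [Set.eq_empty_of_forall_notMem (s := {k | generatorDegree k = β}), Set.image_empty,
    Submodule.span_empty] at this
  · exact this
  · rintro (⟨l, j⟩ | j | ⟨l, j⟩) rfl
    · exact hcon.2.1 (single_add_content_pos j l)
    · exact hcon.1 rfl
    · exact hcon.2.2 (neg_lt_zero.mpr (single_add_content_pos j l))

theorem mem_span_words (T : IsChevalley A h e f) (hdet : A.det ≠ 0) {β : ι → ℤ} (hβ : 0 < β)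
    {x : L} (hx : x ∈ wtSpace L h (rootWeight A β)) :
    x ∈ Submodule.span ℂ ((fun k : List ι × ι => word e k.1 (e k.2)) ''
      {k | Pi.single k.2 1 + content k.1 = β}) := by
  refine Submodule.span_mono ?_ (T.mem_span_generator hdet hx)
  rintro _ ⟨⟨l, j⟩ | j | ⟨l, j⟩, hk, rfl⟩
  · exact ⟨(l, j), hk, rfl⟩
  · exact absurd hk hβ.ne
  · have hk' : -(Pi.single j 1 + content l) = β := hk
    exact absurd (hk' ▸ hβ) (not_lt_of_gt (neg_lt_zero.mpr (single_add_content_pos j l)))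

theorem finiteDimensional (T : IsChevalley A h e f) (hdet : A.det ≠ 0) {β : ι → ℤ} (hβ : 0 < β) :
    FiniteDimensional ℂ (wtSpace L h (rootWeight A β)) := by
  have hfin : {k : List ι × ι | Pi.single k.2 1 + content k.1 = β}.Finite := by
    refine (Set.Finite.subset (Set.Finite.biUnion (Set.finite_univ (α := ι)) fun i _ =>
      (finite_content_eq (β - Pi.single i 1)).image fun l => (l, i)) ?_)
    rintro ⟨l, i⟩ hk
    simp only [Set.mem_iUnion]
    exact ⟨i, trivial, l, eq_sub_of_add_eq' hk, rfl⟩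
  have := FiniteDimensional.span_of_finite ℂ
    (hfin.image fun k : List ι × ι => word e k.1 (e k.2))
  exact Submodule.finiteDimensional_of_le fun x hx => T.mem_span_words hdet hβ hx

/-- The induction principle for all arguments on height: `𝔤_β` is spanned by the brackets `[e_i, y]`
with `y` of degree `β - α_i`. The case `β = 2 α_i` may be excluded in `h2` because the only word of
that degree is `[e_i, e_i] = 0`. -/
theorem root_induction (T : IsChevalley A h e f) (hdet : A.det ≠ 0) {β : ι → ℤ} (hβ : 0 < β)
    (p : Submodule ℂ L) (h1 : ∀ i, β = Pi.single i 1 → e i ∈ p)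
    (h2 : ∀ i, 0 < β - Pi.single i 1 → β - Pi.single i 1 ≠ Pi.single i 1 →
      ∀ y ∈ wtSpace L h (rootWeight A (β - Pi.single i 1)), ⁅e i, y⁆ ∈ p) :
    wtSpace L h (rootWeight A β) ≤ p := by
  intro x hx
  refine Submodule.span_le.mpr ?_ (T.mem_span_words hdet hβ hx)
  rintro _ ⟨⟨_ | ⟨i, l⟩, j⟩, hk, rfl⟩
  · exact h1 j (by simpa using hk.symm)
  · have hk' : β - Pi.single i 1 = Pi.single j 1 + content l := by
      rw [← show _ = β from hk, content_cons]; abel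
    have hmem : word e l (e j) ∈ wtSpace L h (rootWeight A (β - Pi.single i 1)) := by
      have := T.generator_mem (.inl (l, j))
      rw [hk']; exact this
    by_cases hs : β - Pi.single i 1 = Pi.single i 1
    · have hl : l = [] ∧ j = i := by
        have h3 : (Pi.single i 1 : ι → ℤ) = Pi.single j 1 + content l := hs.symm.trans hk'
        have h4 : j = i := by
          by_contra hne
          have := congrFun h3 j
          have h5 := content_nonneg l j
          simp [Pi.single_eq_of_ne hne] at this
          simp at h5
          omega
        subst h4
        refine ⟨?_, rfl⟩
        have h6 : content l = 0 := by simpa using h3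
        refine List.eq_nil_iff_forall_not_mem.mpr fun a ha => ?_
        have := congrFun h6 a
        exact (List.count_pos_iff.mpr ha).ne' (Int.natCast_eq_zero.mp this)
      obtain ⟨rfl, rfl⟩ := hl
      change ⁅e j, e j⁆ ∈ p
      rw [lie_self]; exact zero_mem _
    · refine h2 i ?_ hs _ hmem
      rw [hk']; exact single_add_content_pos j l

theorem wtSpace_simple_le (T : IsChevalley A h e f) (hdet : A.det ≠ 0) (i : ι) :
    wtSpace L h (rootWeight A (Pi.single i 1)) ≤ Submodule.span ℂ {e i} := by
  refine T.root_induction hdet (Pi.single_pos.mpr one_pos) _ (fun j hj => ?_) fun j hj => ?_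
  · have : j = i := by
      by_contra hne
      have := congrFun hj j
      simp [Pi.single_eq_of_ne hne] at this
    exact this ▸ Submodule.subset_span rfl
  · exfalso
    have h1 : (0 : ℤ) ≤ (Pi.single i 1 - Pi.single j 1 : ι → ℤ) j := hj.le j
    have : j = i := by
      by_contra hne
      simp [Pi.single_eq_of_ne hne] at h1
    rw [this, sub_self] at hj
    exact lt_irrefl _ hj

/-- Only the letter `i` can occur in a word of degree `m α_i`, and such a word contains `[e_i,
e_i]`. -/
theorem eq_zero_of_mem_multiple (T : IsChevalley A h e f) (hdet : A.det ≠ 0) (i : ι) {m : ℤ}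
    (hm : 2 ≤ m) {x : L} (hx : x ∈ wtSpace L h (rootWeight A (Pi.single i m))) : x = 0 := by
  have hmain : ∀ n : ℕ, wtSpace L h (rootWeight A (Pi.single i (n + 2 : ℤ))) ≤ ⊥ := by
    intro n
    induction n with
    | zero =>
      refine T.root_induction hdet (Pi.single_pos.mpr (by simp)) _ (fun j hj => ?_)
        fun j hj hne => ?_
      · exfalso
        have := congrFun hj i
        by_cases h : i = j
        · subst h; simp at this
        · simp [Pi.single_eq_of_ne h] at this
      · exfalso
        have h1 : (0 : ℤ) ≤ (Pi.single i ((0 : ℕ) + 2 : ℤ) - Pi.single j 1 : ι → ℤ) j := hj.le j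
        have : j = i := by
          by_contra hne
          simp [Pi.single_eq_of_ne hne] at h1
        subst this
        refine hne ?_
        rw [← Pi.single_sub]
        norm_num
    | succ n ih =>
      refine T.root_induction hdet (Pi.single_pos.mpr (by positivity)) _ (fun j hj => ?_)
        fun j hj hne y hy => ?_
      · exfalso
        have := congrFun hj i
        by_cases h : i = j
        · subst h; simp at this; omega
        · simp [Pi.single_eq_of_ne h] at this; omega
      · have h1 : (0 : ℤ) ≤ (Pi.single i ((n + 1 : ℕ) + 2 : ℤ) - Pi.single j 1 : ι → ℤ) j := hj.le j
        have : j = i := by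
          by_contra hne
          simp [Pi.single_eq_of_ne hne] at h1
        subst this
        rw [← Pi.single_sub, show ((n + 1 : ℕ) + 2 : ℤ) - 1 = n + 2 by push_cast; ring] at hy
        rw [(Submodule.mem_bot ℂ).mp (ih hy), lie_zero]
        exact zero_mem _
  have := hmain (m - 2).toNat
  rw [show (((m - 2).toNat : ℕ) + 2 : ℤ) = m by omega] at this
  exact (Submodule.mem_bot ℂ).mp (this hx)

end

end IsChevalley

end Chevalley

/-! ### Verma modules, realized on words, and independence of the `h_i` -/

section Verma

variable {ι : Type*} [Fintype ι] [DecidableEq ι] (A : Matrix ι ι ℤ) (lam : ι → ℂ)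

/-- The weight of the basis vector of the Verma module with the given label. -/
def vermaWeight (l : List ι) (i : ι) : ℂ := lam i - rootWeight A (content l) i

theorem vermaWeight_cons (j : ι) (l : List ι) (i : ι) :
    vermaWeight A lam (j :: l) i = vermaWeight A lam l i - A i j := by
  simp only [vermaWeight, content_cons, rootWeight_add, Pi.add_apply, rootWeight_single]
  ring

/-- The action of `f_j` on the Verma module. -/
def vermaF (j : ι) : Module.End ℂ (List ι →₀ ℂ) :=
  Finsupp.linearCombination ℂ fun l => Finsupp.single (j :: l) 1

/-- The action of `h_i` on the Verma module. -/
def vermaH (i : ι) : Module.End ℂ (List ι →₀ ℂ) :=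
  Finsupp.linearCombination ℂ fun l => vermaWeight A lam l i • Finsupp.single l 1

/-- The action of `e_i` on the basis vectors of the Verma module. -/
def vermaEAux (i : ι) : List ι → (List ι →₀ ℂ)
  | [] => 0
  | j :: l => vermaF j (vermaEAux i l) +
      if i = j then vermaWeight A lam l i • Finsupp.single l 1 else 0

/-- The action of `e_i` on the Verma module. -/
def vermaE (i : ι) : Module.End ℂ (List ι →₀ ℂ) :=
  Finsupp.linearCombination ℂ (vermaEAux A lam i)

theorem vermaF_single (j : ι) (l : List ι) :
    vermaF j (Finsupp.single l 1) = Finsupp.single (j :: l) 1 := by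
  simp [vermaF]

theorem vermaH_single (i : ι) (l : List ι) :
    vermaH A lam i (Finsupp.single l 1) = vermaWeight A lam l i • Finsupp.single l 1 := by
  simp only [vermaH, Finsupp.linearCombination_single, one_smul]

theorem vermaE_single (i : ι) (l : List ι) :
    vermaE A lam i (Finsupp.single l 1) = vermaEAux A lam i l := by
  simp only [vermaE, Finsupp.linearCombination_single, one_smul]

theorem vermaH_lie_vermaH (i j : ι) : vermaH A lam i * vermaH A lam j - vermaH A lam j * vermaH A lam i = 0 := by
  refine Finsupp.lhom_ext' fun l => LinearMap.ext_ring ?_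
  simp only [LinearMap.comp_apply, Finsupp.lsingle_apply, LinearMap.sub_apply,
    Module.End.mul_apply, vermaH_single, map_smul, smul_smul, LinearMap.zero_apply, mul_comm,
    sub_self]

theorem vermaE_lie_vermaF (i j : ι) :
    vermaE A lam i * vermaF j - vermaF j * vermaE A lam i = if i = j then vermaH A lam i else 0 := by
  refine Finsupp.lhom_ext' fun l => LinearMap.ext_ring ?_
  simp only [LinearMap.comp_apply, Finsupp.lsingle_apply, LinearMap.sub_apply,
    Module.End.mul_apply, vermaF_single, vermaE_single, vermaEAux, add_sub_cancel_left]
  split_ifs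
  · rw [vermaH_single]
  · rfl

theorem vermaH_lie_vermaF (i j : ι) :
    vermaH A lam i * vermaF j - vermaF j * vermaH A lam i = -((A i j : ℂ) • vermaF j) := by
  refine Finsupp.lhom_ext' fun l => LinearMap.ext_ring ?_
  simp only [LinearMap.comp_apply, Finsupp.lsingle_apply, LinearMap.sub_apply,
    Module.End.mul_apply, vermaF_single, vermaH_single, map_smul, vermaWeight_cons,
    LinearMap.neg_apply, LinearMap.smul_apply]
  rw [← sub_smul, ← neg_smul]
  congr 1
  ring

theorem vermaH_vermaEAux (i j : ι) (l : List ι) :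
    vermaH A lam i (vermaEAux A lam j l) =
      (vermaWeight A lam l i + A i j) • vermaEAux A lam j l := by
  induction l with
  | nil => simp [vermaEAux]
  | cons k l ih =>
    have h1 := DFunLike.congr_fun (vermaH_lie_vermaF A lam i k) (vermaEAux A lam j l)
    simp only [LinearMap.sub_apply, Module.End.mul_apply, ih, map_smul,
      LinearMap.neg_apply, LinearMap.smul_apply] at h1
    rw [vermaEAux, map_add, eq_add_of_sub_eq h1, smul_add, ← neg_smul, ← add_smul,
      vermaWeight_cons]
    congr 1
    · congr 1
      ring
    · split_ifs with hjk
      · rw [map_smul, vermaH_single, smul_comm, hjk]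
        congr 1
        ring
      · rw [map_zero, smul_zero]

theorem vermaH_lie_vermaE (i j : ι) :
    vermaH A lam i * vermaE A lam j - vermaE A lam j * vermaH A lam i = (A i j : ℂ) • vermaE A lam j := by
  refine Finsupp.lhom_ext' fun l => LinearMap.ext_ring ?_
  simp only [LinearMap.comp_apply, Finsupp.lsingle_apply, LinearMap.sub_apply,
    Module.End.mul_apply, vermaE_single, vermaH_single, map_smul, vermaH_vermaEAux,
    LinearMap.smul_apply]
  rw [← sub_smul]
  congr 1
  ring

attribute [local instance] LieRing.ofAssociativeRing

/-- The action of the generators on the Verma module. -/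
def vermaGen : CartanMatrix.Generators ι → Module.End ℂ (List ι →₀ ℂ)
  | .H i => vermaH A lam i
  | .E i => vermaE A lam i
  | .F i => vermaF i

theorem chevalleyIdeal_le_ker_verma :
    chevalleyIdeal A ≤ (FreeLieAlgebra.lift ℂ (vermaGen A lam)).ker := by
  refine LieSubmodule.lieSpan_le.mpr ?_
  rintro x (((⟨⟨i, j⟩, rfl⟩ | ⟨⟨i, j⟩, rfl⟩) | ⟨⟨i, j⟩, rfl⟩) | ⟨⟨i, j⟩, rfl⟩)
  all_goals
    rw [SetLike.mem_coe, LieHom.mem_ker]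
  · simp [CartanMatrix.Relations.HH, FreeLieAlgebra.lift_of_apply, vermaGen, LieRing.of_associative_ring_bracket, vermaH_lie_vermaH]
  · by_cases hij : i = j
    · subst hij
      simp [CartanMatrix.Relations.EF, FreeLieAlgebra.lift_of_apply, vermaGen, LieRing.of_associative_ring_bracket,
        vermaE_lie_vermaF]
    · simp [CartanMatrix.Relations.EF, FreeLieAlgebra.lift_of_apply, vermaGen, LieRing.of_associative_ring_bracket,
        vermaE_lie_vermaF,
        hij]
  · simp only [CartanMatrix.Relations.HE, Function.uncurry, Function.comp_apply,
      ← Int.cast_smul_eq_zsmul ℂ, map_sub, map_smul, LieHom.map_lie, FreeLieAlgebra.lift_of_apply,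
      vermaGen, LieRing.of_associative_ring_bracket, vermaH_lie_vermaE, sub_self]
  · simp only [CartanMatrix.Relations.HF, Function.uncurry, Function.comp_apply,
      ← Int.cast_smul_eq_zsmul ℂ, map_add, map_smul, LieHom.map_lie, FreeLieAlgebra.lift_of_apply,
      vermaGen, LieRing.of_associative_ring_bracket, vermaH_lie_vermaF]
    exact neg_add_cancel ((A i j : ℂ) • vermaF j)

/-- If the highest weight is the `i`-th coordinate vector, then `h_j` acts on the highest weight
vector as `δ_ij`, so that action extracts the `i`-th coefficient of any linear relation. -/
theorem linearIndependent_preGen_H :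
    LinearIndependent ℂ fun i => preGen A (.H i) := by
  refine Fintype.linearIndependent_iff.mpr fun c hc i => ?_
  have h1 : LieSubmodule.Quotient.mk' (chevalleyIdeal A)
      (∑ i, c i • FreeLieAlgebra.of ℂ (CartanMatrix.Generators.H i)) = 0 := by
    rw [map_sum, ← hc]
    exact Finset.sum_congr rfl fun j _ => by rw [map_smul]; rfl
  have h2 := chevalleyIdeal_le_ker_verma A (Pi.single i 1)
    ((LieSubmodule.Quotient.mk_eq_zero (N := chevalleyIdeal A)).mp h1)
  rw [LieHom.mem_ker, map_sum] at h2
  have h3 := DFunLike.congr_fun (DFunLike.congr_fun h2 (Finsupp.single [] 1)) []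
  simpa [FreeLieAlgebra.lift_of_apply, vermaGen, vermaH_single, vermaWeight, Pi.single_apply,
    Finsupp.finsetSum_apply] using h3

end Verma

/-! ### Graded ideals, the radical and the Cartan subalgebra of the quotient -/

section Quotients

variable {ι : Type*} [Fintype ι] [DecidableEq ι] (A : Matrix ι ι ℤ)

theorem isChevalley_preAlgebra :
    IsChevalley A (fun i => preGen A (.H i)) (fun i => preGen A (.E i))
      (fun i => preGen A (.F i)) where
  hh i j := (preGen_relations A i j).1
  ef i j := (preGen_relations A i j).2.1
  he i j := by rw [(preGen_relations A i j).2.2.1, Int.cast_smul_eq_zsmul]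
  hf i j := by rw [(preGen_relations A i j).2.2.2, Int.cast_smul_eq_zsmul]
  gen K hE hF := by
    have hH : ∀ i, preGen A (.H i) ∈ K := fun i => by
      have := K.lie_mem (hE i) (hF i)
      rwa [(preGen_relations A i i).2.1, if_pos rfl] at this
    let π : FreeLieAlgebra ℂ (CartanMatrix.Generators ι) →ₗ⁅ℂ⁆ PreAlgebra A :=
      { toFun := fun x => LieSubmodule.Quotient.mk x
        map_add' := fun x y => rfl
        map_smul' := fun t x => rfl
        map_lie' := rfl }
    let g : CartanMatrix.Generators ι → K
      | .H i => ⟨_, hH i⟩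
      | .E i => ⟨_, hE i⟩
      | .F i => ⟨_, hF i⟩
    have hπ : K.incl.comp (FreeLieAlgebra.lift ℂ g) = π := FreeLieAlgebra.hom_ext fun x => by
      rw [LieHom.comp_apply, FreeLieAlgebra.lift_of_apply]
      cases x <;> rfl
    refine eq_top_iff.mpr fun x _ => ?_
    obtain ⟨x, rfl⟩ := LieSubmodule.Quotient.surjective_mk' _ x
    change π x ∈ K
    rw [← hπ]
    exact (FreeLieAlgebra.lift ℂ g x).2

variable {A}

/-- The sum of the weight spaces of nonzero weights. -/
theorem disjoint_span_generator {L : Type*} [LieRing L] [LieAlgebra ℂ L] {h e f : ι → L}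
    (T : IsChevalley A h e f) (hdet : A.det ≠ 0) :
    Disjoint (Submodule.span ℂ (IsChevalley.generator h e f '' {k | IsChevalley.generatorDegree k ≠ 0}))
      (Submodule.span ℂ (Set.range h)) := by
  refine Submodule.disjoint_def.mpr fun x hx hx' => ?_
  have h0 : x ∈ wtSpace L h (rootWeight A 0) :=
    Submodule.span_le.mpr (by rintro _ ⟨i, rfl⟩; exact T.h_mem i) hx'
  let K := {k : (List ι × ι) ⊕ ι ⊕ (List ι × ι) // IsChevalley.generatorDegree k ≠ 0}
  let g : K → L := fun k => IsChevalley.generator h e f k.1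
  let w : K → ι → ℂ := fun k => rootWeight A (IsChevalley.generatorDegree k.1)
  have hx2 : x ∈ Submodule.span ℂ (Set.range g) := by
    refine Submodule.span_mono ?_ hx
    rintro _ ⟨k, hk, rfl⟩
    exact ⟨⟨k, hk⟩, rfl⟩
  have h1 := mem_span_of_weight (fun i => LieModule.toEnd ℂ L L (h i)) g w
    (fun k => T.generator_mem k.1) hx2 h0
  have h2 : {k : K | w k = rootWeight A 0} = ∅ :=
    Set.eq_empty_of_forall_notMem fun k hk => k.2 (rootWeight_injective hdet hk)
  rw [h2, Set.image_empty, Submodule.span_empty] at h1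
  exact h1

/-- An ideal contains the weight components of its elements. Its components of weight zero lie in
the Cartan subalgebra, hence vanish. -/
theorem le_span_generator_of_disjoint {L : Type*} [LieRing L] [LieAlgebra ℂ L] {h e f : ι → L}
    (T : IsChevalley A h e f) (hdet : A.det ≠ 0) {I : LieIdeal ℂ L}
    (hI : Disjoint I.toSubmodule (Submodule.span ℂ (Set.range h))) :
    I.toSubmodule ≤ Submodule.span ℂ
      (IsChevalley.generator h e f '' {k | IsChevalley.generatorDegree k ≠ 0}) := by
  intro v hv
  obtain ⟨F, c, rfl, h2, h3⟩ := exists_weight_decomposition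
    (fun i => LieModule.toEnd ℂ L L (h i)) (IsChevalley.generator h e f)
    (fun k => rootWeight A (IsChevalley.generatorDegree k)) (fun k => T.generator_mem k)
    (v := v) (by rw [T.span_generator]; trivial)
  refine Submodule.sum_mem _ fun μ hμ => ?_
  by_cases h0 : μ = rootWeight A 0
  · have h4 : c μ ∈ Submodule.span ℂ (Set.range h) := by
      refine T.mem_span_h hdet fun i => ?_
      have := apply_eq_smul_of_mem_span (fun i => LieModule.toEnd ℂ L L (h i)) _ _
        (fun k => T.generator_mem k) (h2 μ) i
      rwa [h0] at this ⊢
    have h5 := h3 I.toSubmodule (fun i y hy => lie_mem_right ℂ L I _ _ hy) hv μ hμ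
    rw [Submodule.disjoint_def.mp hI _ h5 h4]
    exact zero_mem _
  · refine Submodule.span_mono (Set.image_mono ?_) (h2 μ)
    rintro k hk hk'
    exact h0 (by rw [← show _ = μ from hk, hk'])

/-- Disjointness from a subspace does not in general pass to sums of ideals. It does here because
all these ideals lie in one fixed complement, the sum of the nonzero weight spaces. -/
theorem disjoint_radical (hdet : A.det ≠ 0) :
    Disjoint (radical A).toSubmodule (preCartan A) := by
  refine Disjoint.mono_left ?_ (disjoint_span_generator (isChevalley_preAlgebra A) hdet)
  rw [radical, LieSubmodule.sSup_toSubmodule_eq_iSup]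
  exact iSup₂_le fun I hI => le_span_generator_of_disjoint (isChevalley_preAlgebra A) hdet hI

theorem isChevalley_kmAlgebra : IsChevalley A (genH A) (genE A) (genF A) where
  hh i j := congrArg (LieSubmodule.Quotient.mk' (radical A)) ((isChevalley_preAlgebra A).hh i j)
  ef i j := by
    have := congrArg (LieSubmodule.Quotient.mk' (radical A)) ((isChevalley_preAlgebra A).ef i j)
    rw [apply_ite (LieSubmodule.Quotient.mk' (radical A)), map_zero] at this
    exact this
  he i j := congrArg (LieSubmodule.Quotient.mk' (radical A)) ((isChevalley_preAlgebra A).he i j)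
  hf i j := congrArg (LieSubmodule.Quotient.mk' (radical A)) ((isChevalley_preAlgebra A).hf i j)
  gen K hE hF := by
    let π : PreAlgebra A →ₗ⁅ℂ⁆ KMAlgebra A :=
      { toFun := fun x => LieSubmodule.Quotient.mk x
        map_add' := fun x y => rfl
        map_smul' := fun t x => rfl
        map_lie' := rfl }
    have := (isChevalley_preAlgebra A).gen (K.comap π) hE hF
    refine eq_top_iff.mpr fun x _ => ?_
    obtain ⟨x, rfl⟩ := LieSubmodule.Quotient.surjective_mk' _ x
    have hx : x ∈ K.comap π := by rw [this]; trivial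
    exact hx

theorem linearIndependent_genH (hdet : A.det ≠ 0) : LinearIndependent ℂ (genH A) := by
  refine (linearIndependent_preGen_H A).map
    (f := ((LieSubmodule.Quotient.mk' (radical A)) : PreAlgebra A →ₗ[ℂ] KMAlgebra A)) ?_
  have : LinearMap.ker ((LieSubmodule.Quotient.mk' (radical A)) : PreAlgebra A →ₗ[ℂ] KMAlgebra A) =
      (radical A).toSubmodule := Submodule.ker_mkQ _
  rw [this]
  exact (disjoint_radical hdet).symm

/-- The preimage of such an ideal in the auxiliary algebra also avoids the Cartan subalgebra, since
the radical does, and is therefore absorbed by the radical. -/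
theorem ideal_eq_bot_of_disjoint (hdet : A.det ≠ 0) (I : LieIdeal ℂ (KMAlgebra A))
    (hI : Disjoint I.toSubmodule (Submodule.span ℂ (Set.range (genH A)))) : I = ⊥ := by
  let J : LieIdeal ℂ (PreAlgebra A) :=
    { I.toSubmodule.comap ((LieSubmodule.Quotient.mk' (radical A)) :
        PreAlgebra A →ₗ[ℂ] KMAlgebra A) with
      lie_mem := fun {x m} hm => by
        have : ⁅(LieSubmodule.Quotient.mk x : KMAlgebra A), (LieSubmodule.Quotient.mk m :
          KMAlgebra A)⁆ ∈ I := lie_mem_right ℂ _ I _ _ hm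
        exact this }
  have hJ : J ≤ radical A := by
    refine le_sSup (Submodule.disjoint_def.mpr fun x hx hx' => ?_)
    have h1 : LieSubmodule.Quotient.mk' (radical A) x ∈ Submodule.span ℂ (Set.range (genH A)) := by
      have := Submodule.mem_map_of_mem (f := ((LieSubmodule.Quotient.mk' (radical A)) :
        PreAlgebra A →ₗ[ℂ] KMAlgebra A)) hx'
      rw [preCartan, Submodule.map_span, ← Set.range_comp] at this
      exact this
    have h2 := Submodule.disjoint_def.mp hI _ hx h1
    exact Submodule.disjoint_def.mp (disjoint_radical hdet) x
      ((LieSubmodule.Quotient.mk_eq_zero (N := radical A)).mp h2) hx'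
  refine (LieSubmodule.eq_bot_iff _).mpr fun x hx => ?_
  obtain ⟨x, rfl⟩ := LieSubmodule.Quotient.surjective_mk' _ x
  exact (LieSubmodule.Quotient.mk_eq_zero (N := radical A)).mpr (hJ hx)

end Quotients

/-! ### The integral form on the root lattice and the elements `H(β)` -/

section RootPairing

variable {ι : Type*} [Fintype ι] [DecidableEq ι]

/-- The integral form `(β|γ) = ∑ β_i a_ij γ_j`. -/
def ip (A : Matrix ι ι ℤ) (β γ : ι → ℤ) : ℤ := β ⬝ᵥ A.mulVec γ

section

variable {A : Matrix ι ι ℤ}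

theorem ip_add_left (β β' γ : ι → ℤ) : ip A (β + β') γ = ip A β γ + ip A β' γ :=
  add_dotProduct _ _ _

theorem ip_sub_left (β β' γ : ι → ℤ) : ip A (β - β') γ = ip A β γ - ip A β' γ :=
  sub_dotProduct _ _ _

theorem ip_neg_left (β γ : ι → ℤ) : ip A (-β) γ = - ip A β γ := neg_dotProduct _ _

theorem ip_smul_left (c : ℤ) (β γ : ι → ℤ) : ip A (c • β) γ = c * ip A β γ := smul_dotProduct _ _ _

theorem ip_comm (hA : A.IsSymm) (β γ : ι → ℤ) : ip A β γ = ip A γ β := by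
  rw [ip, ip, Matrix.dotProduct_mulVec, ← Matrix.mulVec_transpose, hA.eq, dotProduct_comm]

theorem ip_add_right (hA : A.IsSymm) (β γ γ' : ι → ℤ) : ip A β (γ + γ') = ip A β γ + ip A β γ' := by
  rw [ip_comm hA, ip_add_left, ip_comm hA γ, ip_comm hA γ']

theorem ip_sub_right (hA : A.IsSymm) (β γ γ' : ι → ℤ) : ip A β (γ - γ') = ip A β γ - ip A β γ' := by
  rw [ip_comm hA, ip_sub_left, ip_comm hA γ, ip_comm hA γ']

theorem ip_smul_right (hA : A.IsSymm) (c : ℤ) (β γ : ι → ℤ) : ip A β (c • γ) = c * ip A β γ := by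
  rw [ip_comm hA, ip_smul_left, ip_comm hA γ]

theorem ip_single_left (i : ι) (γ : ι → ℤ) : ip A (Pi.single i 1) γ = A.mulVec γ i := by
  simp [ip]

theorem ip_single_single (i j : ι) : ip A (Pi.single i 1) (Pi.single j 1) = A i j := by
  simp [ip]

theorem ip_eq_sum (β γ : ι → ℤ) : ip A β γ = ∑ i, β i * ip A (Pi.single i 1) γ := by
  simp only [ip_single_left]
  rfl

end

variable {L : Type*} [LieRing L] [LieAlgebra ℂ L]

/-- The element `∑ c_i h_i`. -/
def hComb (h : ι → L) : (ι → ℂ) →ₗ[ℂ] L := Fintype.linearCombination ℂ h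

/-- The coefficients of an element of the root lattice, as complex numbers. -/
def castVec (β : ι → ℤ) : ι → ℂ := fun i => (β i : ℂ)

/-- The element `H(β) = ∑ β_i h_i`. -/
def hVec (h : ι → L) (β : ι → ℤ) : L := hComb h (castVec β)

theorem castVec_add (β γ : ι → ℤ) : castVec (β + γ) = castVec β + castVec γ := by
  ext; simp [castVec]

theorem castVec_sub (β γ : ι → ℤ) : castVec (β - γ) = castVec β - castVec γ := by
  ext; simp [castVec]

theorem castVec_neg (β : ι → ℤ) : castVec (-β) = - castVec β := by
  ext; simp [castVec]

theorem castVec_single (i : ι) : castVec (Pi.single i 1) = Pi.single i 1 := by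
  ext j
  by_cases hij : j = i
  · subst hij; simp [castVec]
  · simp [castVec, Pi.single_eq_of_ne hij]

theorem hVec_apply (h : ι → L) (β : ι → ℤ) : hVec h β = ∑ i, (β i : ℂ) • h i := by
  simp [hVec, hComb, Fintype.linearCombination_apply, castVec]

theorem hComb_castVec (h : ι → L) (β : ι → ℤ) : hComb h (castVec β) = hVec h β := rfl

theorem hVec_add (h : ι → L) (β γ : ι → ℤ) : hVec h (β + γ) = hVec h β + hVec h γ := by
  simp only [hVec, castVec_add, map_add]

theorem hVec_sub (h : ι → L) (β γ : ι → ℤ) : hVec h (β - γ) = hVec h β - hVec h γ := by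
  simp only [hVec, castVec_sub, map_sub]

theorem hVec_neg (h : ι → L) (β : ι → ℤ) : hVec h (-β) = - hVec h β := by
  simp only [hVec, castVec_neg, map_neg]

theorem hVec_zero (h : ι → L) : hVec h 0 = 0 := by simp [hVec_apply]

theorem hVec_single (h : ι → L) (i : ι) : hVec h (Pi.single i 1) = h i := by
  rw [hVec, castVec_single, hComb, Fintype.linearCombination_apply_single, one_smul]

theorem hVec_negGen (h : ι → L) (β : ι → ℤ) : hVec (fun i => - h i) β = hVec h (-β) := by
  simp [hVec_apply]

theorem hComb_injective {h : ι → L} (li : LinearIndependent ℂ h) :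
    Function.Injective (hComb h) := by
  exact linearIndependent_iff_injective_fintypeLinearCombination.mp li

variable {V : Type*} [AddCommGroup V] [Module ℂ V] [LieRingModule L V] [LieModule ℂ L V]

theorem hVec_lie {h : ι → L} {μ : ι → ℂ} {v : V} (hv : v ∈ wtSpace V h μ) (β : ι → ℤ) :
    ⁅hVec h β, v⁆ = (∑ i, (β i : ℂ) * μ i) • v := by
  rw [hVec_apply, sum_lie, Finset.sum_smul]
  exact Finset.sum_congr rfl fun i _ => by rw [smul_lie, hv i, smul_smul]

theorem hVec_lie_root {A : Matrix ι ι ℤ} {h : ι → L} {γ : ι → ℤ} {v : V}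
    (hv : v ∈ wtSpace V h (rootWeight A γ)) (β : ι → ℤ) :
    ⁅hVec h β, v⁆ = (ip A β γ : ℂ) • v := by
  rw [hVec_lie hv]
  congr 1
  simp [ip, rootWeight, dotProduct]

theorem exists_ne_of_ne_single {β : ι → ℤ} {i : ι} (hβ : ∀ m, β ≠ Pi.single i m) :
    ∃ k, k ≠ i ∧ β k ≠ 0 := by
  by_contra! hcon
  refine hβ (β i) (funext fun k => ?_)
  by_cases hk : k = i
  · subst hk; simp
  · rw [hcon k hk, Pi.single_eq_of_ne hk]

end RootPairing

/-! ### Brackets of opposite root spaces -/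

namespace IsChevalley

variable {ι : Type*} [Fintype ι] [DecidableEq ι] {L : Type*} [LieRing L] [LieAlgebra ℂ L]
  {A : Matrix ι ι ℤ} {h e f : ι → L}

theorem wtSpace_swap (V : Type*) [AddCommGroup V] [Module ℂ V] [LieRingModule L V]
    [LieModule ℂ L V] (h : ι → L) (β : ι → ℤ) :
    wtSpace V (fun i => - h i) (rootWeight A β) = wtSpace V h (rootWeight A (-β)) := by
  rw [wtSpace_neg, rootWeight_neg]

theorem root_induction_neg (T : IsChevalley A h e f) (hdet : A.det ≠ 0) {β : ι → ℤ} (hβ : 0 < β)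
    (p : Submodule ℂ L) (h1 : ∀ i, β = Pi.single i 1 → f i ∈ p)
    (h2 : ∀ i, 0 < β - Pi.single i 1 → β - Pi.single i 1 ≠ Pi.single i 1 →
      ∀ y ∈ wtSpace L h (rootWeight A (-(β - Pi.single i 1))), ⁅f i, y⁆ ∈ p) :
    wtSpace L h (rootWeight A (-β)) ≤ p := by
  rw [← wtSpace_swap]
  refine T.swap.root_induction hdet hβ p h1 fun i hi hi' y hy => h2 i hi hi' y ?_
  rwa [wtSpace_swap] at hy

theorem exists_eq_smul_e (T : IsChevalley A h e f) (hdet : A.det ≠ 0) {i : ι} {x : L}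
    (hx : x ∈ wtSpace L h (rootWeight A (Pi.single i 1))) : ∃ c : ℂ, x = c • e i := by
  obtain ⟨c, hc⟩ := Submodule.mem_span_singleton.mp (T.wtSpace_simple_le hdet i hx)
  exact ⟨c, hc.symm⟩

theorem exists_eq_smul_f (T : IsChevalley A h e f) (hdet : A.det ≠ 0) {i : ι} {x : L}
    (hx : x ∈ wtSpace L h (rootWeight A (-Pi.single i 1))) : ∃ c : ℂ, x = c • f i :=
  T.swap.exists_eq_smul_e hdet (by rwa [wtSpace_swap])

theorem eq_zero_of_mem_multiple_neg (T : IsChevalley A h e f) (hdet : A.det ≠ 0) (i : ι) {m : ℤ}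
    (hm : 2 ≤ m) {x : L} (hx : x ∈ wtSpace L h (rootWeight A (-Pi.single i m))) : x = 0 :=
  T.swap.eq_zero_of_mem_multiple hdet i hm (by rwa [wtSpace_swap])

theorem lie_h_h (T : IsChevalley A h e f) (hdet : A.det ≠ 0) {x y : L}
    (hx : x ∈ wtSpace L h (rootWeight A 0)) (hy : y ∈ wtSpace L h (rootWeight A 0)) :
    ⁅x, y⁆ = 0 := by
  have := T.mem_span_h hdet hx
  induction this using Submodule.span_induction with
  | mem _ hz => obtain ⟨i, rfl⟩ := hz; rw [hy i]; simp
  | zero => rw [zero_lie]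
  | add a b ha hb iha ihb =>
    have hmem : ∀ a ∈ Submodule.span ℂ (Set.range h), a ∈ wtSpace L h (rootWeight A 0) :=
      fun a ha => Submodule.span_le.mpr (by rintro _ ⟨i, rfl⟩; exact T.h_mem i) ha
    rw [add_lie, iha (hmem a ha), ihb (hmem b hb), add_zero]
  | smul c a ha iha =>
    have hmem : ∀ a ∈ Submodule.span ℂ (Set.range h), a ∈ wtSpace L h (rootWeight A 0) :=
      fun a ha => Submodule.span_le.mpr (by rintro _ ⟨i, rfl⟩; exact T.h_mem i) ha
    rw [smul_lie, iha (hmem a ha), smul_zero]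

theorem lie_mem_root {β γ δ : ι → ℤ} {x y : L} (hx : x ∈ wtSpace L h (rootWeight A β))
    (hy : y ∈ wtSpace L h (rootWeight A γ)) (hδ : β + γ = δ) :
    ⁅x, y⁆ ∈ wtSpace L h (rootWeight A δ) := by
  rw [← hδ, rootWeight_add]
  exact lie_mem_wtSpace hx hy

/-- For distinct `i`, `j`, the bracket `[[e_i, x], [f_j, y]]` of weight zero is a multiple of `H(β)`. -/
theorem lie_lie_mem_of_ne (T : IsChevalley A h e f) (hdet : A.det ≠ 0) (hA : A.IsSymm)
    (li : LinearIndependent ℂ h) {β : ι → ℤ}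
    (ih : ∀ γ, 0 < γ → γ < β → ∀ x ∈ wtSpace L h (rootWeight A γ),
      ∀ y ∈ wtSpace L h (rootWeight A (-γ)), ∃ c : ℂ, ⁅x, y⁆ = c • hVec h γ)
    {i j : ι} (hij : i ≠ j) (hi : 0 < β - Pi.single i 1) (hj : 0 < β - Pi.single j 1) {x y : L}
    (hx : x ∈ wtSpace L h (rootWeight A (β - Pi.single i 1)))
    (hy : y ∈ wtSpace L h (rootWeight A (-(β - Pi.single j 1)))) :
    ∃ c : ℂ, ⁅⁅e i, x⁆, ⁅f j, y⁆⁆ = c • hVec h β := by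
  have hpos : ∀ k : ι, (0 : ι → ℤ) < Pi.single k 1 := fun k => Pi.single_pos.mpr one_pos
  have hlt : ∀ k, β - Pi.single k 1 < β := fun k => sub_lt_self _ (hpos k)
  have hxe := T.e_mem i
  have hfj := T.f_mem j
  set γ := β - Pi.single i 1 - Pi.single j 1 with hγ
  have hγ0 : 0 ≤ γ := fun k => by
    have h1 := hi.le k
    have h2 := hj.le k
    simp only [hγ, Pi.sub_apply, Pi.zero_apply, Pi.single_apply] at h1 h2 ⊢
    split_ifs at * with h3 h4
    · exact absurd (h3.symm.trans h4) hij
    all_goals omega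
  have hji : γ + Pi.single j 1 = β - Pi.single i 1 := by rw [hγ]; abel
  have hij' : γ + Pi.single i 1 = β - Pi.single j 1 := by rw [hγ]; abel
  -- The degree `α_j - α_i` has coefficients of both signs.
  have hxy : ⁅x, y⁆ = 0 := by
    by_contra hne
    have h1 := lie_mem_root hx hy (δ := Pi.single j 1 - Pi.single i 1) (by abel)
    rcases T.pos_or_neg hdet h1 hne with h2 | h2 | h2
    · have := congrFun h2 i
      simp [Pi.single_eq_of_ne hij] at this
    · have := h2.le i
      simp [Pi.single_eq_of_ne hij] at this
    · have := h2.le j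
      simp [Pi.single_eq_of_ne hij.symm] at this
  have hu : ⁅x, f j⁆ ∈ wtSpace L h (rootWeight A γ) := lie_mem_root hx hfj (by rw [hγ]; abel)
  have hz : ⁅e i, y⁆ ∈ wtSpace L h (rootWeight A (-γ)) := lie_mem_root hxe hy (by rw [hγ]; abel)
  have hfy : ⁅f j, y⁆ ∈ wtSpace L h (rootWeight A (-β)) := lie_mem_root hfj hy (by abel)
  obtain ⟨a, ha⟩ := T.exists_eq_smul_f hdet (i := i)
    (lie_mem_root hx hfy (δ := - Pi.single i 1) (by abel))
  obtain ⟨b, hb⟩ := ih _ hi (hlt i) x hx ⁅e i, ⁅f j, y⁆⁆ (lie_mem_root hxe hfy (by abel))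
  obtain ⟨d, hd⟩ := T.exists_eq_smul_e hdet (i := j)
    (lie_mem_root hx hz (δ := Pi.single j 1) (by rw [hγ]; abel))
  obtain ⟨c', hc'⟩ := ih _ hj (hlt j) ⁅⁅x, f j⁆, e i⁆ (lie_mem_root hu hxe (by rw [hγ]; abel)) y hy
  have h1 : ⁅⁅x, f j⁆, y⁆ = a • f i := by
    rw [← ha, leibniz_lie x, hxy, lie_zero, add_zero]
  have h2 : ⁅e i, ⁅f j, y⁆⁆ = ⁅f j, ⁅e i, y⁆⁆ := by
    rw [leibniz_lie, T.ef, if_neg hij, zero_lie, zero_add]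
  have h3 : b • hVec h (β - Pi.single i 1) = ⁅⁅x, f j⁆, ⁅e i, y⁆⁆ - d • h j := by
    rw [← hb, h2, leibniz_lie x, hd, lie_smul, T.fe, if_pos rfl, smul_neg, sub_eq_add_neg]
  have h4 : ⁅⁅x, f j⁆, ⁅e i, y⁆⁆ = c' • hVec h (β - Pi.single j 1) + a • h i := by
    rw [leibniz_lie ⁅x, f j⁆, hc', h1, lie_smul, T.ef, if_pos rfl]
  -- The Jacobi identity writes the bracket as `a h_i - b H(β - α_i)`. Since `H(β) = H(β - α_i) +
  -- h_i`, it is a multiple of `H(β)` once `a = -b`. To compare `a` and `b`, the bracket `[[x, f_j],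
  -- [e_i, y]]` is expanded in two ways, in `h3` and `h4`.
  suffices hab : a = -b ∨ ⁅⁅e i, x⁆, ⁅f j, y⁆⁆ = 0 by
    rcases hab with hab | hab
    · refine ⟨a, ?_⟩
      rw [lie_lie, ha, hb, lie_smul, T.ef, if_pos rfl, hVec_sub, hVec_single,
        ← neg_eq_iff_eq_neg.mpr hab]
      module
    · exact ⟨0, by rw [hab, zero_smul]⟩
  -- For `β = α_i + α_j` the vectors are multiples of `e_j` and `f_i`, and `a = -b` is the symmetry
  -- `a_ij = a_ji`.
  by_cases hγ1 : γ = 0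
  · left
    have hβi : β - Pi.single i 1 = Pi.single j 1 := by rw [← hji, hγ1, zero_add]
    have hβj : β - Pi.single j 1 = Pi.single i 1 := by rw [← hij', hγ1, zero_add]
    rw [hβi] at hx hb
    rw [hβj] at hy
    obtain ⟨ξ, rfl⟩ := T.exists_eq_smul_e hdet hx
    obtain ⟨η, rfl⟩ := T.exists_eq_smul_f hdet hy
    rw [h2, hVec_single] at hb
    simp only [lie_smul, smul_lie, T.ef, if_pos, ← lie_skew (f j) (h i),
      T.hf, smul_neg, neg_neg] at hb h1
    have hf0 : f i ≠ 0 := fun h0 => by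
      have := T.ef i i
      rw [h0, lie_zero, if_pos rfl] at this
      exact li.ne_zero i this.symm
    have e1 : ξ * (η * (A i j : ℂ)) = b := smul_left_injective ℂ (li.ne_zero j) (by
      simpa only [smul_smul, mul_comm, mul_left_comm] using hb)
    have e2 : -(ξ * (η * (A j i : ℂ))) = a := smul_left_injective ℂ hf0 (by
      simpa only [smul_smul, neg_smul, mul_comm, mul_left_comm] using h1)
    rw [← e1, ← e2, hA.apply]
  · have hγ2 : 0 < γ := lt_of_le_of_ne hγ0 (Ne.symm hγ1)
    obtain ⟨c, hc⟩ := ih γ hγ2 (lt_of_lt_of_le (b := β - Pi.single i 1)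
      (by rw [← hji]; exact lt_add_of_pos_right _ (hpos j)) (hlt i).le) _ hu _ hz
    by_cases hx0 : x = 0
    · right; rw [hx0, lie_zero, zero_lie]
    by_cases hy0 : y = 0
    · right; rw [hy0, lie_zero, lie_zero]
    -- Otherwise `β - α_i` would be a multiple of `α_j` by a factor at least two, forcing `x = 0`.
    -- So `γ` has a nonzero coefficient away from `j`, and likewise one away from `i`. Comparing
    -- those coefficients gives `b = c = c'`, and the coefficient at `i` then gives `a = -c`.
    have hm1 : ∀ m, γ ≠ Pi.single j m := fun m hm => by
      refine hx0 (T.eq_zero_of_mem_multiple hdet j (m := m + 1) ?_ ?_)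
      · have := Pi.single_pos.mp (hm ▸ hγ2)
        omega
      · rwa [Pi.single_add, ← hm, hji]
    have hm2 : ∀ m, γ ≠ Pi.single i m := fun m hm => by
      refine hy0 (T.eq_zero_of_mem_multiple_neg hdet i (m := m + 1) ?_ ?_)
      · have := Pi.single_pos.mp (hm ▸ hγ2)
        omega
      · rwa [Pi.single_add, ← hm, hij']
    obtain ⟨k, hk, hk0⟩ := exists_ne_of_ne_single hm1
    obtain ⟨l, hl, hl0⟩ := exists_ne_of_ne_single hm2
    left
    rw [hc] at h3 h4
    rw [← hji, hVec_add, hVec_single] at h3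
    rw [← hij', hVec_add, hVec_single] at h4
    have hinj := hComb_injective li
    have e1 : b • (castVec γ + Pi.single j 1) = c • castVec γ - d • (Pi.single j 1 : ι → ℂ) := by
      refine hinj ?_
      simpa only [map_add, map_sub, map_smul, ← castVec_single, hComb_castVec, hVec_single] using h3
    have e2 : c • castVec γ = c' • (castVec γ + Pi.single i 1) + a • (Pi.single i 1 : ι → ℂ) := by
      refine hinj ?_
      simpa only [map_add, map_sub, map_smul, ← castVec_single, hComb_castVec, hVec_single] using h4
    have e3 := congrFun e1 k
    have e4 := congrFun e2 l
    have e5 := congrFun e2 i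
    simp only [Pi.smul_apply, Pi.add_apply, Pi.sub_apply, Pi.single_eq_of_ne hk,
      Pi.single_eq_of_ne hl, Pi.single_eq_same, smul_eq_mul, mul_zero, add_zero, sub_zero,
      mul_one] at e3 e4 e5
    have hk1 : castVec γ k ≠ 0 := Int.cast_ne_zero.mpr hk0
    have hl1 : castVec γ l ≠ 0 := Int.cast_ne_zero.mpr hl0
    rw [mul_right_cancel₀ hk1 e3]
    have e6 := mul_right_cancel₀ hl1 e4
    rw [e6] at e5 ⊢
    linear_combination -e5

/-- The bracket `[[e_i, x], [f_i, y]]` of weight zero is a multiple of `H(β)`. -/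
theorem lie_lie_mem_of_eq (T : IsChevalley A h e f) (hdet : A.det ≠ 0) (hA : A.IsSymm)
    (li : LinearIndependent ℂ h) {β : ι → ℤ}
    (ih : ∀ γ, 0 < γ → γ < β → ∀ x ∈ wtSpace L h (rootWeight A γ),
      ∀ y ∈ wtSpace L h (rootWeight A (-γ)), ∃ c : ℂ, ⁅x, y⁆ = c • hVec h γ)
    {i : ι} (hi : 0 < β - Pi.single i 1) (hi1 : β - Pi.single i 1 ≠ Pi.single i 1) {x y : L}
    (hx : x ∈ wtSpace L h (rootWeight A (β - Pi.single i 1)))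
    (hy : y ∈ wtSpace L h (rootWeight A (-(β - Pi.single i 1)))) :
    ∃ c : ℂ, ⁅⁅e i, x⁆, ⁅f i, y⁆⁆ = c • hVec h β := by
  have hpos : ∀ k : ι, (0 : ι → ℤ) < Pi.single k 1 := fun k => Pi.single_pos.mpr one_pos
  have hlt : ∀ k, β - Pi.single k 1 < β := fun k => sub_lt_self _ (hpos k)
  have hxe := T.e_mem i
  have hfi := T.f_mem i
  by_cases hx0 : x = 0
  · exact ⟨0, by rw [hx0, lie_zero, zero_lie, zero_smul]⟩
  set γ := β - Pi.single i 1 - Pi.single i 1 with hγ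
  have hγi : γ + Pi.single i 1 = β - Pi.single i 1 := by rw [hγ]; abel
  have hu : ⁅x, f i⁆ ∈ wtSpace L h (rootWeight A γ) := lie_mem_root hx hfi (by rw [hγ]; abel)
  have hz : ⁅e i, y⁆ ∈ wtSpace L h (rootWeight A (-γ)) := lie_mem_root hxe hy (by rw [hγ]; abel)
  have hfy : ⁅f i, y⁆ ∈ wtSpace L h (rootWeight A (-β)) := lie_mem_root hfi hy (by abel)
  obtain ⟨a, ha⟩ := T.exists_eq_smul_f hdet (i := i)
    (lie_mem_root hx hfy (δ := - Pi.single i 1) (by abel))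
  obtain ⟨b, hb⟩ := ih _ hi (hlt i) x hx ⁅e i, ⁅f i, y⁆⁆ (lie_mem_root hxe hfy (by abel))
  obtain ⟨p, hp⟩ := ih _ hi (hlt i) x hx y hy
  obtain ⟨d, hd⟩ := T.exists_eq_smul_e hdet (i := i)
    (lie_mem_root hx hz (δ := Pi.single i 1) (by rw [hγ]; abel))
  obtain ⟨c', hc'⟩ := ih _ hi (hlt i) ⁅⁅x, f i⁆, e i⁆ (lie_mem_root hu hxe (by rw [hγ]; abel)) y hy
  -- Here `γ = β - 2 α_i` need not be positive, so the induction hypothesis applies only if `[x,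
  -- f_i] ≠ 0` makes `γ` a root; a negative root is impossible because it would force `β - α_i = 0`.
  obtain ⟨c, hc⟩ : ∃ c : ℂ, ⁅⁅x, f i⁆, ⁅e i, y⁆⁆ = c • hVec h γ := by
    by_cases hu0 : ⁅x, f i⁆ = 0
    · exact ⟨0, by rw [hu0, zero_lie, zero_smul]⟩
    rcases T.pos_or_neg hdet hu hu0 with h1 | h1 | h1
    · exact absurd (sub_eq_zero.mp h1) hi1
    · exact ih γ h1 (lt_trans (by rw [← hγi]; exact lt_add_of_pos_right _ (hpos i)) (hlt i))
        _ hu _ hz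
    · exfalso
      have h2 : β - Pi.single i 1 < Pi.single i 1 := sub_neg.mp h1
      refine hi.ne' (funext fun k => le_antisymm ?_ (hi.le k))
      by_cases hk : k = i
      · subst hk
        by_contra h3
        refine h2.not_ge fun l => ?_
        by_cases hl : l = k
        · subst hl; simp at h3 ⊢; omega
        · rw [Pi.single_eq_of_ne hl]; exact hi.le l
      · have := h2.le k
        rwa [Pi.single_eq_of_ne hk] at this
  set q : ℂ := (ip A (β - Pi.single i 1) (Pi.single i 1) : ℂ) with hq
  have hHf : ⁅f i, hVec h (β - Pi.single i 1)⁆ = q • f i := by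
    have h1 : ⁅hVec h (β - Pi.single i 1), f i⁆ = _ := hVec_lie_root hfi _
    rw [← lie_skew, h1, ip_comm hA, ip_neg_left, ip_comm hA, Int.cast_neg, neg_smul, neg_neg]
  have hhy : ⁅h i, y⁆ = -(q • y) := by
    have h1 : ⁅hVec h (Pi.single i 1), y⁆ = _ := hVec_lie_root hy _
    rw [hVec_single, ip_comm hA, ip_neg_left] at h1
    rw [h1, Int.cast_neg, neg_smul]
  -- For `i = j` the bracket `[x, y] = p H(β - α_i)` need not vanish. It contributes `pq` to both
  -- expansions, and the two contributions cancel in `a = -b`.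
  have h1 : ⁅⁅x, f i⁆, y⁆ = (a - p * q) • f i := by
    have h2 := leibniz_lie x (f i) y
    rw [ha, hp, lie_smul, hHf, smul_smul] at h2
    rw [sub_smul, h2, add_sub_cancel_right]
  have h3 : (b + q * p) • hVec h (β - Pi.single i 1) = ⁅⁅x, f i⁆, ⁅e i, y⁆⁆ - d • h i := by
    have h2 : ⁅e i, ⁅f i, y⁆⁆ = -(q • y) + ⁅f i, ⁅e i, y⁆⁆ := by
      rw [leibniz_lie, T.ef, if_pos rfl, hhy]
    rw [h2, lie_add, lie_neg, lie_smul, hp, leibniz_lie x (f i), hd, lie_smul, T.fe,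
      if_pos rfl] at hb
    rw [add_smul, ← hb]
    module
  have h4 : ⁅⁅x, f i⁆, ⁅e i, y⁆⁆ = c' • hVec h (β - Pi.single i 1) + (a - p * q) • h i := by
    rw [leibniz_lie ⁅x, f i⁆, hc', h1, lie_smul, T.ef, if_pos rfl]
  have hm : ∀ m, β - Pi.single i 1 ≠ Pi.single i m := fun m hm => by
    refine hx0 (T.eq_zero_of_mem_multiple hdet i (m := m) ?_ (hm ▸ hx))
    have h5 := Pi.single_pos.mp (hm ▸ hi)
    have h6 : m ≠ 1 := by rintro rfl; exact hi1 hm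
    omega
  obtain ⟨k, hk, hk0⟩ := exists_ne_of_ne_single hm
  have hinj := hComb_injective li
  rw [h4] at hc h3
  set v := castVec (β - Pi.single i 1) with hv
  have e1 : (b + q * p) • v = c' • v + (a - p * q) • Pi.single i 1 - d • (Pi.single i 1 : ι → ℂ) := by
    refine hinj ?_
    simpa only [map_add, map_sub, map_smul, ← castVec_single, hComb_castVec, hVec_single, hv] using h3
  have e2 : c' • v + (a - p * q) • Pi.single i 1 = c • (v - (Pi.single i 1 : ι → ℂ)) := by
    refine hinj ?_
    rw [hγ, hVec_sub h (β - Pi.single i 1)] at hc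
    simpa only [map_add, map_sub, map_smul, ← castVec_single, hComb_castVec, hVec_single, hv] using hc
  have e3 := congrFun e1 k
  have e4 := congrFun e2 k
  have e5 := congrFun e2 i
  simp only [Pi.smul_apply, Pi.add_apply, Pi.sub_apply, Pi.single_eq_of_ne hk,
    Pi.single_eq_same, smul_eq_mul, mul_zero, add_zero, sub_zero, mul_one] at e3 e4 e5
  have hk1 : v k ≠ 0 := Int.cast_ne_zero.mpr hk0
  have e6 := mul_right_cancel₀ hk1 e3
  have e7 := mul_right_cancel₀ hk1 e4
  have hab : a = -b := by
    rw [← e7] at e5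
    linear_combination e5 + e6
  refine ⟨a, ?_⟩
  rw [lie_lie, ha, hb, lie_smul, T.ef, if_pos rfl, hVec_sub, hVec_single,
    ← neg_eq_iff_eq_neg.mpr hab]
  module

/-- Usually deduced from an invariant form, this is proved first, by induction on height, so that
the form can be defined from it. Both arguments are reduced to brackets with a simple generator, and
the two preceding lemmas treat equal and distinct simple roots. -/
theorem exists_lie_eq_smul_hVec (T : IsChevalley A h e f) (hdet : A.det ≠ 0) (hA : A.IsSymm)
    (li : LinearIndependent ℂ h) {β : ι → ℤ} (hβ : 0 < β) :
    ∀ x ∈ wtSpace L h (rootWeight A β), ∀ y ∈ wtSpace L h (rootWeight A (-β)),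
      ∃ c : ℂ, ⁅x, y⁆ = c • hVec h β := by
  obtain ⟨n, hn⟩ : ∃ n : ℕ, ∑ i, β i ≤ n := ⟨(∑ i, β i).toNat, by omega⟩
  induction n generalizing β with
  | zero =>
    exfalso
    have h1 := Fintype.sum_pos hβ
    simp at hn
    omega
  | succ n ih =>
    have ih' : ∀ γ, 0 < γ → γ < β → ∀ x ∈ wtSpace L h (rootWeight A γ),
        ∀ y ∈ wtSpace L h (rootWeight A (-γ)), ∃ c : ℂ, ⁅x, y⁆ = c • hVec h γ := by
      intro γ h1 h2
      refine ih h1 ?_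
      have := Fintype.sum_pos (sub_pos.mpr h2)
      simp only [Pi.sub_apply, Finset.sum_sub_distrib] at this
      push_cast at hn
      omega
    simp only [← Submodule.mem_span_singleton, eq_comm (b := _ • hVec h β)]
    intro x hx
    let p : L → Submodule ℂ L := fun y =>
      (Submodule.span ℂ {hVec h β}).comap (LieModule.toEnd ℂ L L y)
    have hp : ∀ x y : L, x ∈ p y ↔ y ∈ p x := fun x y => by
      change ⁅y, x⁆ ∈ Submodule.span ℂ {hVec h β} ↔ ⁅x, y⁆ ∈ Submodule.span ℂ {hVec h β}
      rw [← lie_skew, neg_mem_iff]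
    have hmem : ∀ {x y : L} {c : ℂ}, ⁅x, y⁆ = c • hVec h β → y ∈ p x := fun {x y c} hc =>
      Submodule.mem_span_singleton.mpr ⟨c, hc.symm⟩
    suffices H : ∀ y ∈ wtSpace L h (rootWeight A (-β)), y ∈ p x from H
    intro y hy
    rw [← hp]
    refine T.root_induction hdet hβ (p y) (fun i hi => ?_) (fun i hi hi1 x' hx' => ?_) hx
    · obtain ⟨c, rfl⟩ := T.exists_eq_smul_f hdet (i := i) (hi ▸ hy)
      rw [← hp]
      refine hmem (c := c) ?_
      rw [lie_smul, T.ef, if_pos rfl, hi, hVec_single]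
    · rw [← hp]
      refine T.root_induction_neg hdet hβ (p ⁅e i, x'⁆) (fun j hj => ?_) (fun j hj hj1 y' hy' => ?_) hy
      · exfalso
        rw [hj] at hi
        have h1 := hi.le i
        have hji : i = j := by
          by_contra hne
          simp [Pi.single_eq_of_ne hne] at h1
        rw [hji, sub_self] at hi
        exact lt_irrefl _ hi
      · by_cases hij : i = j
        · subst hij
          obtain ⟨c, hc⟩ := T.lie_lie_mem_of_eq hdet hA li ih' hi hi1 hx' hy'
          exact hmem hc
        · obtain ⟨c, hc⟩ := T.lie_lie_mem_of_ne hdet hA li ih' hij hi hj hx' hy'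
          exact hmem hc

end IsChevalley

/-! ### Construction of the invariant bilinear form -/

section InvariantForm

variable {ι : Type*} [Fintype ι] [DecidableEq ι] {L : Type*} [LieRing L] [LieAlgebra ℂ L]
  {A : Matrix ι ι ℤ} {h e f : ι → L}

/-- A bilinear form for which root spaces of roots `β`, `γ` with `β + γ ≠ 0` are orthogonal, with
`[x, y] = ⟨x|y⟩ H(β)` for `x ∈ 𝔤_β`, `y ∈ 𝔤_{-β}`, and with `⟨h_i|h_j⟩ = a_ij`. -/
structure IsRootForm (A : Matrix ι ι ℤ) (h : ι → L) (B : L →ₗ[ℂ] L →ₗ[ℂ] ℂ) : Prop where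
  orth : ∀ {β γ : ι → ℤ}, β + γ ≠ 0 → ∀ {x}, x ∈ wtSpace L h (rootWeight A β) →
    ∀ {y}, y ∈ wtSpace L h (rootWeight A γ) → B x y = 0
  lie_eq : ∀ {β : ι → ℤ} {x}, x ∈ wtSpace L h (rootWeight A β) →
    ∀ {y}, y ∈ wtSpace L h (rootWeight A (-β)) → ⁅x, y⁆ = B x y • hVec h β
  h_h : ∀ i j, B (h i) (h j) = A i j

theorem IsRootForm.swap {B : L →ₗ[ℂ] L →ₗ[ℂ] ℂ} (hB : IsRootForm A h B) :
    IsRootForm A (fun i => - h i) B where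
  orth {β γ} hβγ {x} hx {y} hy := by
    rw [IsChevalley.wtSpace_swap] at hx hy
    exact hB.orth (by rwa [← neg_add, Ne, neg_eq_zero]) hx hy
  lie_eq {β x} hx {y} hy := by
    rw [IsChevalley.wtSpace_swap] at hx hy
    rw [hB.lie_eq hx hy, hVec_negGen]
  h_h i j := by simpa using hB.h_h i j

namespace IsChevalley

/-- Linear maps may be prescribed degree by degree: a basis can be chosen among the homogeneous
spanning vectors, and a homogeneous vector involves only basis vectors of its own degree. -/
theorem exists_linearMap_eq_on_wtSpace (T : IsChevalley A h e f) (hdet : A.det ≠ 0)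
    {W : Type*} [AddCommGroup W] [Module ℂ W] (φ : (ι → ℤ) → L →ₗ[ℂ] W) :
    ∃ Φ : L →ₗ[ℂ] W, ∀ β, ∀ x ∈ wtSpace L h (rootWeight A β), Φ x = φ β x := by
  obtain ⟨b, hb, hspan, hli⟩ := exists_linearIndependent ℂ (Set.range (generator h e f))
  have hdeg : ∀ x : b, ∃ β, (x : L) ∈ wtSpace L h (rootWeight A β) := fun x => by
    obtain ⟨k, hk⟩ := hb x.2
    exact ⟨_, hk ▸ T.generator_mem k⟩
  choose deg hdeg using hdeg
  have htop : Submodule.span ℂ (Set.range fun x : b => (x : L)) = ⊤ := by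
    rw [Subtype.range_coe, hspan, T.span_generator]
  let bas : Module.Basis b ℂ L := Module.Basis.mk hli htop.ge
  refine ⟨bas.constr ℂ fun x => φ (deg x) x, fun β x hx => ?_⟩
  have h1 := mem_span_of_mem_wtSpace hdeg htop hx
  induction h1 using Submodule.span_induction with
  | mem _ h =>
    obtain ⟨y, hy, rfl⟩ := h
    have h2 : bas y = (y : L) := by simp [bas]
    rw [← h2, Module.Basis.constr_basis, h2, rootWeight_injective hdet hy]
  | zero => simp
  | add y z h1 h2 hy hz =>
    have hle : ∀ {y}, y ∈ Submodule.span ℂ ((fun x : b => (x : L)) '' {k | rootWeight A (deg k) =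
        rootWeight A β}) → y ∈ wtSpace L h (rootWeight A β) := fun {y} hy =>
      Submodule.span_le.mpr (by rintro _ ⟨k, hk, rfl⟩; exact (show _ = _ from hk) ▸ hdeg k) hy
    rw [map_add, map_add, hy (hle h1), hz (hle h2)]
  | smul c y h1 hy =>
    have hle : ∀ {y}, y ∈ Submodule.span ℂ ((fun x : b => (x : L)) '' {k | rootWeight A (deg k) =
        rootWeight A β}) → y ∈ wtSpace L h (rootWeight A β) := fun {y} hy =>
      Submodule.span_le.mpr (by rintro _ ⟨k, hk, rfl⟩; exact (show _ = _ from hk) ▸ hdeg k) hy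
    rw [map_smul, map_smul, hy (hle h1)]

theorem exists_coordinates (T : IsChevalley A h e f) (hdet : A.det ≠ 0)
    (li : LinearIndependent ℂ h) :
    ∃ C : L →ₗ[ℂ] (ι → ℂ), (∀ c, C (hComb h c) = c) ∧
      ∀ β ≠ 0, ∀ x ∈ wtSpace L h (rootWeight A β), C x = 0 := by
  obtain ⟨q, hq⟩ := LinearMap.exists_leftInverse_of_injective (hComb h)
    (LinearMap.ker_eq_bot.mpr (hComb_injective li))
  obtain ⟨C, hC⟩ := T.exists_linearMap_eq_on_wtSpace hdet fun β => if β = 0 then q else 0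
  refine ⟨C, fun c => ?_, fun β hβ x hx => ?_⟩
  · rw [hC 0, if_pos rfl]
    · exact DFunLike.congr_fun hq c
    · rw [hComb, Fintype.linearCombination_apply]
      exact Submodule.sum_mem _ fun i _ => Submodule.smul_mem _ _ (T.h_mem i)
  · rw [hC β x hx, if_neg hβ, LinearMap.zero_apply]

theorem sum_ne_zero_of_pos {β : ι → ℤ} (hβ : 0 < β) : ((∑ i, β i : ℤ) : ℂ) ≠ 0 :=
  Int.cast_ne_zero.mpr (Fintype.sum_pos hβ).ne'

/-- Any functional that is nonzero on `H(β)` recovers `c` from `[x, y] = c H(β)`. The sum of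
coordinates works for all roots at once, since it sends `H(β)` to the height of `β`. -/
theorem exists_isRootForm (T : IsChevalley A h e f) (hdet : A.det ≠ 0) (hA : A.IsSymm)
    (li : LinearIndependent ℂ h) : ∃ B : L →ₗ[ℂ] L →ₗ[ℂ] ℂ, IsRootForm A h B := by
  obtain ⟨C, hC1, hC2⟩ := T.exists_coordinates hdet li
  let l : L →ₗ[ℂ] ℂ := (∑ i, LinearMap.proj i) ∘ₗ C
  have hl : ∀ β, l (hVec h β) = ((∑ i, β i : ℤ) : ℂ) := fun β => by
    simp [l, hVec, hC1, castVec]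
  have hl0 : ∀ β ≠ 0, ∀ x ∈ wtSpace L h (rootWeight A β), l x = 0 := fun β hβ x hx => by
    simp [l, hC2 β hβ x hx]
  -- A nonzero `β` of height zero has both signs among its coefficients, so its root space is zero
  -- and the value `0⁻¹ = 0` does no harm.
  obtain ⟨B, hB⟩ := T.exists_linearMap_eq_on_wtSpace hdet (W := L →ₗ[ℂ] ℂ) fun β =>
    if β = 0 then
      (((Matrix.toLinearMap₂' ℂ (A.map (Int.cast : ℤ → ℂ))).compl₂ C) ∘ₗ C)
    else ((∑ i, β i : ℤ) : ℂ)⁻¹ • (LinearMap.compr₂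
      (LinearMap.mk₂ ℂ (fun x y : L => ⁅x, y⁆) add_lie smul_lie lie_add fun c x y => lie_smul c x y) l)
  have hB1 : ∀ β ≠ 0, ∀ x ∈ wtSpace L h (rootWeight A β), ∀ y,
      B x y = ((∑ i, β i : ℤ) : ℂ)⁻¹ * l ⁅x, y⁆ := fun β hβ x hx y => by
    rw [hB β x hx, if_neg hβ]; rfl
  have hB0 : ∀ x ∈ wtSpace L h (rootWeight A 0), ∀ y,
      B x y = Matrix.toLinearMap₂' ℂ (A.map (Int.cast : ℤ → ℂ)) (C x) (C y) := fun x hx y => by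
    rw [hB 0 x hx, if_pos rfl]; rfl
  refine ⟨B, ⟨?_, ?_, ?_⟩⟩
  · intro β γ hβγ x hx y hy
    by_cases hβ : β = 0
    · subst hβ
      rw [hB0 x hx, hC2 γ (by simpa using hβγ) y hy, map_zero]
    · rw [hB1 β hβ x hx, hl0 _ hβγ _ (lie_mem_root hx hy rfl), mul_zero]
  · intro β x hx y hy
    by_cases hx0 : x = 0
    · rw [hx0, zero_lie, map_zero, LinearMap.zero_apply, zero_smul]
    rcases T.pos_or_neg hdet hx hx0 with rfl | hβ | hβ
    · rw [neg_zero] at hy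
      rw [T.lie_h_h hdet hx hy, hVec_zero, smul_zero]
    · obtain ⟨c, hc⟩ := T.exists_lie_eq_smul_hVec hdet hA li hβ x hx y hy
      rw [hB1 β hβ.ne' x hx, hc, map_smul, hl, smul_eq_mul, mul_comm c,
        inv_mul_cancel_left₀ (sum_ne_zero_of_pos hβ)]
    · have hβ' : 0 < -β := neg_pos.mpr hβ
      obtain ⟨c, hc⟩ := T.exists_lie_eq_smul_hVec hdet hA li hβ' y hy x (by rwa [neg_neg])
      have hs : ((∑ i, β i : ℤ) : ℂ) ≠ 0 := by
        have := sum_ne_zero_of_pos hβ'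
        simpa only [Pi.neg_apply, Finset.sum_neg_distrib, Int.cast_neg, neg_ne_zero] using this
      have hc' : ⁅x, y⁆ = c • hVec h β := by
        rw [← lie_skew, hc, hVec_neg, smul_neg, neg_neg]
      rw [hB1 β hβ.ne x hx, hc', map_smul, hl, smul_eq_mul, mul_comm c,
        inv_mul_cancel_left₀ hs]
  · intro i j
    have hC3 : ∀ i, C (h i) = Pi.single i 1 := fun i => by
      rw [← hVec_single h i, hVec, hC1, castVec_single]
    rw [hB0 _ (T.h_mem i), hC3, hC3]
    simp [Matrix.toLinearMap₂'_apply, Pi.single_apply]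

end IsChevalley

namespace IsRootForm

variable {B : L →ₗ[ℂ] L →ₗ[ℂ] ℂ}

theorem h_left (hB : IsRootForm A h B) (T : IsChevalley A h e f) (hdet : A.det ≠ 0)
    (hA : A.IsSymm) {x : L} (hx : x ∈ wtSpace L h (rootWeight A 0)) (k : ι) :
    ⁅x, e k⁆ = B (h k) x • e k ∧ B x (h k) = B (h k) x := by
  have := T.mem_span_h hdet hx
  clear hx
  induction this using Submodule.span_induction with
  | mem _ hz =>
    obtain ⟨i, rfl⟩ := hz
    rw [T.he, hB.h_h, hB.h_h, hA.apply]
    exact ⟨rfl, rfl⟩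
  | zero => simp
  | add a b _ _ iha ihb =>
    simp [iha.1, ihb.1, iha.2, ihb.2, add_smul]
  | smul c a _ iha =>
    simp [iha.1, iha.2, smul_smul]

theorem e_f (hB : IsRootForm A h B) (T : IsChevalley A h e f) (li : LinearIndependent ℂ h) (i : ι) :
    B (e i) (f i) = 1 := by
  have h1 := hB.lie_eq (T.e_mem i) (T.f_mem i)
  rw [T.ef, if_pos rfl, hVec_single] at h1
  exact smul_left_injective ℂ (li.ne_zero i) (by simpa using h1.symm)

theorem f_e (hB : IsRootForm A h B) (T : IsChevalley A h e f) (li : LinearIndependent ℂ h) (i : ι) :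
    B (f i) (e i) = 1 := by
  have h1 := hB.lie_eq (T.f_mem i) (by rw [neg_neg]; exact T.e_mem i)
  rw [T.fe, if_pos rfl, hVec_neg, hVec_single, smul_neg, neg_inj] at h1
  exact smul_left_injective ℂ (li.ne_zero i) (by simpa using h1.symm)

/-- If `γ` is not a multiple of `α_k`, the Jacobi identity is an equation between combinations of
`H(γ)` and `h_k`, and a coordinate away from `k` isolates the coefficient of `H(γ)`. The remaining
degrees `γ = m α_k` carry nonzero vectors only for `m = -1, 0, 1` and are computed directly. -/
theorem invariant_e (hB : IsRootForm A h B) (T : IsChevalley A h e f) (hdet : A.det ≠ 0)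
    (hA : A.IsSymm) (li : LinearIndependent ℂ h) (k : ι) {γ δ : ι → ℤ} {u v : L}
    (hu : u ∈ wtSpace L h (rootWeight A γ)) (hv : v ∈ wtSpace L h (rootWeight A δ)) :
    B ⁅e k, u⁆ v = - B u ⁅e k, v⁆ := by
  have hek := T.e_mem k
  by_cases hδ : Pi.single k 1 + γ + δ ≠ 0
  · rw [hB.orth hδ (IsChevalley.lie_mem_root hek hu rfl) hv, hB.orth (γ := Pi.single k 1 + δ)
      (by rwa [← add_assoc, add_comm γ]) hu (IsChevalley.lie_mem_root hek hv rfl), neg_zero]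
  rw [not_not] at hδ
  obtain rfl : δ = -(Pi.single k 1 + γ) := (neg_eq_of_add_eq_zero_right hδ).symm
  by_cases hu0 : u = 0
  · simp [hu0]
  have hev : ⁅e k, v⁆ ∈ wtSpace L h (rootWeight A (-γ)) := IsChevalley.lie_mem_root hek hv (by abel)
  by_cases hm : ∀ m, γ ≠ Pi.single k m
  · obtain ⟨a, ha⟩ := T.exists_eq_smul_f hdet (i := k)
      (IsChevalley.lie_mem_root hu hv (δ := - Pi.single k 1) (by abel))
    have h1 := lie_lie (e k) u v
    rw [hB.lie_eq (IsChevalley.lie_mem_root hek hu rfl) hv, ha, hB.lie_eq hu hev, lie_smul, T.ef, if_pos rfl,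
      hVec_add, hVec_single] at h1
    obtain ⟨j, hj, hj0⟩ := exists_ne_of_ne_single hm
    have h2 : B ⁅e k, u⁆ v • (Pi.single k 1 + castVec γ) =
        a • Pi.single k 1 - B u ⁅e k, v⁆ • castVec γ := by
      refine hComb_injective li ?_
      simpa only [map_add, map_sub, map_smul, ← castVec_single, hComb_castVec, hVec_single] using h1
    have h3 := congrFun h2 j
    simp only [Pi.smul_apply, Pi.add_apply, Pi.sub_apply, Pi.single_eq_of_ne hj, smul_eq_mul,
      mul_zero, zero_add, zero_sub, ← neg_mul] at h3
    exact mul_right_cancel₀ (Int.cast_ne_zero.mpr hj0) h3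
  · push Not at hm
    obtain ⟨m, rfl⟩ := hm
    rcases lt_trichotomy m 0 with hm | rfl | hm
    · by_cases hm1 : m = -1
      · subst hm1
        rw [Pi.single_neg] at hu hv
        rw [add_neg_cancel, neg_zero] at hv
        obtain ⟨ξ, rfl⟩ := T.exists_eq_smul_f hdet hu
        rw [← lie_skew _ v, (hB.h_left T hdet hA hv k).1, lie_smul, T.ef, if_pos rfl]
        simp only [map_smul, map_neg, neg_neg, LinearMap.smul_apply, hB.f_e T li, smul_eq_mul]
        ring
      · refine absurd (T.eq_zero_of_mem_multiple_neg hdet k (m := -m) (by omega) ?_) hu0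
        rwa [Pi.single_neg, neg_neg]
    · rw [Pi.single_zero] at hu hv
      rw [add_zero] at hv
      obtain ⟨ξ, rfl⟩ := T.exists_eq_smul_f hdet hv
      rw [← lie_skew, (hB.h_left T hdet hA hu k).1, lie_smul, T.ef, if_pos rfl]
      simp only [map_smul, map_neg, LinearMap.smul_apply, LinearMap.neg_apply, hB.e_f T li,
        smul_eq_mul, (hB.h_left T hdet hA hu k).2]
      ring
    · by_cases hm1 : m = 1
      · subst hm1
        rw [← Pi.single_add] at hv
        obtain ⟨ξ, rfl⟩ := T.exists_eq_smul_e hdet hu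
        rw [T.eq_zero_of_mem_multiple_neg hdet k (by norm_num) hv]
        simp
      · exact absurd (T.eq_zero_of_mem_multiple hdet k (by omega) hu) hu0

theorem invariant_gen (hB : IsRootForm A h B) (T : IsChevalley A h e f) (hdet : A.det ≠ 0)
    (hA : A.IsSymm) (li : LinearIndependent ℂ h) (k : ι) (u v : L) :
    B ⁅e k, u⁆ v = - B u ⁅e k, v⁆ := by
  have hu : u ∈ Submodule.span ℂ (Set.range (IsChevalley.generator h e f)) := by
    rw [T.span_generator]; trivial
  have hv : v ∈ Submodule.span ℂ (Set.range (IsChevalley.generator h e f)) := by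
    rw [T.span_generator]; trivial
  induction hu using Submodule.span_induction with
  | mem _ hz =>
    obtain ⟨i, rfl⟩ := hz
    induction hv using Submodule.span_induction with
    | mem _ hz =>
      obtain ⟨j, rfl⟩ := hz
      exact hB.invariant_e T hdet hA li k (T.generator_mem i) (T.generator_mem j)
    | zero => simp
    | add a b _ _ iha ihb => rw [map_add, iha, ihb, lie_add, map_add, neg_add]
    | smul c a _ iha => rw [map_smul, iha, lie_smul, map_smul, smul_neg]
  | zero => simp
  | add a b _ _ iha ihb =>
    rw [lie_add, map_add, LinearMap.add_apply, iha, ihb, map_add, LinearMap.add_apply, neg_add]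
  | smul c a _ iha =>
    rw [lie_smul, map_smul, LinearMap.smul_apply, iha, map_smul, LinearMap.smul_apply, smul_neg]

/-- The elements under which the form is invariant make up a subalgebra, so the generators suffice.
-/
theorem invariant (hB : IsRootForm A h B) (T : IsChevalley A h e f) (hdet : A.det ≠ 0)
    (hA : A.IsSymm) (li : LinearIndependent ℂ h) (z u v : L) :
    B ⁅z, u⁆ v = - B u ⁅z, v⁆ := by
  let K : LieSubalgebra ℂ L :=
    { carrier := {z | ∀ u v, B ⁅z, u⁆ v = - B u ⁅z, v⁆}
      add_mem' := fun {a b} ha hb u v => by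
        rw [add_lie, map_add, LinearMap.add_apply, ha, hb, add_lie, map_add, neg_add]
      zero_mem' := fun u v => by simp
      smul_mem' := fun c a ha u v => by
        rw [smul_lie, map_smul, LinearMap.smul_apply, ha, smul_lie, map_smul, smul_neg]
      lie_mem' := fun {a b} ha hb u v => by
        rw [lie_lie, lie_lie, map_sub, LinearMap.sub_apply, ha, hb, hb, ha, map_sub]
        ring }
  have hz : z ∈ K := by
    rw [T.gen K (hB.invariant_gen T hdet hA li)
      (hB.swap.invariant_gen T.swap hdet hA (li.neg))]
    trivial
  exact hz u v

theorem symm (hB : IsRootForm A h B) (T : IsChevalley A h e f) (hdet : A.det ≠ 0)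
    (hA : A.IsSymm) (li : LinearIndependent ℂ h) {β γ : ι → ℤ} {u v : L}
    (hu : u ∈ wtSpace L h (rootWeight A β)) (hv : v ∈ wtSpace L h (rootWeight A γ)) :
    B u v = B v u := by
  by_cases hβγ : β + γ = 0
  · obtain rfl : γ = -β := (neg_eq_of_add_eq_zero_right hβγ).symm
    by_cases hβ : β = 0
    · subst hβ
      rw [neg_zero] at hv
      have h1 := T.mem_span_h hdet hu
      clear hβγ hu
      induction h1 using Submodule.span_induction with
      | mem _ hz => obtain ⟨i, rfl⟩ := hz; exact ((hB.h_left T hdet hA hv i).2).symm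
      | zero => simp
      | add a b _ _ iha ihb => simp [iha, ihb]
      | smul c a _ iha => simp [iha]
    · have h1 := hB.lie_eq hu hv
      have h2 := hB.lie_eq hv (by rwa [neg_neg])
      rw [← lie_skew, h1, hVec_neg, smul_neg, neg_inj] at h2
      refine smul_left_injective ℂ (m := hVec h β) (fun h3 => hβ ?_) h2
      have h4 : castVec β = 0 := hComb_injective li (by rw [map_zero]; exact h3)
      exact funext fun i => Int.cast_eq_zero.mp (congrFun h4 i)
  · rw [hB.orth hβγ hu hv, hB.orth (by rwa [add_comm]) hv hu]

end IsRootForm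

end InvariantForm

/-! ### Serre relations, reflections by `sl₂`-strings and the norms of roots -/

section Integrability

variable {ι : Type*} [Fintype ι] [DecidableEq ι] {L : Type*} [LieRing L] [LieAlgebra ℂ L]
  {A : Matrix ι ι ℤ} {h e f : ι → L}
  {V : Type*} [AddCommGroup V] [Module ℂ V] [LieRingModule L V] [LieModule ℂ L V]

/-- `L` is the Kac-Moody algebra of the nondegenerate symmetric generalized Cartan matrix `A`, with
Chevalley generators `h i`, `e i`, `f i`. -/
structure IsKacMoody (A : Matrix ι ι ℤ) (h e f : ι → L) : Prop extends IsChevalley A h e f where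
  symm : A.IsSymm
  diag : ∀ i, A i i = 2
  offDiag : ∀ i j, i ≠ j → A i j ≤ 0
  det : A.det ≠ 0
  li : LinearIndependent ℂ h
  ideal : ∀ I : LieIdeal ℂ L, Disjoint I.toSubmodule (Submodule.span ℂ (Set.range h)) → I = ⊥

theorem isKacMoody_kmAlgebra (hA : IsHyperbolic A) (hdet : A.det ≠ 0) :
    IsKacMoody A (genH A) (genE A) (genF A) :=
  { isChevalley_kmAlgebra with
    symm := hA.symm
    diag := hA.diag
    offDiag := hA.offDiag
    det := hdet
    li := linearIndependent_genH hdet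
    ideal := ideal_eq_bot_of_disjoint hdet }

theorem content_replicate (n : ℕ) (i : ι) : content (List.replicate n i) = Pi.single i (n : ℤ) := by
  ext j
  by_cases hij : j = i
  · subst hij; simp [content]
  · simp [content, List.count_replicate, Ne.symm hij]

theorem word_replicate (x : ι → L) (n : ℕ) (i : ι) (v : V) :
    word x (List.replicate n i) v = ((LieModule.toEnd ℂ L V (x i)) ^ n) v := by
  induction n with
  | zero => rfl
  | succ n ih =>
    rw [List.replicate_succ, pow_succ', Module.End.mul_apply, ← ih]
    rfl

theorem exists_pow_lie_eq_zero {x y : L} {v : V}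
    (hy : ∃ n : ℕ, ((LieAlgebra.ad ℂ L x) ^ n) y = 0)
    (hv : ∃ n : ℕ, ((LieModule.toEnd ℂ L V x) ^ n) v = 0) :
    ∃ n : ℕ, ((LieModule.toEnd ℂ L V x) ^ n) ⁅y, v⁆ = 0 := by
  have hy' : ∃ n : ℕ, ((LieModule.toEnd ℂ L L x) ^ n) y = 0 := hy
  have := LieModule.lie_mem_maxGenEigenspace_toEnd (R := ℂ) (χ₁ := 0) (χ₂ := 0) (x := x) (y := y)
    (m := v) (by simpa [Module.End.mem_maxGenEigenspace] using hy')
    (by simpa [Module.End.mem_maxGenEigenspace] using hv)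
  simpa [Module.End.mem_maxGenEigenspace] using this

namespace IsKacMoody

theorem swap (K : IsKacMoody A h e f) : IsKacMoody A (fun i => - h i) f e :=
  { K.toIsChevalley.swap with
    symm := K.symm
    diag := K.diag
    offDiag := K.offDiag
    det := K.det
    li := K.li.neg
    ideal := fun I hI => K.ideal I (hI.mono_right (Submodule.span_le.mpr (by
      rintro _ ⟨i, rfl⟩
      rw [← neg_neg (h i)]
      exact neg_mem (Submodule.subset_span ⟨i, rfl⟩)))) }

theorem isSl2Triple (K : IsKacMoody A h e f) (i : ι) : IsSl2Triple (h i) (e i) (f i) where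
  h_ne_zero := K.li.ne_zero i
  lie_e_f := by rw [K.ef, if_pos rfl]
  lie_h_e_nsmul := by rw [K.he, K.diag, ← Nat.cast_smul_eq_nsmul ℂ]; norm_num
  lie_h_f_nsmul := by rw [K.hf, K.diag, ← Nat.cast_smul_eq_nsmul ℂ]; norm_num

/-- Such a vector generates an ideal spanned by `f`-words in it. All degrees that occur are
negative, so the ideal avoids the Cartan subalgebra and vanishes. -/
theorem eq_zero_of_singular (K : IsKacMoody A h e f) {β : ι → ℤ} (hβ : 0 < β) {y : L}
    (hy : y ∈ wtSpace L h (rootWeight A (-β))) (hey : ∀ k, ⁅e k, y⁆ = 0) : y = 0 := by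
  have hmem : y ∈ Submodule.span ℂ (Set.range fun l => word f l y) :=
    Submodule.subset_span ⟨[], rfl⟩
  have hst := K.span_words_isLieStable hy hey
  let I : LieIdeal ℂ L :=
    { Submodule.span ℂ (Set.range fun l => word f l y) with
      lie_mem := fun {x m} hm => hst x m hm }
  have hI : I = ⊥ := by
    refine K.ideal I (Submodule.disjoint_def.mpr fun v hv hv' => ?_)
    have h0 : v ∈ wtSpace L h (rootWeight A 0) :=
      Submodule.span_le.mpr (by rintro _ ⟨i, rfl⟩; exact K.h_mem i) hv'
    have h1 := mem_span_of_weight (fun i => LieModule.toEnd ℂ L L (h i)) (fun l => word f l y)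
      (fun l => rootWeight A (-β) - rootWeight A (content l)) (fun l => K.word_f_mem hy l) hv h0
    rw [Set.eq_empty_of_forall_notMem (s := {l : List ι | _}), Set.image_empty,
      Submodule.span_empty] at h1
    · exact h1
    · intro l hl
      have h2 : rootWeight A (-β) - rootWeight A (content l) = rootWeight A 0 := hl
      rw [← rootWeight_sub] at h2
      have h3 := rootWeight_injective K.det h2
      have h4 : β + content l = 0 := by rw [← neg_eq_zero, neg_add, ← sub_eq_add_neg, h3]
      exact (lt_of_lt_of_le hβ (le_add_of_nonneg_right (content_nonneg l))).ne' h4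
  have : y ∈ I := hmem
  rw [hI] at this
  exact (LieSubmodule.mem_bot y).mp this

theorem lie_e_pow_f (K : IsKacMoody A h e f) {i k : ι} (hki : k ≠ i) (n : ℕ) (v : V) :
    ⁅e k, ((LieModule.toEnd ℂ L V (f i)) ^ n) v⁆ = ((LieModule.toEnd ℂ L V (f i)) ^ n) ⁅e k, v⁆ := by
  induction n with
  | zero => rfl
  | succ n ih =>
    rw [pow_succ', Module.End.mul_apply, LieModule.toEnd_apply_apply, leibniz_lie, K.ef, if_neg hki,
      zero_lie, zero_add, ih]
    rfl

/-- The vector is singular: `e_i` kills it because `f_j` is primitive of weight `-a_ij` for the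
`i`-th `sl₂` and the exponent is one beyond that weight; `e_j` leads to `a_ij` times an iterated
bracket of `f_i` with `f_i`; the other `e_k` commute with both. -/
theorem serre (K : IsKacMoody A h e f) {i j : ι} (hij : i ≠ j) :
    ((LieModule.toEnd ℂ L L (f i)) ^ ((-A i j).toNat + 1)) (f j) = 0 := by
  set n := (-A i j).toNat with hn
  have hnA : (n : ℤ) = - A i j := by
    rw [hn, Int.toNat_of_nonneg]
    linarith [K.offDiag i j hij]
  rw [← word_replicate]
  refine K.eq_zero_of_singular (β := Pi.single j 1 + Pi.single i ((n + 1 : ℕ) : ℤ)) ?_ ?_ fun k => ?_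
  · refine lt_of_lt_of_le (b := Pi.single j 1) (Pi.single_pos.mpr one_pos)
      (le_add_of_nonneg_right (Pi.single_nonneg.mpr (by positivity)))
  · have := K.word_f_mem (K.f_mem j) (List.replicate (n + 1) i)
    rwa [← rootWeight_sub, content_replicate, ← neg_add'] at this
  · rw [word_replicate]
    by_cases hki : k = i
    · subst hki
      by_cases hf0 : f j = 0
      · simp [hf0]
      have P : IsSl2Triple.HasPrimitiveVectorWith (K.isSl2Triple k) (f j) (n : ℂ) :=
        { ne_zero := hf0
          lie_h := by
            rw [K.hf, ← neg_smul]
            congr 1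
            exact_mod_cast hnA.symm
          lie_e := by rw [K.ef, if_neg hij] }
      rw [P.lie_e_pow_succ_toEnd_f]
      simp
    · rw [K.lie_e_pow_f hki]
      by_cases hkj : k = j
      · subst hkj
        rw [K.ef, if_pos rfl, pow_succ, Module.End.mul_apply, LieModule.toEnd_apply_apply,
          ← lie_skew, K.hf, neg_neg, map_smul, K.symm.apply]
        rcases Nat.eq_zero_or_pos n with h0 | h0
        · have : A i k = 0 := by rw [h0] at hnA; simpa using hnA.symm
          simp [this]
        · obtain ⟨m, hm⟩ := Nat.exists_eq_succ_of_ne_zero h0.ne'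
          rw [hm, pow_succ, Module.End.mul_apply, LieModule.toEnd_apply_apply, lie_self, map_zero,
            smul_zero]
      · rw [K.ef, if_neg hkj, map_zero]

/-- The elements killed by some power of `ad f_i` form a subalgebra, the Engel subalgebra, which
contains all generators. -/
theorem ad_f_nilpotent (K : IsKacMoody A h e f) (i : ι) (y : L) :
    ∃ n : ℕ, ((LieAlgebra.ad ℂ L (f i)) ^ n) y = 0 := by
  rw [← LieSubalgebra.mem_engel_iff, K.gen (LieSubalgebra.engel ℂ (f i)) (fun j => ?_) fun j => ?_]
  · trivial
  · rw [LieSubalgebra.mem_engel_iff]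
    by_cases hij : i = j
    · subst hij
      refine ⟨3, ?_⟩
      simp only [pow_succ, pow_zero, one_mul, Module.End.mul_apply, LieAlgebra.ad_apply, K.fe,
        if_pos, lie_neg, ← lie_skew (f i) (h i), K.hf, lie_smul, lie_self, smul_zero, neg_zero]
    · exact ⟨1, by simp [K.fe, hij]⟩
  · rw [LieSubalgebra.mem_engel_iff]
    by_cases hij : i = j
    · subst hij
      exact ⟨1, by simp⟩
    · exact ⟨_, K.serre hij⟩

theorem ad_e_nilpotent (K : IsKacMoody A h e f) (i : ι) (y : L) :
    ∃ n : ℕ, ((LieAlgebra.ad ℂ L (e i)) ^ n) y = 0 :=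
  K.swap.ad_f_nilpotent i y

/-- A reflection of weights without the Weyl group: raise `v` to the top `u = e_i^q v` of its
string, a primitive vector of weight `m + 2q`, and lower it `m + q` times. The result is nonzero
because `m + q ≤ m + 2q`. -/
theorem exists_reflected_aux (K : IsKacMoody A h e f) {i : ι}
    (he : ∀ v : V, ∃ n : ℕ, ((LieModule.toEnd ℂ L V (e i)) ^ n) v = 0)
    {μ : ι → ℂ} {v : V} (hv : v ∈ wtSpace V h μ) (hv0 : v ≠ 0) {m : ℕ} (hm : μ i = m) :
    ∃ v' ∈ wtSpace V h (μ - rootWeight A (Pi.single i (m : ℤ))), v' ≠ 0 := by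
  classical
  have hex := he v
  set p := Nat.find hex with hp
  have hp0 : ((LieModule.toEnd ℂ L V (e i)) ^ p) v = 0 := Nat.find_spec hex
  obtain ⟨q, hq⟩ : ∃ q, p = q + 1 := by
    refine Nat.exists_eq_succ_of_ne_zero fun h0 => hv0 ?_
    rw [h0] at hp0
    simpa using hp0
  have hq0 : ((LieModule.toEnd ℂ L V (e i)) ^ q) v ≠ 0 :=
    Nat.find_min hex (by omega : q < p)
  set u := ((LieModule.toEnd ℂ L V (e i)) ^ q) v with hu
  have huw : u ∈ wtSpace V h (μ + rootWeight A (Pi.single i (q : ℤ))) := by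
    rw [hu, ← word_replicate, ← content_replicate]
    exact K.word_e_mem hv _
  have hrw : rootWeight A (Pi.single i (q : ℤ)) i = 2 * q := by
    simp [rootWeight, K.diag]
  have P : IsSl2Triple.HasPrimitiveVectorWith (K.isSl2Triple i) u (((m + 2 * q : ℕ)) : ℂ) :=
    { ne_zero := hq0
      lie_h := by
        rw [huw i, Pi.add_apply, hm, hrw]
        push_cast
        rfl
      lie_e := by
        rw [hq, pow_succ', Module.End.mul_apply] at hp0
        exact hp0 }
  have hne : ∀ j ≤ m + 2 * q, ((LieModule.toEnd ℂ L V (f i)) ^ j) u ≠ 0 := by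
    intro j hj
    induction j with
    | zero => simpa using hq0
    | succ j ih =>
      intro h0
      have h1 := P.lie_e_pow_succ_toEnd_f j
      rw [h0, lie_zero] at h1
      refine (smul_ne_zero ?_ (ih (by omega))) h1.symm
      refine mul_ne_zero (by exact_mod_cast Nat.succ_ne_zero j) ?_
      rw [sub_ne_zero]
      exact_mod_cast (by omega : m + 2 * q ≠ j)
  refine ⟨_, ?_, hne (m + q) (by omega)⟩
  have := K.word_f_mem huw (List.replicate (m + q) i)
  rw [word_replicate, content_replicate] at this
  convert this using 2
  rw [Nat.cast_add, Pi.single_add, rootWeight_add]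
  abel

theorem exists_reflected (K : IsKacMoody A h e f) {i : ι}
    (he : ∀ v : V, ∃ n : ℕ, ((LieModule.toEnd ℂ L V (e i)) ^ n) v = 0)
    (hf : ∀ v : V, ∃ n : ℕ, ((LieModule.toEnd ℂ L V (f i)) ^ n) v = 0)
    {μ : ι → ℂ} {v : V} (hv : v ∈ wtSpace V h μ) (hv0 : v ≠ 0) {m : ℤ} (hm : μ i = m) :
    ∃ v' ∈ wtSpace V h (μ - rootWeight A (Pi.single i m)), v' ≠ 0 := by
  obtain ⟨n, rfl | rfl⟩ := m.eq_nat_or_neg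
  · exact K.exists_reflected_aux he hv hv0 (by simpa using hm)
  · obtain ⟨v', h1, h2⟩ := K.swap.exists_reflected_aux hf (μ := -μ)
      (by rwa [wtSpace_neg, neg_neg]) hv0 (m := n) (by simp [hm])
    refine ⟨v', ?_, h2⟩
    rw [wtSpace_neg] at h1
    convert h1 using 2
    rw [Pi.single_neg, rootWeight_neg]
    abel

/-- Reflections preserve the norm. As long as some `(α_i|β) > 0`, reflecting in `α_i` lowers the
height, and `β` stays positive unless it is `α_i`, of norm two. If no such `i` remains, then `(β|β)
≤ 0`. -/
theorem ip_self_le_two (K : IsKacMoody A h e f) {β : ι → ℤ} (hβ : 0 < β) {x : L}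
    (hx : x ∈ wtSpace L h (rootWeight A β)) (hx0 : x ≠ 0) : ip A β β ≤ 2 := by
  obtain ⟨n, hn⟩ : ∃ n : ℕ, ∑ i, β i ≤ n := ⟨(∑ i, β i).toNat, by omega⟩
  induction n generalizing β x with
  | zero =>
    have := Fintype.sum_pos hβ
    simp at hn
    omega
  | succ n ih =>
    by_cases hdom : ∀ i, ip A (Pi.single i 1) β ≤ 0
    · rw [ip_eq_sum]
      refine (Finset.sum_nonpos fun i _ => ?_).trans (by norm_num)
      exact mul_nonpos_of_nonneg_of_nonpos (hβ.le i) (hdom i)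
    push Not at hdom
    obtain ⟨i, hi⟩ := hdom
    by_cases hs : ∃ m, β = Pi.single i m
    · obtain ⟨m, rfl⟩ := hs
      have h1 : ¬ 2 ≤ m := fun hm => hx0 (K.eq_zero_of_mem_multiple K.det i hm hx)
      have h2 := Pi.single_pos.mp hβ
      obtain rfl : m = 1 := by omega
      rw [ip_single_single, K.diag]
    · push Not at hs
      obtain ⟨k, hk, hk0⟩ := exists_ne_of_ne_single hs
      set m := ip A (Pi.single i 1) β with hm
      obtain ⟨y, hy, hy0⟩ := K.exists_reflected (V := L) (K.ad_e_nilpotent i) (K.ad_f_nilpotent i)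
        hx hx0 (i := i) (m := m) (by rw [hm, ip_single_left]; rfl)
      rw [← rootWeight_sub] at hy
      -- The coefficient at `k ≠ i` is unchanged by the reflection, so the reflected root cannot be
      -- negative.
      have hk1 : 0 < (β - Pi.single i m : ι → ℤ) k := by
        rw [Pi.sub_apply, Pi.single_eq_of_ne hk, sub_zero]
        exact lt_of_le_of_ne (hβ.le k) (Ne.symm hk0)
      have hpos : 0 < β - Pi.single i m := by
        rcases K.pos_or_neg K.det hy hy0 with h1 | h1 | h1
        · rw [h1] at hk1; exact absurd hk1 (lt_irrefl _)
        · exact h1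
        · exact absurd hk1 (not_lt_of_ge (h1.le k))
      have h2 := ih hpos hy hy0 (by
        simp only [Pi.sub_apply, Finset.sum_sub_distrib, Finset.sum_pi_single', Finset.mem_univ,
          if_true]
        push_cast at hn
        omega)
      have h3 : Pi.single i m = m • (Pi.single i 1 : ι → ℤ) := by
        rw [← Pi.single_smul]; simp
      rw [h3, ip_sub_left, ip_sub_right K.symm, ip_sub_right K.symm, ip_smul_left, ip_smul_left,
        ip_smul_right K.symm, ip_smul_right K.symm, ip_single_single, K.diag,
        ip_comm K.symm β (Pi.single i 1), ← hm] at h2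
      linarith

/-- The inequality `(β|β) < 2 (ρ|β)` for nonsimple positive roots, which makes the factor in the
Casimir identity positive: such a root has height at least two. -/
theorem ip_self_lt (K : IsKacMoody A h e f) {β : ι → ℤ} (hβ : 0 < β)
    (hs : ∀ i, β ≠ Pi.single i 1) {x : L}
    (hx : x ∈ wtSpace L h (rootWeight A β)) (hx0 : x ≠ 0) : ip A β β < 2 * ∑ i, β i := by
  have h1 := K.ip_self_le_two hβ hx hx0
  suffices h2 : 2 ≤ ∑ i, β i by omega
  by_contra h3
  obtain ⟨k, hk⟩ : ∃ k, 0 < β k := by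
    by_contra! hcon
    exact hβ.not_ge hcon
  refine hs k (sub_eq_zero.mp ?_)
  have h4 : 0 ≤ β - Pi.single k 1 := fun j => by
    by_cases hj : j = k
    · subst hj; simp; omega
    · simpa [Pi.single_eq_of_ne hj] using hβ.le j
  by_contra h5
  have h6 := Fintype.sum_pos (lt_of_le_of_ne h4 (Ne.symm h5))
  simp only [Pi.sub_apply, Finset.sum_sub_distrib, Finset.sum_pi_single', Finset.mem_univ,
    if_true] at h6
  omega

end IsKacMoody

end Integrability

/-! ### A Casimir identity on the root spaces -/

section Casimir

variable {ι : Type*} [Fintype ι] [DecidableEq ι] {L : Type*} [LieRing L] [LieAlgebra ℂ L]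
  {A : Matrix ι ι ℤ} {h e f : ι → L} {B : L →ₗ[ℂ] L →ₗ[ℂ] ℂ}

/-- Two finite families of equal length. -/
structure FamilyPair (L : Type*) where
  n : ℕ
  a : Fin n → L
  b : Fin n → L

/-- The families are dual bases of `𝔤_β` and `𝔤_{-β}`. -/
structure IsDualBases (A : Matrix ι ι ℤ) (h : ι → L) (B : L →ₗ[ℂ] L →ₗ[ℂ] ℂ) (β : ι → ℤ)
    (D : FamilyPair L) : Prop where
  a_mem : ∀ i, D.a i ∈ wtSpace L h (rootWeight A β)
  b_mem : ∀ i, D.b i ∈ wtSpace L h (rootWeight A (-β))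
  sum_a : ∀ u ∈ wtSpace L h (rootWeight A β), ∑ i, B u (D.b i) • D.a i = u
  sum_b : ∀ v ∈ wtSpace L h (rootWeight A (-β)), ∑ i, B (D.a i) v • D.b i = v

/-- Invariance of the canonical tensor: `∑ [e_k, a_i] ⊗ b_i` in degree `γ` equals `-∑ a'_j ⊗ [e_k,
b'_j]` in degree `γ + α_k`. Both sides expand, by duality, into the same double sum. -/
theorem IsDualBases.sum_lie_e (K : IsKacMoody A h e f) (hB : IsRootForm A h B) {γ : ι → ℤ} {k : ι}
    {D D' : FamilyPair L} (hD : IsDualBases A h B γ D)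
    (hD' : IsDualBases A h B (γ + Pi.single k 1) D') (P : L →ₗ[ℂ] L →ₗ[ℂ] ℂ) :
    ∑ i, P ⁅e k, D.a i⁆ (D.b i) = - ∑ j, P (D'.a j) ⁅e k, D'.b j⁆ := by
  have h1 : ∀ i, P ⁅e k, D.a i⁆ (D.b i) =
      ∑ j, B ⁅e k, D.a i⁆ (D'.b j) * P (D'.a j) (D.b i) := fun i => by
    conv_lhs => rw [← hD'.sum_a _ (IsChevalley.lie_mem_root (K.e_mem k) (hD.a_mem i)
      (add_comm _ _))]
    simp only [map_sum, LinearMap.sum_apply, map_smul, LinearMap.smul_apply, smul_eq_mul]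
  have h2 : ∀ j, P (D'.a j) ⁅e k, D'.b j⁆ =
      ∑ i, B (D.a i) ⁅e k, D'.b j⁆ * P (D'.a j) (D.b i) := fun j => by
    conv_lhs => rw [← hD.sum_b _ (IsChevalley.lie_mem_root (K.e_mem k) (hD'.b_mem j)
      (by abel))]
    simp only [map_sum, map_smul, smul_eq_mul]
  simp only [h1, h2]
  rw [Finset.sum_comm, ← Finset.sum_neg_distrib]
  refine Finset.sum_congr rfl fun j _ => ?_
  rw [← Finset.sum_neg_distrib]
  refine Finset.sum_congr rfl fun i _ => ?_
  rw [hB.invariant K.toIsChevalley K.det K.symm K.li, neg_mul]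

/-- The contribution of `𝔤_β` to the Casimir sum. -/
def casimirTerm (B : L →ₗ[ℂ] L →ₗ[ℂ] ℂ) (D : FamilyPair L) (x y : L) : ℂ :=
  ∑ i, - B ⁅D.b i, x⁆ ⁅D.a i, y⁆

theorem sum_pos_of_lt {β γ : ι → ℤ} (hβγ : β < γ) : ∑ i, β i < ∑ i, γ i := by
  have := Fintype.sum_pos (sub_pos.mpr hβγ)
  simp only [Pi.sub_apply, Finset.sum_sub_distrib] at this
  omega

theorem sum_single (k : ι) : ∑ i, (Pi.single k 1 : ι → ℤ) i = 1 := by simp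

theorem sum_add_single (β : ι → ℤ) (k : ι) :
    ∑ i, (β + Pi.single k 1 : ι → ℤ) i = ∑ i, β i + 1 := by
  simp [Finset.sum_add_distrib]

theorem Ioo_single_eq_empty (i : ι) : Finset.Ioo (0 : ι → ℤ) (Pi.single i 1) = ∅ := by
  refine Finset.eq_empty_of_forall_notMem fun β hβ => ?_
  obtain ⟨h1, h2⟩ := Finset.mem_Ioo.mp hβ
  have h3 := sum_pos_of_lt h1
  have h4 := sum_pos_of_lt h2
  rw [sum_single] at h4
  simp at h3
  omega

theorem single_pos' (k : ι) : (0 : ι → ℤ) < Pi.single k 1 := Pi.single_pos.mpr one_pos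

theorem sum_Ioo_add_single {α : ι → ℤ} (hα : 0 < α) (k : ι) {M : Type*} [AddCommMonoid M]
    (g : (ι → ℤ) → M) (hg : ∀ β, 0 < β → β < α + Pi.single k 1 → ¬ β ≤ α → g β = 0) :
    ∑ β ∈ Finset.Ioo 0 (α + Pi.single k 1), g β = g α + ∑ β ∈ Finset.Ioo 0 α, g β := by
  classical
  have h1 : (Finset.Ioo 0 (α + Pi.single k 1)).filter (· ≤ α) = insert α (Finset.Ioo 0 α) := by
    ext β
    simp only [Finset.mem_filter, Finset.mem_Ioo, Finset.mem_insert]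
    constructor
    · rintro ⟨⟨h1, _⟩, h3⟩
      rcases eq_or_lt_of_le h3 with h4 | h4
      · exact Or.inl h4
      · exact Or.inr ⟨h1, h4⟩
    · have h0 : α < α + Pi.single k 1 := lt_add_of_pos_right _ (single_pos' k)
      rintro (rfl | ⟨h1, h2⟩)
      · exact ⟨⟨hα, h0⟩, le_rfl⟩
      · exact ⟨⟨h1, h2.trans h0⟩, h2.le⟩
  rw [← Finset.sum_insert (by simp), ← h1]
  refine (Finset.sum_subset (Finset.filter_subset _ _) fun β hβ hβ' => ?_).symm
  obtain ⟨h2, h3⟩ := Finset.mem_Ioo.mp hβ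
  exact hg β h2 h3 fun h4 => hβ' (Finset.mem_filter.mpr ⟨hβ, h4⟩)

theorem sum_Ioo_add_single' {α : ι → ℤ} (hα : 0 < α) (k : ι) {M : Type*} [AddCommMonoid M]
    (g : (ι → ℤ) → M) (hg : ∀ β, 0 < β → β < α + Pi.single k 1 → ¬ Pi.single k 1 ≤ β → g β = 0) :
    ∑ β ∈ Finset.Ioo 0 (α + Pi.single k 1), g β =
      g (Pi.single k 1) + ∑ β ∈ Finset.Ioo 0 α, g (β + Pi.single k 1) := by
  classical
  have h1 : (Finset.Ioo 0 (α + Pi.single k 1)).filter (Pi.single k 1 ≤ ·) =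
      insert (Pi.single k 1) ((Finset.Ioo 0 α).image (· + Pi.single k 1)) := by
    ext β
    simp only [Finset.mem_filter, Finset.mem_Ioo, Finset.mem_insert, Finset.mem_image]
    constructor
    · rintro ⟨⟨_, h2⟩, h3⟩
      rcases eq_or_lt_of_le h3 with h4 | h4
      · exact Or.inl h4.symm
      · exact Or.inr ⟨β - Pi.single k 1, ⟨sub_pos.mpr h4, sub_lt_iff_lt_add.mpr h2⟩,
          sub_add_cancel _ _⟩
    · rintro (rfl | ⟨γ, ⟨h1, h2⟩, rfl⟩)
      · exact ⟨⟨single_pos' k, lt_add_of_pos_left _ hα⟩, le_rfl⟩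
      · exact ⟨⟨add_pos h1 (single_pos' k), add_lt_add_left h2 _⟩, le_add_of_nonneg_left h1.le⟩
  have h2 : ∑ β ∈ Finset.Ioo 0 α, g (β + Pi.single k 1) =
      ∑ β ∈ (Finset.Ioo 0 α).image (· + Pi.single k 1), g β :=
    (Finset.sum_image fun _ _ _ _ h => add_right_cancel h).symm
  rw [h2, ← Finset.sum_insert, ← h1]
  · refine (Finset.sum_subset (Finset.filter_subset _ _) fun β hβ hβ' => ?_).symm
    obtain ⟨h2, h3⟩ := Finset.mem_Ioo.mp hβ
    exact hg β h2 h3 fun h4 => hβ' (Finset.mem_filter.mpr ⟨hβ, h4⟩)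
  · simp

theorem IsRootForm.hVec_hVec (hB : IsRootForm A h B) (β γ : ι → ℤ) :
    B (hVec h β) (hVec h γ) = ip A β γ := by
  simp only [hVec_apply, map_sum, LinearMap.sum_apply, map_smul, LinearMap.smul_apply, hB.h_h,
    smul_eq_mul, ip, dotProduct, Matrix.mulVec, Int.cast_sum, Int.cast_mul, Finset.mul_sum]
  rw [Finset.sum_comm]
  refine Finset.sum_congr rfl fun i _ => Finset.sum_congr rfl fun j _ => ?_
  ring

theorem IsDualBases.lie_b {D : FamilyPair L} {β : ι → ℤ} (hB : IsRootForm A h B)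
    (hD : IsDualBases A h B β D) {x : L} (hx : x ∈ wtSpace L h (rootWeight A β)) (i : Fin D.n) :
    ⁅D.b i, x⁆ = -(B x (D.b i) • hVec h β) := by
  rw [← lie_skew, hB.lie_eq hx (hD.b_mem i)]

theorem IsDualBases.sum_apply_lie {D : FamilyPair L} {β : ι → ℤ} (hB : IsRootForm A h B)
    (hD : IsDualBases A h B β D) {x : L} (hx : x ∈ wtSpace L h (rootWeight A β))
    (φ : L →ₗ[ℂ] L) : ∑ i, B ⁅D.b i, x⁆ (φ (D.a i)) = - B (hVec h β) (φ x) := by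
  conv_rhs => rw [← hD.sum_a x hx]
  simp only [hD.lie_b hB hx, map_neg, map_smul, map_sum, LinearMap.neg_apply, LinearMap.smul_apply,
    smul_eq_mul, Finset.sum_neg_distrib]

/-- Moving `e_k` off `x` splits each summand into three. One reproduces the identity for `x` and
`[e_k, y]`; the other two cancel by the invariance of the canonical tensor after a shift by `α_k`,
up to the boundary degrees `α` and `α_k`. The boundary terms account for the change of `(α|α)`, and
the increase of `2 ht α` by two cancels against `a_kk = 2`. -/
theorem casimir_step (K : IsKacMoody A h e f) (hB : IsRootForm A h B) {α : ι → ℤ} (hα : 0 < α)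
    (k : ι) {D : (ι → ℤ) → FamilyPair L}
    (hD : ∀ β, 0 < β → β < α + Pi.single k 1 → IsDualBases A h B β (D β))
    (ih : ∀ x ∈ wtSpace L h (rootWeight A α), ∀ y ∈ wtSpace L h (rootWeight A (-α)),
      ∑ β ∈ Finset.Ioo 0 α, casimirTerm B (D β) x y = (2 * ∑ i, α i - ip A α α : ℤ) * B x y)
    {x : L} (hx : x ∈ wtSpace L h (rootWeight A α)) {y : L}
    (hy : y ∈ wtSpace L h (rootWeight A (-(α + Pi.single k 1)))) :
    ∑ β ∈ Finset.Ioo 0 (α + Pi.single k 1), casimirTerm B (D β) ⁅e k, x⁆ y =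
      (2 * ∑ i, (α + Pi.single k 1 : ι → ℤ) i - ip A (α + Pi.single k 1) (α + Pi.single k 1) : ℤ) *
        B ⁅e k, x⁆ y := by
  have inv := hB.invariant K.toIsChevalley K.det K.symm K.li
  have hαk : α < α + Pi.single k 1 := lt_add_of_pos_right _ (single_pos' k)
  have hz : ⁅e k, y⁆ ∈ wtSpace L h (rootWeight A (-α)) :=
    IsChevalley.lie_mem_root (K.e_mem k) hy (by abel)
  have hex := IsChevalley.lie_mem_root (K.e_mem k) hx (add_comm _ _)
  let P : L →ₗ[ℂ] L →ₗ[ℂ] ℂ := LinearMap.mk₂ ℂ (fun u v => B ⁅v, x⁆ ⁅u, y⁆)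
    (fun a b c => by rw [add_lie, map_add]) (fun c a b => by rw [smul_lie, map_smul])
    (fun a b c => by rw [add_lie, map_add, LinearMap.add_apply])
    (fun c a b => by rw [smul_lie, map_smul, LinearMap.smul_apply])
  let T0 : (ι → ℤ) → ℂ := fun β => casimirTerm B (D β) x ⁅e k, y⁆
  let T1 : (ι → ℤ) → ℂ := fun β => ∑ i, P ⁅e k, (D β).a i⁆ ((D β).b i)
  let T2 : (ι → ℤ) → ℂ := fun β => ∑ i, P ((D β).a i) ⁅e k, (D β).b i⁆
  have hterm : ∀ β, casimirTerm B (D β) ⁅e k, x⁆ y = T2 β + T1 β - T0 β := fun β => by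
    simp only [T0, T1, T2, casimirTerm, P, LinearMap.mk₂_apply]
    rw [← Finset.sum_add_distrib, ← Finset.sum_sub_distrib]
    refine Finset.sum_congr rfl fun i _ => ?_
    rw [leibniz_lie ((D β).b i) (e k) x, ← lie_skew ((D β).b i) (e k), map_add,
      LinearMap.add_apply, inv (e k), leibniz_lie (e k) ((D β).a i) y, map_add, neg_lie, map_neg,
      LinearMap.neg_apply]
    ring
  -- A nonzero bracket would make `α - β` zero or a root. Zero or positive contradicts `¬ β ≤ α`;
  -- negative would force `ht α < ht β < ht α + 1`.
  have hvan : ∀ β, 0 < β → β < α + Pi.single k 1 → ¬ β ≤ α → ∀ i, ⁅(D β).b i, x⁆ = 0 := by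
    intro β h1 h2 h3 i
    by_contra h4
    rcases K.pos_or_neg K.det (IsChevalley.lie_mem_root ((hD β h1 h2).b_mem i) hx rfl) h4 with
      h5 | h5 | h5
    · exact h3 (neg_add_eq_zero.mp h5).le
    · exact h3 (neg_add_eq_sub β α ▸ h5 |> sub_pos.mp).le
    · have h6 := sum_pos_of_lt (sub_neg.mp (neg_add_eq_sub β α ▸ h5))
      have h7 := sum_pos_of_lt h2
      rw [sum_add_single] at h7
      omega
  have s0 : ∑ β ∈ Finset.Ioo 0 (α + Pi.single k 1), T0 β = T0 α + ∑ β ∈ Finset.Ioo 0 α, T0 β :=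
    sum_Ioo_add_single hα k T0 fun β h1 h2 h3 => Finset.sum_eq_zero fun i _ => by
      rw [hvan β h1 h2 h3, map_zero, LinearMap.zero_apply, neg_zero]
  have s1 : ∑ β ∈ Finset.Ioo 0 (α + Pi.single k 1), T1 β = T1 α + ∑ β ∈ Finset.Ioo 0 α, T1 β :=
    sum_Ioo_add_single hα k T1 fun β h1 h2 h3 => Finset.sum_eq_zero fun i _ => by
      simp only [P, LinearMap.mk₂_apply]
      rw [hvan β h1 h2 h3, map_zero, LinearMap.zero_apply]
  have s2 : ∑ β ∈ Finset.Ioo 0 (α + Pi.single k 1), T2 β =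
      T2 (Pi.single k 1) + ∑ β ∈ Finset.Ioo 0 α, T2 (β + Pi.single k 1) :=
    sum_Ioo_add_single' hα k T2 fun β h1 h2 h3 => Finset.sum_eq_zero fun i _ => by
      have h4 : ⁅e k, (D β).b i⁆ = 0 := by
        by_contra h4
        rcases K.pos_or_neg K.det (IsChevalley.lie_mem_root (K.e_mem k) ((hD β h1 h2).b_mem i)
          (sub_eq_add_neg _ _).symm) h4 with h5 | h5 | h5
        · exact h3 (sub_eq_zero.mp h5).le
        · have h6 := sum_pos_of_lt (sub_pos.mp h5)
          have h7 := sum_pos_of_lt h1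
          rw [sum_single] at h6
          simp at h7
          omega
        · exact h3 (sub_neg.mp h5).le
      rw [h4, map_zero]
  -- The interior terms cancel in pairs of degrees `β` and `β + α_k`; only `T1 α` and `T2 α_k`
  -- survive.
  have s12 : ∑ β ∈ Finset.Ioo 0 α, T1 β = - ∑ β ∈ Finset.Ioo 0 α, T2 (β + Pi.single k 1) := by
    rw [← Finset.sum_neg_distrib]
    refine Finset.sum_congr rfl fun β hβ => ?_
    obtain ⟨h1, h2⟩ := Finset.mem_Ioo.mp hβ
    exact IsDualBases.sum_lie_e K hB (hD β h1 (h2.trans hαk))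
      (hD _ (add_pos h1 (single_pos' k)) (add_lt_add_left h2 _)) P
  have s0' : ∑ β ∈ Finset.Ioo 0 α, T0 β = (2 * ∑ i, α i - ip A α α : ℤ) * B x ⁅e k, y⁆ :=
    ih x hx _ hz
  have hBz : B ⁅e k, x⁆ y = - B x ⁅e k, y⁆ := inv _ _ _
  have t0 : T0 α = B x ⁅e k, y⁆ * ip A α α := by
    have h1 := (hD α hα hαk).sum_apply_lie hB hx (- LieModule.toEnd ℂ L L ⁅e k, y⁆)
    simp only [LinearMap.neg_apply, LieModule.toEnd_apply_apply, lie_skew] at h1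
    simp only [T0, casimirTerm, Finset.sum_neg_distrib, h1, hB.lie_eq hx hz, map_smul,
      hB.hVec_hVec, smul_eq_mul, neg_neg]
  have t1 : T1 α = - (B ⁅e k, x⁆ y * ip A α (α + Pi.single k 1)) := by
    have h1 := (hD α hα hαk).sum_apply_lie hB hx
      (- (LieModule.toEnd ℂ L L y ∘ₗ LieModule.toEnd ℂ L L (e k)))
    simp only [LinearMap.neg_apply, LinearMap.comp_apply, LieModule.toEnd_apply_apply,
      lie_skew] at h1
    simp only [T1, P, LinearMap.mk₂_apply, h1, hB.lie_eq hex hy, map_smul,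
      hB.hVec_hVec, smul_eq_mul]
  have t2 : T2 (Pi.single k 1) = ip A (Pi.single k 1) α * B x ⁅e k, y⁆ := by
    have hDk := hD _ (single_pos' k) (lt_add_of_pos_left _ hα)
    have h1 : ∀ i, ⁅e k, (D (Pi.single k 1)).b i⁆ =
        B (e k) ((D (Pi.single k 1)).b i) • hVec h (Pi.single k 1) := fun i =>
      hB.lie_eq (K.e_mem k) (hDk.b_mem i)
    conv_rhs => rw [← hDk.sum_a _ (K.e_mem k)]
    simp only [T2, P, LinearMap.mk₂_apply, h1, smul_lie, hVec_lie_root hx, map_smul,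
      LinearMap.smul_apply, smul_eq_mul, sum_lie, map_sum, Finset.mul_sum]
    refine Finset.sum_congr rfl fun i _ => ?_
    ring
  rw [Finset.sum_congr rfl fun β _ => hterm β, Finset.sum_sub_distrib, Finset.sum_add_distrib,
    s0, s1, s2, s12, s0', t0, t1, t2, sum_add_single, ip_add_left, ip_add_right K.symm,
    ip_add_right K.symm, ip_single_single, K.diag, hBz, ip_comm K.symm α (Pi.single k 1)]
  push_cast
  ring

theorem casimir_identity (K : IsKacMoody A h e f) (hB : IsRootForm A h B) {α : ι → ℤ} (hα : 0 < α)
    {D : (ι → ℤ) → FamilyPair L} (hD : ∀ β, 0 < β → β < α → IsDualBases A h B β (D β)) :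
    ∀ x ∈ wtSpace L h (rootWeight A α), ∀ y ∈ wtSpace L h (rootWeight A (-α)),
      ∑ β ∈ Finset.Ioo 0 α, casimirTerm B (D β) x y = (2 * ∑ i, α i - ip A α α : ℤ) * B x y := by
  obtain ⟨n, hn⟩ : ∃ n : ℕ, ∑ i, α i ≤ n := ⟨(∑ i, α i).toNat, by omega⟩
  induction n generalizing α with
  | zero =>
    have := Fintype.sum_pos hα
    simp at hn
    omega
  | succ n ih =>
    intro x hx y hy
    let p : Submodule ℂ L :=
      { carrier := {x | ∑ β ∈ Finset.Ioo 0 α, casimirTerm B (D β) x y =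
          (2 * ∑ i, α i - ip A α α : ℤ) * B x y}
        add_mem' := fun {a b} ha hb => by
          rw [Set.mem_ofPred_eq] at ha hb ⊢
          rw [map_add, LinearMap.add_apply, mul_add, ← ha, ← hb, ← Finset.sum_add_distrib]
          refine Finset.sum_congr rfl fun β _ => ?_
          simp only [casimirTerm, ← Finset.sum_add_distrib]
          refine Finset.sum_congr rfl fun i _ => ?_
          rw [lie_add, map_add, LinearMap.add_apply, neg_add]
        zero_mem' := by simp [casimirTerm]
        smul_mem' := fun c a ha => by
          rw [Set.mem_ofPred_eq] at ha ⊢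
          rw [map_smul, LinearMap.smul_apply, smul_eq_mul, mul_left_comm, ← ha, Finset.mul_sum]
          refine Finset.sum_congr rfl fun β _ => ?_
          simp only [casimirTerm, Finset.mul_sum]
          refine Finset.sum_congr rfl fun i _ => ?_
          rw [lie_smul, map_smul, LinearMap.smul_apply, smul_eq_mul, mul_neg] }
    refine K.root_induction K.det hα p (fun i hi => ?_) (fun i hi _ x' hx' => ?_) hx
    · change ∑ β ∈ Finset.Ioo 0 α, casimirTerm B (D β) (e i) y = _
      rw [hi, Ioo_single_eq_empty, Finset.sum_empty, sum_single, ip_single_single, K.diag]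
      simp
    · obtain ⟨α', rfl⟩ : ∃ α', α = α' + Pi.single i 1 := ⟨α - Pi.single i 1, by abel⟩
      rw [add_sub_cancel_right] at hi hx'
      rw [sum_add_single] at hn
      push_cast at hn
      exact casimir_step K hB hi i hD
        (ih hi (fun β h1 h2 => hD β h1 (h2.trans (lt_add_of_pos_right _ (single_pos' i))))
          (by omega)) hx' hy

end Casimir

/-! ### Positive definiteness on root spaces -/

section Positivity

open scoped ComplexConjugate

theorem exists_orthonormal_expansion {W : Type*} [AddCommGroup W] [Module ℂ W]
    [FiniteDimensional ℂ W] (c : InnerProductSpace.Core ℂ W) :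
    ∃ (n : ℕ) (a : Fin n → W), ∀ u, ∑ i, c.inner (a i) u • a i = u := by
  let _ : NormedAddCommGroup W := c.toNormedAddCommGroup
  let _ : InnerProductSpace ℂ W := InnerProductSpace.ofCore c.toCore
  exact ⟨_, stdOrthonormalBasis ℂ W, fun u => (stdOrthonormalBasis ℂ W).sum_repr' u⟩

variable {ι : Type*} [Fintype ι] [DecidableEq ι] {L : Type*} [LieRing L] [LieAlgebra ℂ L]
  {A : Matrix ι ι ℤ} {h e f : ι → L} {B : L →ₗ[ℂ] L →ₗ[ℂ] ℂ} {w : L →ₛₗ[starRingEnd ℂ] L}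

/-- `w` is the Cartan-Chevalley involution. -/
structure IsChevalleyInvolution (h e f : ι → L) (w : L →ₛₗ[starRingEnd ℂ] L) : Prop where
  lie : ∀ x y, w ⁅x, y⁆ = ⁅w x, w y⁆
  map_h : ∀ i, w (h i) = - h i
  map_e : ∀ i, w (e i) = - f i
  map_f : ∀ i, w (f i) = - e i

namespace IsChevalleyInvolution

theorem involutive (hw : IsChevalleyInvolution h e f w) (K : IsKacMoody A h e f) (x : L) :
    w (w x) = x := by
  let S : LieSubalgebra ℂ L :=
    { carrier := {x | w (w x) = x}
      add_mem' := fun {a b} (ha : w (w a) = a) (hb : w (w b) = b) =>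
        show w (w (a + b)) = a + b by rw [map_add, map_add, ha, hb]
      zero_mem' := show w (w 0) = 0 by rw [map_zero, map_zero]
      smul_mem' := fun c a (ha : w (w a) = a) => show w (w (c • a)) = c • a by
        rw [LinearMap.map_smulₛₗ, LinearMap.map_smulₛₗ, ha, Complex.conj_conj]
      lie_mem' := fun {a b} (ha : w (w a) = a) (hb : w (w b) = b) =>
        show w (w ⁅a, b⁆) = ⁅a, b⁆ by rw [hw.lie, hw.lie, ha, hb] }
  have hS : S = ⊤ := K.gen S
    (fun i => show w (w (e i)) = e i by rw [hw.map_e, map_neg, hw.map_f, neg_neg])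
    (fun i => show w (w (f i)) = f i by rw [hw.map_f, map_neg, hw.map_e, neg_neg])
  have : x ∈ S := hS ▸ LieSubalgebra.mem_top x
  exact this

theorem map_mem (hw : IsChevalleyInvolution h e f w) {β : ι → ℤ} {x : L}
    (hx : x ∈ wtSpace L h (rootWeight A β)) : w x ∈ wtSpace L h (rootWeight A (-β)) := fun i => by
  rw [← neg_neg (h i), ← hw.map_h, neg_lie, ← hw.lie, hx i, LinearMap.map_smulₛₗ, rootWeight_neg,
    Pi.neg_apply, neg_smul, rootWeight, map_intCast]

theorem map_hVec (hw : IsChevalleyInvolution h e f w) (β : ι → ℤ) :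
    w (hVec h β) = - hVec h β := by
  simp [hVec_apply, map_sum, LinearMap.map_smulₛₗ, hw.map_h]

theorem apply_apply (hw : IsChevalleyInvolution h e f w) (K : IsKacMoody A h e f)
    (hB : IsRootForm A h B) {β : ι → ℤ} (hβ : β ≠ 0) {x y : L}
    (hx : x ∈ wtSpace L h (rootWeight A β)) (hy : y ∈ wtSpace L h (rootWeight A (-β))) :
    B (w x) (w y) = conj (B x y) := by
  have h1 := congrArg w (hB.lie_eq hx hy)
  rw [hw.lie, hB.lie_eq (hw.map_mem hx) (hw.map_mem hy), LinearMap.map_smulₛₗ, hw.map_hVec,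
    hVec_neg] at h1
  refine smul_left_injective ℂ ?_ h1
  rw [neg_ne_zero]
  intro h0
  have h2 : castVec β = 0 := hComb_injective K.li (by rw [hComb_castVec, h0, map_zero])
  exact hβ (funext fun i => Int.cast_eq_zero.mp (congrFun h2 i))

theorem conj_apply (hw : IsChevalleyInvolution h e f w) (K : IsKacMoody A h e f)
    (hB : IsRootForm A h B) {β : ι → ℤ} (hβ : β ≠ 0) {x y : L}
    (hx : x ∈ wtSpace L h (rootWeight A β)) (hy : y ∈ wtSpace L h (rootWeight A β)) :
    conj (B x (- w y)) = B y (- w x) := by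
  rw [← hw.apply_apply K hB hβ hx (neg_mem (hw.map_mem hy)), map_neg, hw.involutive K, map_neg,
    map_neg, hB.symm K.toIsChevalley K.det K.symm K.li (hw.map_mem hx) hy]

/-- Once `⟨x | -ω(y)⟩` is known to be an inner product on `𝔤_β`, an orthonormal basis `a_i` has the
dual basis `-ω(a_i)`; the expansion in `𝔤_{-β}` is the image under `ω` of the one in `𝔤_β`. -/
theorem exists_isDualBases (hw : IsChevalleyInvolution h e f w) (K : IsKacMoody A h e f)
    (hB : IsRootForm A h B) {β : ι → ℤ} (hβ : 0 < β)
    (pos : ∀ x ∈ wtSpace L h (rootWeight A β), x ≠ 0 → 0 < (B x (- w x)).re) :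
    ∃ D : FamilyPair L, IsDualBases A h B β D ∧ ∀ i, D.b i = - w (D.a i) := by
  have := K.finiteDimensional K.det hβ
  let c : InnerProductSpace.Core ℂ (wtSpace L h (rootWeight A β)) :=
    { inner := fun x y => B y (- w x)
      conj_inner_symm := fun x y => hw.conj_apply K hB hβ.ne' x.2 y.2
      re_inner_nonneg := fun x => by
        by_cases hx : (x : L) = 0
        · simp [hx]
        · exact (pos x x.2 hx).le
      add_left := fun x y z => by
        rw [Submodule.coe_add, map_add, neg_add, map_add]
      smul_left := fun x y r => by
        rw [Submodule.coe_smul, LinearMap.map_smulₛₗ, ← smul_neg, map_smul, smul_eq_mul]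
      definite := fun x hx => by
        by_contra hx0
        have := pos x x.2 fun h0 => hx0 (Subtype.ext h0)
        rw [show B x (- w x) = 0 from hx] at this
        exact lt_irrefl _ this }
  obtain ⟨n, a, ha⟩ := exists_orthonormal_expansion c
  have ha' : ∀ u ∈ wtSpace L h (rootWeight A β), ∑ i, B u (- w (a i)) • (a i : L) = u :=
    fun u hu => by
      have := congrArg Subtype.val (ha ⟨u, hu⟩)
      rwa [AddSubmonoidClass.coe_finsetSum] at this
  refine ⟨⟨n, fun i => a i, fun i => - w (a i)⟩, ⟨fun i => (a i).2,
    fun i => neg_mem (hw.map_mem (a i).2), ha', fun v hv => ?_⟩, fun i => rfl⟩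
  have hu : - w v ∈ wtSpace L h (rootWeight A β) := by
    have := neg_mem (hw.map_mem hv)
    rwa [neg_neg] at this
  have h1 := congrArg (fun x => - w x) (ha' _ hu)
  simp only [map_neg, neg_neg, hw.involutive K, map_sum, LinearMap.map_smulₛₗ] at h1
  rw [← Finset.sum_neg_distrib] at h1
  conv_rhs => rw [← h1]
  refine Finset.sum_congr rfl fun i _ => ?_
  have h2 := hw.conj_apply K hB hβ.ne' hu (a i).2
  rw [map_neg w, hw.involutive K, neg_neg] at h2
  rw [← h2, ← smul_neg]
  simp

/-- With `b_i = -ω(a_i)` one has `[a_i, -ω(x)] = ω([b_i, x])`, so every summand is the hermitian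
square of `[b_i, x]`. -/
theorem casimirTerm_eq (hw : IsChevalleyInvolution h e f w) (K : IsKacMoody A h e f)
    {D : FamilyPair L} (hD : ∀ i, D.b i = - w (D.a i)) (x : L) :
    casimirTerm B D x (- w x) = ∑ i, B ⁅D.b i, x⁆ (- w ⁅D.b i, x⁆) := by
  refine Finset.sum_congr rfl fun i _ => ?_
  rw [hw.lie, show w (D.b i) = - D.a i by rw [hD, map_neg, hw.involutive K], neg_lie, neg_neg, lie_neg, map_neg,
    neg_neg]

theorem re_apply_nonneg {β : ι → ℤ}
    (pos : ∀ x ∈ wtSpace L h (rootWeight A β), x ≠ 0 → 0 < (B x (- w x)).re) {x : L}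
    (hx : x ∈ wtSpace L h (rootWeight A β)) : 0 ≤ (B x (- w x)).re := by
  by_cases h0 : x = 0
  · simp [h0]
  · exact (pos x hx h0).le

/-- The hermitian form `⟨x | -ω(y)⟩` is positive definite on the root spaces of positive roots. -/
theorem apply_pos (hw : IsChevalleyInvolution h e f w) (K : IsKacMoody A h e f)
    (hB : IsRootForm A h B) {α : ι → ℤ} (hα : 0 < α) :
    ∀ x ∈ wtSpace L h (rootWeight A α), x ≠ 0 → 0 < (B x (- w x)).re := by
  obtain ⟨n, hn⟩ : ∃ n : ℕ, ∑ i, α i ≤ n := ⟨(∑ i, α i).toNat, by omega⟩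
  induction n generalizing α with
  | zero =>
    have := Fintype.sum_pos hα
    simp at hn
    omega
  | succ n ih =>
    intro x hx hx0
    by_cases hs : ∃ k, α = Pi.single k 1
    · obtain ⟨k, rfl⟩ := hs
      obtain ⟨c, rfl⟩ := K.exists_eq_smul_e K.det hx
      have hc : c ≠ 0 := fun h0 => hx0 (by rw [h0, zero_smul])
      rw [LinearMap.map_smulₛₗ w, hw.map_e, smul_neg, neg_neg, map_smul, map_smul,
        LinearMap.smul_apply, hB.e_f K.toIsChevalley K.li, smul_eq_mul, smul_eq_mul, mul_one,
        mul_comm, Complex.mul_conj]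
      exact_mod_cast Complex.normSq_pos.mpr hc
    push Not at hs
    have hlow : ∀ β, 0 < β → β < α → ∀ x ∈ wtSpace L h (rootWeight A β), x ≠ 0 →
        0 < (B x (- w x)).re := fun β h1 h2 => ih h1 (by
      have := sum_pos_of_lt h2
      push_cast at hn
      omega)
    -- A junk value for the degrees outside `0 < β < α`, needed only to choose the dual bases as a
    -- total function.
    have : Nonempty (FamilyPair L) := ⟨⟨0, 0, 0⟩⟩
    choose! D hD hDw using fun β (h1 : 0 < β) (h2 : β < α) =>
      hw.exists_isDualBases K hB h1 (hlow β h1 h2)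
    have hid := casimir_identity K hB hα hD x hx _ (neg_mem (hw.map_mem hx))
    have hpos := sub_pos.mpr (K.ip_self_lt hα hs hx hx0)
    have hmem : ∀ β, 0 < β → β < α → ∀ i, ⁅(D β).b i, x⁆ ∈ wtSpace L h (rootWeight A (α - β)) :=
      fun β h1 h2 i => IsChevalley.lie_mem_root ((hD β h1 h2).b_mem i) hx (neg_add_eq_sub β α)
    have hlow' : ∀ β, 0 < β → β < α → ∀ x ∈ wtSpace L h (rootWeight A (α - β)), x ≠ 0 →
        0 < (B x (- w x)).re := fun β h1 h2 =>
      hlow (α - β) (sub_pos.mpr h2) (sub_lt_self _ h1)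
    have hre : ∑ β ∈ Finset.Ioo 0 α, (casimirTerm B (D β) x (- w x)).re =
        ((2 * ∑ i, α i - ip A α α : ℤ) : ℝ) * (B x (- w x)).re := by
      rw [← Complex.re_sum, hid, ← Complex.ofReal_intCast, Complex.re_ofReal_mul]
    have hterm : ∀ β ∈ Finset.Ioo 0 α, (casimirTerm B (D β) x (- w x)).re =
        ∑ i, (B ⁅(D β).b i, x⁆ (- w ⁅(D β).b i, x⁆)).re := fun β hβ => by
      obtain ⟨h1, h2⟩ := Finset.mem_Ioo.mp hβ
      rw [hw.casimirTerm_eq K (hDw β h1 h2), Complex.re_sum]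
    rw [Finset.sum_congr rfl hterm] at hre
    have hnn : ∀ β ∈ Finset.Ioo 0 α, ∀ i ∈ Finset.univ,
        0 ≤ (B ⁅(D β).b i, x⁆ (- w ⁅(D β).b i, x⁆)).re := fun β hβ i _ => by
      obtain ⟨h1, h2⟩ := Finset.mem_Ioo.mp hβ
      exact re_apply_nonneg (hlow' β h1 h2) (hmem β h1 h2 i)
    -- If the norm of `x` were not positive, the sum of squares would be both nonpositive and
    -- nonnegative, so every `[b_i, x]` would vanish. The `b_i` span the lower negative root spaces,
    -- hence every `f_k` kills `x`, and `x = 0` by the singular vector lemma with `e` and `f`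
    -- exchanged.
    by_contra hcon
    have hz := le_antisymm (hre.trans_le (mul_nonpos_of_nonneg_of_nonpos
      (Int.cast_nonneg hpos.le) (not_lt.mp hcon))) (Finset.sum_nonneg fun β hβ =>
        Finset.sum_nonneg (hnn β hβ))
    have hz' : ∀ β, 0 < β → β < α → ∀ i, ⁅(D β).b i, x⁆ = 0 := fun β h1 h2 i => by
      have hβ := Finset.mem_Ioo.mpr ⟨h1, h2⟩
      have h3 := (Finset.sum_eq_zero_iff_of_nonneg fun β hβ => Finset.sum_nonneg (hnn β hβ)).mp hz
        β hβ
      have h4 := (Finset.sum_eq_zero_iff_of_nonneg (hnn β hβ)).mp h3 i (Finset.mem_univ i)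
      by_contra h5
      exact (hlow' β h1 h2 _ (hmem β h1 h2 i) h5).ne' h4
    refine hx0 (K.swap.eq_zero_of_singular hα (by rwa [IsChevalley.wtSpace_swap, neg_neg])
      fun k => ?_)
    by_contra h0
    have hfk := IsChevalley.lie_mem_root (K.f_mem k) hx (neg_add_eq_sub _ α)
    rcases K.pos_or_neg K.det hfk h0 with h1 | h1 | h1
    -- The element `f_k` is among the vectors spanned by the `b_i` only if `α_k < α`. The other
    -- possibilities for `α - α_k` are zero, excluded because `α` is not simple, and a negative
    -- root, excluded by height.
    · exact hs k (sub_eq_zero.mp h1)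
    · have h2 := sub_pos.mp h1
      have h3 := hD _ (single_pos' k) h2
      refine h0 ?_
      rw [← h3.sum_b _ (K.f_mem k), sum_lie]
      exact Finset.sum_eq_zero fun i _ => by
        rw [smul_lie, hz' _ (single_pos' k) h2, smul_zero]
    · have h2 := sum_pos_of_lt (sub_neg.mp h1)
      have h3 := sum_pos_of_lt hα
      rw [sum_single] at h2
      simp at h3
      omega

theorem exists_lie_eq (hw : IsChevalleyInvolution h e f w) (K : IsKacMoody A h e f)
    {α : ι → ℤ} (hα : 0 < α) {x : L} (hx : x ∈ wtSpace L h (rootWeight A α)) (hx0 : x ≠ 0) :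
    ∃ N : ℝ, 0 < N ∧ ⁅x, - w x⁆ = (N : ℂ) • hVec h α := by
  obtain ⟨B, hB⟩ := K.exists_isRootForm K.det K.symm K.li
  refine ⟨_, hw.apply_pos K hB hα x hx hx0, ?_⟩
  rw [Complex.conj_eq_iff_re.mp (hw.conj_apply K hB hα.ne' hx hx)]
  exact hB.lie_eq hx (neg_mem (hw.map_mem hx))

end IsChevalleyInvolution

end Positivity

/-! ### Timelike vectors of a hyperbolic root lattice -/

section Hyperbolic

variable {ι : Type*} [Fintype ι] [DecidableEq ι] {A : Matrix ι ι ℤ}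

/-- A vector with a vanishing coefficient is supported on a proper subdiagram, where the form is
positive semidefinite. -/
theorem IsHyperbolic.ip_self_nonneg (hA : IsHyperbolic A) {β : ι → ℤ} {i : ι} (hβ : β i = 0) :
    0 ≤ ip A β β := by
  have h1 := (hA.proper {i}ᶜ (by simp)).dotProduct_mulVec_nonneg fun j => (β j : ℝ)
  have h2 : star (fun j : ({i}ᶜ : Set ι) => (β j : ℝ)) ⬝ᵥ
      ((A.map (Int.cast : ℤ → ℝ)).submatrix (Subtype.val : ({i}ᶜ : Set ι) → ι)
        (Subtype.val : ({i}ᶜ : Set ι) → ι)).mulVec (fun j => (β j : ℝ)) = (ip A β β : ℝ) := by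
    have hsum : ∀ g : ι → ℝ, g i = 0 → ∑ j : ({i}ᶜ : Set ι), g j = ∑ j, g j := fun g hg => by
      rw [← Finset.sum_subset (Finset.subset_univ ({i}ᶜ : Finset ι)) fun j _ hj => by
        rw [Finset.mem_compl, Finset.mem_singleton, not_not] at hj
        rw [hj, hg]]
      exact (Finset.sum_subtype _ (by simp) _).symm
    simp only [ip, dotProduct, Matrix.mulVec, Int.cast_sum, Int.cast_mul, Matrix.submatrix_apply,
      Matrix.map_apply, Pi.star_apply, star_trivial]
    rw [hsum (fun j => (β j : ℝ) * ∑ k : ({i}ᶜ : Set ι), (A j k : ℝ) * (β k : ℝ)) (by simp [hβ])]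
    refine Finset.sum_congr rfl fun j _ => ?_
    rw [hsum (fun k => (A j k : ℝ) * (β k : ℝ)) (by simp [hβ])]
  rw [h2] at h1
  exact_mod_cast h1

theorem single_eq_smul (i : ι) (m : ℤ) : Pi.single i m = m • (Pi.single i 1 : ι → ℤ) := by
  rw [← Pi.single_smul]; simp

/-- A vector of negative norm with nonnegative coefficients has full support. -/
theorem IsHyperbolic.pos_of_ip_self_neg (hA : IsHyperbolic A) {α : ι → ℤ} (hα : 0 ≤ α)
    (hαα : ip A α α < 0) (i : ι) : 0 < α i :=
  lt_of_le_of_ne (hα i) fun h0 => absurd hαα (not_lt.mpr (hA.ip_self_nonneg h0.symm))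

theorem ip_reflect (symm : A.IsSymm) (diag : ∀ i, A i i = 2) (i : ι) (β : ι → ℤ) (m : ℤ) :
    ip A (β + Pi.single i m) (β + Pi.single i m) =
      ip A β β + 2 * m * ip A (Pi.single i 1) β + 2 * m ^ 2 := by
  rw [single_eq_smul, ip_add_left, ip_add_right symm, ip_add_right symm, ip_smul_left,
    ip_smul_left, ip_smul_right symm, ip_smul_right symm, ip_single_single, diag,
    ip_comm symm β (Pi.single i 1)]
  ring

/-- Only the `i`-th coefficient can become negative. In that case, with `β` the part of `α` off `i`,
the reflected vector is `β` plus a negative multiple of `α_i`. Since `(β|β) ≥ 0` and `(α_i|β) ≤ 0`,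
its norm would be nonnegative, but it equals `(α|α) < 0`. -/
theorem IsHyperbolic.reflect_nonneg (hA : IsHyperbolic A) {α : ι → ℤ} (hα : 0 ≤ α)
    (hαα : ip A α α < 0) (i : ι) : 0 ≤ α - Pi.single i (ip A (Pi.single i 1) α) := by
  set m := ip A (Pi.single i 1) α with hm
  intro j
  by_cases hj : j = i
  · subst hj
    rw [Pi.zero_apply, Pi.sub_apply, Pi.single_eq_same]
    by_contra hneg
    push Not at hneg
    set β := α - Pi.single j (α j) with hβ
    have h0 : 0 ≤ ip A β β := hA.ip_self_nonneg (i := j) (by simp [hβ])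
    have h1 : ip A (Pi.single j 1) β ≤ 0 := by
      rw [ip_single_left]
      refine Finset.sum_nonpos fun k _ => ?_
      by_cases hk : k = j
      · subst hk; simp [hβ]
      · refine mul_nonpos_of_nonpos_of_nonneg (hA.offDiag j k (Ne.symm hk)) ?_
        simpa [hβ, Pi.single_eq_of_ne hk] using hα k
    have h2 : α - Pi.single j m = β + Pi.single j (α j - m) := by
      rw [hβ, Pi.single_sub]; abel
    have h3 := ip_reflect hA.symm hA.diag j α (-m)
    have h4 := ip_reflect hA.symm hA.diag j β (α j - m)
    rw [Pi.single_neg, ← sub_eq_add_neg, h2, h4, ← hm] at h3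
    nlinarith [mul_nonneg_of_nonpos_of_nonpos hneg.le h1, sq_nonneg (α j - m)]
  · simpa [Pi.single_eq_of_ne hj] using hα j

/-- A quantitative form of positive definiteness on the orthogonal complement of a timelike `α`: the
vector `α_i x - x_i α` has vanishing `i`-th coefficient, hence nonnegative norm. -/
theorem IsHyperbolic.sq_mul_le (hA : IsHyperbolic A) {α x : ι → ℤ} (hx : ip A α x = 0) (i : ι) :
    x i ^ 2 * (- ip A α α) ≤ α i ^ 2 * ip A x x := by
  have h1 := hA.ip_self_nonneg (β := α i • x - x i • α) (i := i) (by simp [mul_comm])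
  rw [ip_sub_left, ip_sub_right hA.symm, ip_sub_right hA.symm, ip_smul_left, ip_smul_left,
    ip_smul_left, ip_smul_left, ip_smul_right hA.symm, ip_smul_right hA.symm,
    ip_smul_right hA.symm, ip_smul_right hA.symm, ip_comm hA.symm x α, hx] at h1
  nlinarith

/-- At fixed `(α|β)`, the norm `(β|β)` grows quadratically in the coefficients of `β`, while the
bound `2 Λ·β` grows linearly. The estimate is made at an index `i` where `β_i` is maximal; since `i`
depends on `β`, the bound `C` sums over all indices. -/
theorem IsHyperbolic.finite_level (hA : IsHyperbolic A) {α : ι → ℤ} (hα : 0 ≤ α)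
    (hαα : ip A α α < 0) (Λ : ι → ℕ) (d : ℤ) :
    {β : ι → ℤ | 0 ≤ β ∧ ip A β β ≤ 2 * ∑ i, (Λ i : ℤ) * β i ∧ ip A α β = d}.Finite := by
  set S : ℤ := ∑ i, (Λ i : ℤ) with hS
  have hS0 : 0 ≤ S := Finset.sum_nonneg fun i _ => Int.natCast_nonneg _
  let C : ℤ := ∑ i, (2 * α i ^ 2 * S + 2 * |d| * α i)
  have hterm : ∀ i ∈ Finset.univ, 0 ≤ 2 * α i ^ 2 * S + 2 * |d| * α i := fun i _ => by
    have := hα i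
    rw [Pi.zero_apply] at this
    positivity
  refine (Set.finite_Icc (0 : ι → ℤ) fun _ => C).subset fun β ⟨h0, h1, h2⟩ => ⟨h0, fun j => ?_⟩
  obtain ⟨i, -, hi⟩ := Finset.exists_max_image Finset.univ β ⟨j, Finset.mem_univ j⟩
  refine (hi j (Finset.mem_univ j)).trans (le_trans ?_ (Finset.single_le_sum hterm
    (Finset.mem_univ i)))
  have hb := h0 i
  rw [Pi.zero_apply] at hb
  have hΛ : ∑ j, (Λ j : ℤ) * β j ≤ S * β i := by
    rw [hS, Finset.sum_mul]
    exact Finset.sum_le_sum fun k hk => mul_le_mul_of_nonneg_left (hi k hk) (Int.natCast_nonneg _)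
  set a := - ip A α α with ha
  have ha0 : 0 < a := by omega
  -- The projection of `β` to the orthogonal complement of `α`, scaled by `a = -(α|α)` to stay
  -- integral.
  have hx : ip A α (a • β + d • α) = 0 := by
    rw [ip_add_right hA.symm, ip_smul_right hA.symm, ip_smul_right hA.symm, h2, ha]
    ring
  have h3 := hA.sq_mul_le hx i
  rw [← ha, ip_add_left, ip_add_right hA.symm, ip_add_right hA.symm, ip_smul_left, ip_smul_left,
    ip_smul_left, ip_smul_left, ip_smul_right hA.symm, ip_smul_right hA.symm,
    ip_smul_right hA.symm, ip_smul_right hA.symm, ip_comm hA.symm β α, h2,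
    show ip A α α = -a by omega] at h3
  simp only [Pi.add_apply, Pi.smul_apply, smul_eq_mul] at h3
  have hαi := hα i
  rw [Pi.zero_apply] at hαi
  have h4 : a * (a * (a * β i ^ 2)) ≤ a * (a * ((2 * α i ^ 2 * S - 2 * d * α i) * β i)) := by
    have h5 := mul_le_mul_of_nonneg_left (h1.trans (mul_le_mul_of_nonneg_left hΛ zero_le_two))
      (mul_nonneg (sq_nonneg (α i)) (sq_nonneg a))
    nlinarith
  have h6 := le_of_mul_le_mul_left (le_of_mul_le_mul_left h4 ha0) ha0
  have h7 : -d * α i ≤ |d| * α i := mul_le_mul_of_nonneg_right (neg_le_abs d) hαi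
  rcases hb.eq_or_lt with hb0 | hb0
  · rw [← hb0]; exact hterm i (Finset.mem_univ i)
  · have h8 : a * β i ≤ 2 * α i ^ 2 * S - 2 * d * α i := by
      refine le_of_mul_le_mul_right ?_ hb0
      nlinarith
    nlinarith

end Hyperbolic

/-! ### Weights of irreducible highest weight modules -/

section HighestWeight

variable {ι : Type*} [Fintype ι] [DecidableEq ι] {L : Type*} [LieRing L] [LieAlgebra ℂ L]
  {A : Matrix ι ι ℤ} {h e f : ι → L}
  {V : Type*} [AddCommGroup V] [Module ℂ V] [LieRingModule L V] [LieModule ℂ L V]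

/-- `V` is irreducible, with highest weight vector `v₀` of the dominant integral weight `Λ`. -/
structure IsHighestWeightModule (h e : ι → L) (Λ : ι → ℕ) (v₀ : V) : Prop where
  irr : LieModule.IsIrreducible ℂ L V
  ne_zero : v₀ ≠ 0
  mem : v₀ ∈ wtSpace V h fun i => (Λ i : ℂ)
  lie_e : ∀ i, ⁅e i, v₀⁆ = 0

namespace IsHighestWeightModule

variable {Λ : ι → ℕ} {v₀ : V}

theorem eq_top (M : IsHighestWeightModule h e Λ v₀) (S : Submodule ℂ V)
    (hS : ∀ x : L, ∀ v ∈ S, ⁅x, v⁆ ∈ S) {v : V} (hv : v ∈ S) (hv0 : v ≠ 0) : S = ⊤ := by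
  have := M.irr
  let N : LieSubmodule ℂ L V := { S with lie_mem := fun {x m} hm => hS x m hm }
  have hN : N = ⊤ := (eq_bot_or_eq_top N).resolve_left fun h0 => hv0 (by
    have : v ∈ N := hv
    rwa [h0, LieSubmodule.mem_bot] at this)
  exact congrArg LieSubmodule.toSubmodule hN

theorem span_words (M : IsHighestWeightModule h e Λ v₀) (K : IsKacMoody A h e f) {μ : ι → ℂ}
    {v : V} (hv : v ∈ wtSpace V h μ) (hv0 : v ≠ 0) (hev : ∀ i, ⁅e i, v⁆ = 0) :
    Submodule.span ℂ (Set.range fun l => word f l v) = ⊤ :=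
  M.eq_top _ (K.span_words_isLieStable hv hev) (Submodule.subset_span ⟨[], rfl⟩) hv0

theorem mem_span (M : IsHighestWeightModule h e Λ v₀) (K : IsKacMoody A h e f) {μ : ι → ℂ}
    {v : V} (hv : v ∈ wtSpace V h μ) :
    v ∈ Submodule.span ℂ ((fun l => word f l v₀) ''
      {l | (fun i => (Λ i : ℂ)) - rootWeight A (content l) = μ}) :=
  mem_span_of_mem_wtSpace (fun l => K.word_f_mem M.mem l) (M.span_words K M.mem M.ne_zero M.lie_e)
    hv

theorem exists_content (M : IsHighestWeightModule h e Λ v₀) (K : IsKacMoody A h e f) {μ : ι → ℂ}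
    {v : V} (hv : v ∈ wtSpace V h μ) (hv0 : v ≠ 0) :
    ∃ β : ι → ℤ, 0 ≤ β ∧ μ = (fun i => (Λ i : ℂ)) - rootWeight A β := by
  by_contra! hcon
  have h1 := M.mem_span K hv
  rw [Set.eq_empty_of_forall_notMem (s := {l : List ι | _})
    fun l hl => hcon _ (content_nonneg l) hl.symm, Set.image_empty, Submodule.span_empty] at h1
  exact hv0 h1

theorem nonneg_of_mem (M : IsHighestWeightModule h e Λ v₀) (K : IsKacMoody A h e f) {β : ι → ℤ}
    {v : V} (hv : v ∈ wtSpace V h ((fun i => (Λ i : ℂ)) - rootWeight A β)) (hv0 : v ≠ 0) :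
    0 ≤ β := by
  obtain ⟨γ, h1, h2⟩ := M.exists_content K hv hv0
  rwa [rootWeight_injective K.det (sub_right_injective h2)]

/-- A nonzero singular vector would generate the whole module by `f`-words, whose weights all lie
strictly below `Λ`; then `v₀` could not occur. -/
theorem eq_zero_of_singular (M : IsHighestWeightModule h e Λ v₀) (K : IsKacMoody A h e f)
    {β : ι → ℤ} (hβ : 0 < β) {v : V}
    (hv : v ∈ wtSpace V h ((fun i => (Λ i : ℂ)) - rootWeight A β)) (hev : ∀ i, ⁅e i, v⁆ = 0) :
    v = 0 := by
  by_contra hv0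
  have h1 := mem_span_of_mem_wtSpace (fun l => K.word_f_mem hv l) (M.span_words K hv hv0 hev) M.mem
  rw [Set.eq_empty_of_forall_notMem (s := {l : List ι | _}), Set.image_empty,
    Submodule.span_empty] at h1
  · exact M.ne_zero h1
  · intro l hl
    have h2 : (fun i => (Λ i : ℂ)) - rootWeight A β - rootWeight A (content l) =
      fun i => (Λ i : ℂ) := hl
    rw [sub_sub, sub_eq_self, ← rootWeight_add, ← rootWeight_zero (A := A)] at h2
    exact (lt_of_lt_of_le hβ (le_add_of_nonneg_right (content_nonneg l))).ne'
      (rootWeight_injective K.det h2)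

/-- By the Leibniz rule, the vectors killed by a power of `x` form a submodule. It contains `v₀`,
and `V` is irreducible. -/
theorem locally_nilpotent (M : IsHighestWeightModule h e Λ v₀) {x : L}
    (hx : ∀ y, ∃ n : ℕ, ((LieAlgebra.ad ℂ L x) ^ n) y = 0)
    (h0 : ∃ n : ℕ, ((LieModule.toEnd ℂ L V x) ^ n) v₀ = 0) (v : V) :
    ∃ n : ℕ, ((LieModule.toEnd ℂ L V x) ^ n) v = 0 := by
  have hmem : ∀ v, v ∈ (LieModule.toEnd ℂ L V x).maxGenEigenspace 0 ↔
      ∃ n : ℕ, ((LieModule.toEnd ℂ L V x) ^ n) v = 0 := fun v => by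
    simp [Module.End.mem_maxGenEigenspace]
  have htop := M.eq_top ((LieModule.toEnd ℂ L V x).maxGenEigenspace 0)
    (fun y v hv => (hmem _).mpr (exists_pow_lie_eq_zero (hx y) ((hmem v).mp hv)))
    ((hmem v₀).mpr h0) M.ne_zero
  exact (hmem v).mp (htop ▸ Submodule.mem_top)

theorem e_nilpotent (M : IsHighestWeightModule h e Λ v₀) (K : IsKacMoody A h e f) (i : ι) (v : V) :
    ∃ n : ℕ, ((LieModule.toEnd ℂ L V (e i)) ^ n) v = 0 :=
  M.locally_nilpotent (K.ad_e_nilpotent i) ⟨1, by rw [pow_one]; exact M.lie_e i⟩ v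

/-- Dominance and integrality of `Λ` enter here: `f_i^(Λ_i + 1) v₀` is a singular vector of lower
weight, hence zero. -/
theorem f_nilpotent (M : IsHighestWeightModule h e Λ v₀) (K : IsKacMoody A h e f) (i : ι) (v : V) :
    ∃ n : ℕ, ((LieModule.toEnd ℂ L V (f i)) ^ n) v = 0 := by
  refine M.locally_nilpotent (K.ad_f_nilpotent i) ⟨Λ i + 1, ?_⟩ v
  refine M.eq_zero_of_singular K (β := Pi.single i ((Λ i + 1 : ℕ) : ℤ))
    (Pi.single_pos.mpr (by positivity)) ?_ fun k => ?_
  · rw [← word_replicate, ← content_replicate]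
    exact K.word_f_mem M.mem _
  · by_cases hki : k = i
    · subst hki
      have P : IsSl2Triple.HasPrimitiveVectorWith (K.isSl2Triple k) v₀ (Λ k : ℂ) :=
        { ne_zero := M.ne_zero
          lie_h := M.mem k
          lie_e := M.lie_e k }
      rw [P.lie_e_pow_succ_toEnd_f, sub_self, mul_zero, zero_smul]
    · rw [K.lie_e_pow_f hki, M.lie_e, map_zero]

theorem exists_reflected (M : IsHighestWeightModule h e Λ v₀) (K : IsKacMoody A h e f) (i : ι)
    {β : ι → ℤ} {v : V} (hv : v ∈ wtSpace V h ((fun i => (Λ i : ℂ)) - rootWeight A β))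
    (hv0 : v ≠ 0) :
    ∃ v' ∈ wtSpace V h ((fun i => (Λ i : ℂ)) -
      rootWeight A (β + Pi.single i (Λ i - ip A (Pi.single i 1) β))), v' ≠ 0 := by
  obtain ⟨v', h1, h2⟩ := K.exists_reflected (M.e_nilpotent K i) (M.f_nilpotent K i) hv hv0
    (i := i) (m := Λ i - ip A (Pi.single i 1) β) (by
      rw [ip_single_left, Pi.sub_apply, rootWeight]
      push_cast
      rfl)
  exact ⟨v', by rwa [rootWeight_add, ← sub_sub], h2⟩

/-- This says `|Λ - β|² ≤ |Λ|²`. If `Λ - β` is dominant, then `(β|β) ≤ Λ·β`. Otherwise a reflection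
lowers the height of `β` and leaves `(β|β) - 2 Λ·β` unchanged. -/
theorem ip_self_le (M : IsHighestWeightModule h e Λ v₀) (K : IsKacMoody A h e f) {β : ι → ℤ} {v : V}
    (hv : v ∈ wtSpace V h ((fun i => (Λ i : ℂ)) - rootWeight A β)) (hv0 : v ≠ 0) :
    ip A β β ≤ 2 * ∑ i, (Λ i : ℤ) * β i := by
  -- The bound is strict because `β = 0` is allowed; the base case is then empty.
  obtain ⟨n, hn⟩ : ∃ n : ℕ, ∑ i, β i < n := ⟨(∑ i, β i).toNat + 1, by omega⟩
  induction n generalizing β v with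
  | zero =>
    have := Finset.sum_nonneg fun i (_ : i ∈ Finset.univ) => M.nonneg_of_mem K hv hv0 i
    simp at hn this
    omega
  | succ n ih =>
    have hβ := M.nonneg_of_mem K hv hv0
    by_cases hdom : ∀ i, ip A (Pi.single i 1) β ≤ Λ i
    · have h1 : 0 ≤ ∑ i, (Λ i : ℤ) * β i :=
        Finset.sum_nonneg fun i _ => mul_nonneg (Int.natCast_nonneg _) (hβ i)
      have h2 : ip A β β ≤ ∑ i, (Λ i : ℤ) * β i := by
        rw [ip_eq_sum]
        refine Finset.sum_le_sum fun i _ => ?_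
        rw [mul_comm]
        exact mul_le_mul_of_nonneg_right (hdom i) (hβ i)
      omega
    · push Not at hdom
      obtain ⟨i, hi⟩ := hdom
      obtain ⟨v', h1, h2⟩ := M.exists_reflected K i hv hv0
      set m := Λ i - ip A (Pi.single i 1) β with hm
      have h3 := ih h1 h2 (by
        simp only [Pi.add_apply, Finset.sum_add_distrib, Finset.sum_pi_single', Finset.mem_univ,
          if_true]
        push_cast at hn
        omega)
      rw [ip_reflect K.symm K.diag] at h3
      have h4 : ∑ j, (Λ j : ℤ) * (β + Pi.single i m : ι → ℤ) j =
          ∑ j, (Λ j : ℤ) * β j + Λ i * m := by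
        simp [mul_add, Finset.sum_add_distrib, Pi.single_apply]
      rw [h4, show ip A (Pi.single i 1) β = Λ i - m by omega] at h3
      nlinarith

/-- The pairing of `Λ - β` with `α` is unchanged when both are reflected. Reflecting lowers the
height of `α`, which stays nonnegative, until all `(α_i|α) ≤ 0`. Then `(α|β) ≤ 0`, while `Λ·α > 0`
because `α` has full support and `Λ ≠ 0`. -/
theorem level_pos (M : IsHighestWeightModule h e Λ v₀) (K : IsKacMoody A h e f)
    (hA : IsHyperbolic A) (hΛ : Λ ≠ 0) {α : ι → ℤ} (hα : 0 ≤ α) (hαα : ip A α α < 0) {β : ι → ℤ}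
    {v : V} (hv : v ∈ wtSpace V h ((fun i => (Λ i : ℂ)) - rootWeight A β)) (hv0 : v ≠ 0) :
    ip A α β < ∑ i, (Λ i : ℤ) * α i := by
  obtain ⟨n, hn⟩ : ∃ n : ℕ, ∑ i, α i < n := ⟨(∑ i, α i).toNat + 1, by omega⟩
  induction n generalizing α β v with
  | zero =>
    have := Finset.sum_nonneg fun i (_ : i ∈ Finset.univ) => hα i
    simp at hn this
    omega
  | succ n ih =>
    have hβ := M.nonneg_of_mem K hv hv0
    by_cases hdom : ∀ i, ip A (Pi.single i 1) α ≤ 0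
    · have h1 : ip A α β ≤ 0 := by
        rw [ip_comm K.symm, ip_eq_sum]
        exact Finset.sum_nonpos fun i _ => mul_nonpos_of_nonneg_of_nonpos (hβ i) (hdom i)
      obtain ⟨k, hk⟩ := Function.ne_iff.mp hΛ
      have h2 : 0 < ∑ i, (Λ i : ℤ) * α i :=
        Finset.sum_pos' (fun i _ => mul_nonneg (Int.natCast_nonneg _) (hα i))
          ⟨k, Finset.mem_univ k, mul_pos (by exact_mod_cast Nat.pos_of_ne_zero hk)
            (hA.pos_of_ip_self_neg hα hαα k)⟩
      omega
    · push Not at hdom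
      obtain ⟨i, hi⟩ := hdom
      obtain ⟨v', h1, h2⟩ := M.exists_reflected K i hv hv0
      have h0 := hA.reflect_nonneg hα hαα i
      set m := ip A (Pi.single i 1) α with hm
      set k := Λ i - ip A (Pi.single i 1) β with hk
      have h3 := ip_reflect K.symm K.diag i α (-m)
      rw [Pi.single_neg, ← sub_eq_add_neg, ← hm] at h3
      have h4 := ih h0 (by nlinarith) h1 h2 (by
        simp only [Pi.sub_apply, Finset.sum_sub_distrib, Finset.sum_pi_single', Finset.mem_univ,
          if_true]
        push_cast at hn
        omega)
      have h5 : ∑ j, (Λ j : ℤ) * (α - Pi.single i m : ι → ℤ) j =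
          ∑ j, (Λ j : ℤ) * α j - Λ i * m := by
        simp [mul_sub, Finset.sum_sub_distrib, Pi.single_apply]
      rw [h5, ip_sub_left, ip_add_right K.symm, ip_add_right K.symm, single_eq_smul i m,
        single_eq_smul i k, ip_smul_left, ip_smul_right K.symm, ip_smul_left, ip_smul_right K.symm,
        ip_single_single, K.diag, ip_comm K.symm α (Pi.single i 1), ← hm,
        show ip A (Pi.single i 1) β = Λ i - k by omega] at h4
      nlinarith

theorem sum_mul_weight (α β : ι → ℤ) :
    ∑ i, (α i : ℂ) * ((fun i => (Λ i : ℂ)) - rootWeight A β) i =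
      ((∑ i, (Λ i : ℤ) * α i - ip A α β : ℤ) : ℂ) := by
  simp only [Pi.sub_apply, mul_sub, Finset.sum_sub_distrib, ip, dotProduct, rootWeight]
  push_cast
  simp only [mul_comm]

theorem exists_level (M : IsHighestWeightModule h e Λ v₀) (K : IsKacMoody A h e f)
    (hA : IsHyperbolic A) (hΛ : Λ ≠ 0) {α : ι → ℤ} (hα : 0 ≤ α) (hαα : ip A α α < 0)
    {μ : ι → ℂ} {v : V} (hv : v ∈ wtSpace V h μ) (hv0 : v ≠ 0) :
    ∃ p : ℤ, 0 < p ∧ ∑ i, (α i : ℂ) * μ i = p := by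
  obtain ⟨β, -, rfl⟩ := M.exists_content K hv hv0
  exact ⟨_, sub_pos.mpr (M.level_pos K hA hΛ hα hαα hv hv0), sum_mul_weight α β⟩

/-- Only finitely many `β` occur at a given level by `finite_level`, and each is the content of
finitely many words. -/
theorem exists_finiteDimensional (M : IsHighestWeightModule h e Λ v₀) (K : IsKacMoody A h e f)
    (hA : IsHyperbolic A) {α : ι → ℤ} (hα : 0 ≤ α) (hαα : ip A α α < 0) (c : ℂ) :
    ∃ W : Submodule ℂ V, FiniteDimensional ℂ W ∧
      ∀ μ : ι → ℂ, ∑ i, (α i : ℂ) * μ i = c → wtSpace V h μ ≤ W := by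
  by_cases hc : ∃ d : ℤ, c = ((∑ i, (Λ i : ℤ) * α i - d : ℤ) : ℂ)
  · obtain ⟨d, rfl⟩ := hc
    have hfin := (hA.finite_level hα hαα Λ d).biUnion fun β _ => finite_content_eq β
    refine ⟨_, FiniteDimensional.span_of_finite ℂ (hfin.image fun l => word f l v₀),
      fun μ hμ v hv => ?_⟩
    by_cases hv0 : v = 0
    · rw [hv0]; exact zero_mem _
    refine Submodule.span_mono (Set.image_mono fun l hl => ?_) (M.mem_span K hv)
    obtain rfl : (fun i => (Λ i : ℂ)) - rootWeight A (content l) = μ := hl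
    refine Set.mem_biUnion (x := content l) ⟨content_nonneg l, M.ip_self_le K hv hv0, ?_⟩ rfl
    rw [sum_mul_weight, Int.cast_inj] at hμ
    omega
  · refine ⟨⊥, inferInstance, fun μ hμ v hv => ?_⟩
    by_contra hv0
    obtain ⟨β, -, rfl⟩ := M.exists_content K hv hv0
    exact hc ⟨_, by rw [← hμ, sum_mul_weight]⟩

end IsHighestWeightModule

end HighestWeight

/-! ### Highest weight ladders and their direct sums -/

section Ladder

open scoped DirectSum

variable {V : Type*} [AddCommGroup V] [Module ℂ V]

namespace So21Rep

/-- `φ` is a homomorphism of representations of `so(2,1)`. -/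
def IsHom {W : Type*} [AddCommGroup W] [Module ℂ W] (D : So21Rep W) (R : So21Rep V)
    (φ : W →ₗ[ℂ] V) : Prop :=
  ∀ x, φ (D.J3 x) = R.J3 (φ x) ∧ φ (D.Jp x) = R.Jp (φ x) ∧ φ (D.Jm x) = R.Jm (φ x)

/-- The representation obtained by exchanging `J⁺` and `J⁻`. -/
def swap (R : So21Rep V) : So21Rep V where
  J3 := - R.J3
  Jp := R.Jm
  Jm := R.Jp
  lie_Jp_Jm w := by
    rw [LinearMap.neg_apply, neg_neg, ← neg_sub, R.lie_Jp_Jm, neg_neg]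
  lie_J3_Jp w := by
    simp only [LinearMap.neg_apply, map_neg]
    rw [neg_sub_neg, ← neg_sub, R.lie_J3_Jm, neg_neg]
  lie_J3_Jm w := by
    simp only [LinearMap.neg_apply, map_neg]
    rw [neg_sub_neg, ← neg_sub, R.lie_J3_Jp]

end So21Rep

theorem ladderCoeff_ne_zero {s : ℝ} (hs : 0 < s) (k : ℕ) : (ladderCoeff s k : ℂ) ≠ 0 := fun h0 => by
  have h1 := ladderCoeff_mul_self hs k
  rw [h0, zero_mul] at h1
  have h2 : (((k + 1) * (2 * s + k) / 2 : ℝ) : ℂ) = 0 := by push_cast; exact h1.symm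
  have h3 := Complex.ofReal_eq_zero.mp h2
  have : 0 < (k + 1) * (2 * s + k) / 2 := by positivity
  exact this.ne' h3

/-- The normalized vectors obtained from `u` by applying `J⁻`. -/
def ladderVec (R : So21Rep V) (s : ℝ) (u : V) : ℕ → V
  | 0 => u
  | k + 1 => (ladderCoeff s k : ℂ)⁻¹ • R.Jm (ladderVec R s u k)

variable {R : So21Rep V} {s : ℝ} {u : V}

theorem Jm_ladderVec (hs : 0 < s) (k : ℕ) :
    R.Jm (ladderVec R s u k) = (ladderCoeff s k : ℂ) • ladderVec R s u (k + 1) := by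
  rw [ladderVec, smul_inv_smul₀ (ladderCoeff_ne_zero hs k)]

theorem J3_ladderVec (hu : R.J3 u = - (s : ℂ) • u) (k : ℕ) :
    R.J3 (ladderVec R s u k) = - ((s + k : ℝ) : ℂ) • ladderVec R s u k := by
  induction k with
  | zero => simpa [ladderVec] using hu
  | succ k ih =>
    rw [ladderVec, map_smul, eq_add_of_sub_eq (R.lie_J3_Jm _), ih, map_smul, smul_comm _ (_ : ℂ)⁻¹]
    congr 1
    push_cast
    module

/-- The squares satisfy `c_{k+1}² = c_k² + s + k + 1`, and `c_0² = s`; this is the commutator of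
`J⁺` and `J⁻` evaluated along the ladder. -/
theorem Jp_ladderVec (hs : 0 < s) (hu : R.J3 u = - (s : ℂ) • u) (hu0 : R.Jp u = 0) (k : ℕ) :
    R.Jp (ladderVec R s u (k + 1)) = (ladderCoeff s k : ℂ) • ladderVec R s u k := by
  have key : ∀ k, R.Jp (ladderVec R s u (k + 1)) = (ladderCoeff s k : ℂ)⁻¹ •
      (R.Jm (R.Jp (ladderVec R s u k)) + ((s + k : ℝ) : ℂ) • ladderVec R s u k) := fun k => by
    rw [ladderVec, map_smul, eq_add_of_sub_eq (R.lie_Jp_Jm _), J3_ladderVec hu, neg_smul, neg_neg,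
      add_comm]
  rw [key]
  refine (inv_smul_eq_iff₀ (ladderCoeff_ne_zero hs k)).mpr ?_
  rw [smul_smul, ladderCoeff_mul_self hs]
  induction k with
  | zero =>
    rw [ladderVec, hu0, map_zero, zero_add]
    congr 1
    push_cast
    ring
  | succ k ih =>
    rw [key, ih, smul_smul, ← ladderCoeff_mul_self hs,
      inv_mul_cancel_left₀ (ladderCoeff_ne_zero hs k), map_smul, Jm_ladderVec hs, smul_smul,
      ladderCoeff_mul_self hs, ← add_smul]
    congr 1
    push_cast
    ring

/-- The homomorphism from the highest weight discrete series module with `v_0 ↦ u`. -/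
def ladderMap (R : So21Rep V) (s : ℝ) (u : V) : (ℕ →₀ ℂ) →ₗ[ℂ] V :=
  Finsupp.linearCombination ℂ (ladderVec R s u)

theorem ladderMap_single (k : ℕ) (a : ℂ) :
    ladderMap R s u (Finsupp.single k a) = a • ladderVec R s u k :=
  Finsupp.linearCombination_single _ _ _

theorem isHom_ladderMap (s : {s : ℝ // 0 < s}) (hu : R.J3 u = - ((s : ℝ) : ℂ) • u)
    (hu0 : R.Jp u = 0) : (discreteMinus s).IsHom R (ladderMap R s u) := by
  intro x
  induction x using Finsupp.induction_linear with
  | zero => simp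
  | add x y hx hy =>
    simp only [map_add, hx, hy, and_self]
  | single k a =>
    refine ⟨?_, ?_, ?_⟩
    · rw [discreteMinus, LinearMap.neg_apply, map_neg, ladderWeight_single, ladderMap_single,
        ladderMap_single, map_smul, J3_ladderVec hu]
      module
    · change ladderMap R s u (ladderBack s _) = _
      cases k with
      | zero => rw [ladderBack_single_zero, map_zero, ladderMap_single, map_smul, ladderVec, hu0,
          smul_zero]
      | succ k => rw [ladderBack_single_succ, ladderMap_single, ladderMap_single, map_smul,
          Jp_ladderVec s.2 hu hu0, smul_smul]
    · change ladderMap R s u (ladderAway s _) = _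
      rw [ladderAway_single, ladderMap_single, ladderMap_single, map_smul, Jm_ladderVec s.2,
        smul_smul]

theorem exists_pow_add_eq_zero {X : Type*} [AddCommMonoid X] [Module ℂ X] {P : Module.End ℂ X}
    {x y : X} (hx : ∃ n : ℕ, (P ^ n) x = 0) (hy : ∃ n : ℕ, (P ^ n) y = 0) :
    ∃ n : ℕ, (P ^ n) (x + y) = 0 := by
  obtain ⟨m, hm⟩ := hx
  obtain ⟨n, hn⟩ := hy
  refine ⟨n + m, ?_⟩
  rw [map_add, pow_add, Module.End.mul_apply, hm, map_zero, zero_add, ← pow_add, add_comm, pow_add,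
    Module.End.mul_apply, hn, map_zero]

theorem ladderBack_nilpotent (s : ℝ) (x : ℕ →₀ ℂ) :
    ∃ n : ℕ, ((ladderBack s : Module.End ℂ (ℕ →₀ ℂ)) ^ n) x = 0 := by
  induction x using Finsupp.induction_linear with
  | zero => exact ⟨0, rfl⟩
  | add x y hx hy => exact exists_pow_add_eq_zero hx hy
  | single k a =>
    refine ⟨k + 1, ?_⟩
    induction k generalizing a with
    | zero => rw [zero_add, pow_one, ladderBack_single_zero]
    | succ k ih => rw [pow_succ, Module.End.mul_apply, ladderBack_single_succ, ih]

theorem eq_single_of_ladderBack_eq_zero {s : ℝ} (hs : 0 < s) {x : ℕ →₀ ℂ}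
    (hx : ladderBack s x = 0) : x = Finsupp.single 0 (x 0) := by
  have key : ∀ (x : ℕ →₀ ℂ) k, ladderBack s x k = x (k + 1) * (ladderCoeff s k : ℂ) := fun x k => by
    induction x using Finsupp.induction_linear with
    | zero => simp
    | add x y hx hy => rw [map_add, Finsupp.add_apply, hx, hy, Finsupp.add_apply, add_mul]
    | single j a =>
      cases j with
      | zero => rw [ladderBack_single_zero]; simp
      | succ j =>
        rw [ladderBack_single_succ]
        by_cases hj : j = k
        · subst hj; simp
        · rw [Finsupp.single_eq_of_ne (Ne.symm hj), Finsupp.single_eq_of_ne (by omega), zero_mul]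
  ext k
  cases k with
  | zero => simp
  | succ k =>
    have h1 := key x k
    rw [hx, Finsupp.zero_apply] at h1
    rw [Finsupp.single_eq_of_ne (by omega)]
    exact (mul_eq_zero.mp h1.symm).resolve_right (ladderCoeff_ne_zero hs k)

theorem ladderBack_surjective {s : ℝ} (hs : 0 < s) : Function.Surjective (ladderBack s) := by
  rw [← LinearMap.range_eq_top, eq_top_iff]
  intro x _
  induction x using Finsupp.induction_linear with
  | zero => exact zero_mem _
  | add x y hx hy => exact add_mem (hx trivial) (hy trivial)
  | single k a =>
    refine ⟨Finsupp.single (k + 1) (a * (ladderCoeff s k : ℂ)⁻¹), ?_⟩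
    rw [ladderBack_single_succ, inv_mul_cancel_right₀ (ladderCoeff_ne_zero hs k)]

/-- A linear map that intertwines `P` with `Q`, where `P` is locally nilpotent, is injective if it is
injective on the kernel of `P`. -/
theorem injective_of_locally_nilpotent {X Y : Type*} [AddCommGroup X] [Module ℂ X] [AddCommGroup Y]
    [Module ℂ Y] {P : Module.End ℂ X} {Q : Module.End ℂ Y} {φ : X →ₗ[ℂ] Y}
    (hP : ∀ x, ∃ n : ℕ, (P ^ n) x = 0) (hφ : ∀ x, φ (P x) = Q (φ x))
    (hker : ∀ x, P x = 0 → φ x = 0 → x = 0) : Function.Injective φ := by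
  refine (injective_iff_map_eq_zero φ).mpr fun x hx => ?_
  obtain ⟨n, hn⟩ := hP x
  induction n generalizing x with
  | zero => simpa using hn
  | succ n ih =>
    rw [pow_succ, Module.End.mul_apply] at hn
    exact hker x (ih (P x) (by rw [hφ, hx, map_zero]) hn) hx

/-- The kernel of `J⁺` on the discrete series module is the line through `v_0`, which goes to the
line through `u ≠ 0`. -/
theorem ladderMap_injective (s : {s : ℝ // 0 < s}) (hu : R.J3 u = - ((s : ℝ) : ℂ) • u)
    (hu0 : R.Jp u = 0) (hne : u ≠ 0) : Function.Injective (ladderMap R s u) := by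
  refine injective_of_locally_nilpotent (ladderBack_nilpotent s)
    (fun x => (isHom_ladderMap s hu hu0 x).2.1) fun x hx hx' => ?_
  rw [eq_single_of_ladderBack_eq_zero s.2 hx, ladderMap_single] at hx'
  rw [eq_single_of_ladderBack_eq_zero s.2 hx, (smul_eq_zero.mp hx').resolve_right hne,
    Finsupp.single_zero]

variable {κ : Type*} [DecidableEq κ]

/-- The sum of the homomorphisms with `v_0 ↦ u p`. -/
def ladderSum (R : So21Rep V) (σ : κ → {s : ℝ // 0 < s}) (u : κ → V) :
    (⨁ _ : κ, ℕ →₀ ℂ) →ₗ[ℂ] V :=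
  DirectSum.toModule ℂ κ V fun p => ladderMap R (σ p) (u p)

/-- The operator `J⁺` on the direct sum of highest weight discrete series modules. -/
def sumBack (σ : κ → {s : ℝ // 0 < s}) : Module.End ℂ (⨁ _ : κ, ℕ →₀ ℂ) :=
  DFinsupp.mapRange.linearMap fun p => ladderBack (σ p)

theorem sumBack_apply (σ : κ → {s : ℝ // 0 < s}) (x : ⨁ _ : κ, ℕ →₀ ℂ) (p : κ) :
    sumBack σ x p = ladderBack (σ p) (x p) :=
  DFinsupp.mapRange_apply _ (fun _ => map_zero _) _ _

theorem sumBack_lof (σ : κ → {s : ℝ // 0 < s}) (p : κ) (x : ℕ →₀ ℂ) :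
    sumBack σ (DirectSum.lof ℂ κ (fun _ => ℕ →₀ ℂ) p x) =
      DirectSum.lof ℂ κ (fun _ => ℕ →₀ ℂ) p (ladderBack (σ p) x) :=
  DFinsupp.mapRange_single (hf := fun _ => map_zero _)

theorem sumBack_nilpotent (σ : κ → {s : ℝ // 0 < s}) (x : ⨁ _ : κ, ℕ →₀ ℂ) :
    ∃ n : ℕ, ((sumBack σ) ^ n) x = 0 := by
  induction x using DirectSum.induction_on with
  | zero => exact ⟨0, rfl⟩
  | add x y hx hy => exact exists_pow_add_eq_zero hx hy
  | of p x =>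
    obtain ⟨n, hn⟩ := ladderBack_nilpotent (σ p) x
    have h1 : ∀ x, ((sumBack σ) ^ n) (DirectSum.lof ℂ κ (fun _ => ℕ →₀ ℂ) p x) =
        DirectSum.lof ℂ κ (fun _ => ℕ →₀ ℂ) p
          (((ladderBack (σ p) : Module.End ℂ (ℕ →₀ ℂ)) ^ n) x) := fun x => by
      clear hn
      induction n generalizing x with
      | zero => rfl
      | succ n ih => rw [pow_succ, pow_succ, Module.End.mul_apply, Module.End.mul_apply,
          sumBack_lof, ih]
    exact ⟨n, (h1 x).trans (by rw [hn, map_zero])⟩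

/-- All `c_k` are nonzero because `s > 0`. This surjectivity takes the place of complete
reducibility. -/
theorem sumBack_surjective (σ : κ → {s : ℝ // 0 < s}) : Function.Surjective (sumBack σ) := by
  rw [← LinearMap.range_eq_top, eq_top_iff]
  intro x _
  induction x using DirectSum.induction_on with
  | zero => exact zero_mem _
  | add x y hx hy => exact add_mem (hx trivial) (hy trivial)
  | of p x =>
    obtain ⟨y, rfl⟩ := ladderBack_surjective (σ p).2 x
    exact ⟨_, sumBack_lof σ p y⟩

theorem ladderSum_lof (σ : κ → {s : ℝ // 0 < s}) (w : κ → V) (p : κ) (x : ℕ →₀ ℂ) :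
    ladderSum R σ w (DirectSum.lof ℂ κ (fun _ => ℕ →₀ ℂ) p x) = ladderMap R (σ p) (w p) x :=
  DirectSum.toModule_lof _ _ _

theorem ladderSum_lof_single (σ : κ → {s : ℝ // 0 < s}) (w : κ → V) (p : κ) (a : ℂ) :
    ladderSum R σ w (DirectSum.lof ℂ κ (fun _ => ℕ →₀ ℂ) p (Finsupp.single 0 a)) = a • w p := by
  rw [ladderSum_lof, ladderMap_single, ladderVec]

section

variable {σ : κ → {s : ℝ // 0 < s}} {w : κ → V}

theorem ladderSum_sumBack (h3 : ∀ p, R.J3 (w p) = - ((σ p : ℝ) : ℂ) • w p)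
    (hp : ∀ p, R.Jp (w p) = 0) (x : ⨁ _ : κ, ℕ →₀ ℂ) :
    ladderSum R σ w (sumBack σ x) = R.Jp (ladderSum R σ w x) := by
  induction x using DirectSum.induction_on with
  | zero => simp
  | add x y hx hy => simp only [map_add, hx, hy]
  | of p x =>
    change ladderSum R σ w (sumBack σ (DirectSum.lof ℂ κ (fun _ => ℕ →₀ ℂ) p x)) =
      R.Jp (ladderSum R σ w (DirectSum.lof ℂ κ (fun _ => ℕ →₀ ℂ) p x))
    rw [sumBack_lof, ladderSum_lof, ladderSum_lof]
    exact (isHom_ladderMap (σ p) (h3 p) (hp p) x).2.1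

/-- On the kernel of `J⁺`, spanned by the vectors `v_0` of the summands, injectivity is the linear
independence of the `w p`; local nilpotence extends it to the whole sum. -/
theorem ladderSum_injective (h3 : ∀ p, R.J3 (w p) = - ((σ p : ℝ) : ℂ) • w p)
    (hp : ∀ p, R.Jp (w p) = 0) (hli : LinearIndependent ℂ w) :
    Function.Injective (ladderSum R σ w) := by
  classical
  refine injective_of_locally_nilpotent (X := ⨁ _ : κ, ℕ →₀ ℂ) (P := sumBack σ) (Q := R.Jp)
    (sumBack_nilpotent σ) (ladderSum_sumBack h3 hp)
    fun x hx hx' => ?_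
  have h0 : ∀ p, x p = Finsupp.single 0 (x p 0) := fun p =>
    eq_single_of_ladderBack_eq_zero (σ p).2 (by rw [← sumBack_apply, hx]; rfl)
  have h1 : ∑ p ∈ DFinsupp.support x, x p 0 • w p = 0 := by
    rw [← hx']
    conv_rhs => rw [← DirectSum.sum_support_of x]
    rw [map_sum]
    refine Finset.sum_congr rfl fun p _ => ?_
    exact (ladderSum_lof_single (R := R) σ w p (x p 0)).symm.trans (congrArg
      (fun y => ladderSum R σ w (DirectSum.lof ℂ κ (fun _ => ℕ →₀ ℂ) p y)) (h0 p).symm)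
  have h2 := linearIndependent_iff'.mp hli _ _ h1
  refine DFinsupp.ext fun p => ?_
  by_cases hps : p ∈ DFinsupp.support x
  · rw [h0 p, h2 p hps, Finsupp.single_zero]
    rfl
  · exact DFinsupp.notMem_support_iff.mp hps

/-- Induction on the power of `J⁺` that kills `v`: lift `J⁺ v` to the direct sum, write the lift as
`J⁺ y`, and correct the image of `y` by an element of `ker J⁺`. -/
theorem ladderSum_surjective (h3 : ∀ p, R.J3 (w p) = - ((σ p : ℝ) : ℂ) • w p)
    (hp : ∀ p, R.Jp (w p) = 0) (hnil : ∀ v, ∃ n : ℕ, (R.Jp ^ n) v = 0)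
    (hspan : LinearMap.ker R.Jp ≤ Submodule.span ℂ (Set.range w)) :
    Function.Surjective (ladderSum R σ w) := by
  have hker : LinearMap.ker R.Jp ≤ LinearMap.range (ladderSum R σ w) :=
    hspan.trans (Submodule.span_le.mpr (by
      rintro _ ⟨p, rfl⟩
      exact ⟨_, (ladderSum_lof_single (R := R) σ w p 1).trans (one_smul _ _)⟩))
  intro v
  obtain ⟨n, hn⟩ := hnil v
  induction n generalizing v with
  | zero => exact ⟨0, by rw [map_zero]; simpa using hn.symm⟩
  | succ n ih =>
    rw [pow_succ, Module.End.mul_apply] at hn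
    obtain ⟨x, hx⟩ := ih (R.Jp v) hn
    obtain ⟨y, rfl⟩ := sumBack_surjective σ x
    rw [ladderSum_sumBack h3 hp] at hx
    obtain ⟨z, hz⟩ := hker (show v - ladderSum R σ w y ∈ LinearMap.ker R.Jp by
      rw [LinearMap.mem_ker, map_sub, hx, sub_self])
    exact ⟨z + y, by rw [map_add, hz, sub_add_cancel]⟩

end

end Ladder

/-! ### The decomposition criterion -/

section Decomposition

open scoped DirectSum

variable {ι V : Type*} [AddCommGroup V] [Module ℂ V]

/-- `R` is the direct sum of finitely many copies of each of the modules `D s`, where the generators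
have weights `μ` in the sense of `wt`, and `s = param μ`; and each nonzero weight vector annihilated by
`top` generates such a module. -/
def So21Rep.Decomposes (R : So21Rep V) (top : V →ₗ[ℂ] V)
    (D : {s : ℝ // 0 < s} → So21Rep (ℕ →₀ ℂ)) (wt : (ι → ℂ) → V → Prop)
    (param : (ι → ℂ) → ℂ) : Prop :=
  ∃ (mult : {s : ℝ // 0 < s} → ℕ)
    (Φ : (⨁ _ : (Σ s : {s : ℝ // 0 < s}, Fin (mult s)), ℕ →₀ ℂ) ≃ₗ[ℂ] V),
    (∀ p, (D p.1).IsHom R (Φ.toLinearMap ∘ₗ DirectSum.lof ℂ _ (fun _ => ℕ →₀ ℂ) p)) ∧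
    (∀ p, ∃ μ : ι → ℂ,
      wt μ (Φ (DirectSum.lof ℂ _ (fun _ => ℕ →₀ ℂ) p (Finsupp.single 0 1))) ∧
      ((p.1 : ℝ) : ℂ) = param μ) ∧
    (∀ (μ : ι → ℂ) (v : V), v ≠ 0 → wt μ v → top v = 0 →
      ∃ s : {s : ℝ // 0 < s}, ((s : ℝ) : ℂ) = param μ ∧ 0 < mult s ∧
        ∃ φ : (ℕ →₀ ℂ) →ₗ[ℂ] V, (D s).IsHom R φ ∧ Function.Injective φ ∧
          φ (Finsupp.single 0 1) = v)

/-- The kernel of `P` is stable under the `T_i`, so it contains the weight components of its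
elements and has a basis of weight vectors. -/
theorem exists_basis_of_ker {K : Type*} (P : V →ₗ[ℂ] V) (T : ι → V →ₗ[ℂ] V) {x : K → V}
    {w : K → ι → ℂ} (hx : ∀ k i, T i (x k) = w k i • x k)
    (hspan : Submodule.span ℂ (Set.range x) = ⊤) (hker : ∀ i v, P v = 0 → P (T i v) = 0) :
    ∃ b : Set V, LinearIndependent ℂ (Subtype.val : b → V) ∧
      LinearMap.ker P ≤ Submodule.span ℂ b ∧
      ∀ u ∈ b, P u = 0 ∧ ∃ μ : ι → ℂ, ∀ i, T i u = μ i • u := by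
  obtain ⟨b, hb, hbs, hli⟩ := exists_linearIndependent ℂ
    {u : V | P u = 0 ∧ ∃ μ : ι → ℂ, ∀ i, T i u = μ i • u}
  refine ⟨b, hli, fun v hv => ?_, hb⟩
  rw [hbs]
  obtain ⟨F, c, h1, h2, h3⟩ := exists_weight_decomposition T x w hx
    (v := v) (hspan ▸ Submodule.mem_top)
  rw [h1]
  exact Submodule.sum_mem _ fun μ hμ => Submodule.subset_span
    ⟨h3 (LinearMap.ker P) (fun i y hy => hker i y hy) hv μ hμ, μ,
      fun i => apply_eq_smul_of_mem_span T x w hx (h2 μ) i⟩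

theorem So21Rep.decomposes_discreteMinus {K : Type*} (R : So21Rep V) (T : ι → V →ₗ[ℂ] V)
    {x : K → V} {w : K → ι → ℂ} (hx : ∀ k i, T i (x k) = w k i • x k)
    (hspan : Submodule.span ℂ (Set.range x) = ⊤) (hker : ∀ i v, R.Jp v = 0 → R.Jp (T i v) = 0)
    (hnil : ∀ v, ∃ n : ℕ, ((R.Jp : Module.End ℂ V) ^ n) v = 0) (param : (ι → ℂ) → ℂ)
    (hJ3 : ∀ (μ : ι → ℂ) v, (∀ i, T i v = μ i • v) → R.J3 v = - param μ • v)
    (hpos : ∀ (μ : ι → ℂ) v, v ≠ 0 → (∀ i, T i v = μ i • v) →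
      ∃ s : {s : ℝ // 0 < s}, ((s : ℝ) : ℂ) = param μ)
    (hfd : ∀ c, ∃ W : Submodule ℂ V, FiniteDimensional ℂ W ∧
      ∀ (μ : ι → ℂ) v, param μ = c → (∀ i, T i v = μ i • v) → v ∈ W) :
    R.Decomposes R.Jp discreteMinus (fun μ v => ∀ i, T i v = μ i • v) param := by
  obtain ⟨b, hli, hspan', hb⟩ := exists_basis_of_ker R.Jp T hx hspan hker
  choose μ hμ using fun u : b => (hb u u.2).2
  choose σ hσ using fun u : b => hpos (μ u) u (hli.ne_zero u) (hμ u)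
  -- The generators with parameter `s` are linearly independent in a finite-dimensional space, which
  -- gives the finite multiplicity.
  have hfin : ∀ s, Finite {u : b // σ u = s} := fun s => by
    obtain ⟨W, hW, hW'⟩ := hfd ((s : ℝ) : ℂ)
    have h1 : LinearIndependent ℂ fun u : {u : b // σ u = s} =>
        (⟨u.1, hW' (μ u.1) u.1 (by rw [← hσ, u.2]) (hμ u.1)⟩ : W) := by
      refine LinearIndependent.of_comp W.subtype ?_
      exact hli.comp (fun u : {u : b // σ u = s} => u.1) Subtype.val_injective
    exact h1.finite
  let mult : {s : ℝ // 0 < s} → ℕ := fun s => Nat.card {u : b // σ u = s}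
  let E : (Σ s : {s : ℝ // 0 < s}, Fin (mult s)) ≃ b :=
    (Equiv.sigmaCongrRight fun s => (Finite.equivFin {u : b // σ u = s}).symm).trans
      (Equiv.sigmaFiberEquiv σ)
  have hE : ∀ p, σ (E p) = p.1 := fun p => ((Finite.equivFin {u : b // σ u = p.1}).symm p.2).2
  let y : (Σ s : {s : ℝ // 0 < s}, Fin (mult s)) → V := fun p => E p
  have hy3 : ∀ p, R.J3 (y p) = - ((p.1 : ℝ) : ℂ) • y p := fun p => by
    rw [hJ3 (μ (E p)) (y p) (hμ (E p)), ← hσ, hE]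
  have hyp : ∀ p, R.Jp (y p) = 0 := fun p => (hb _ (E p).2).1
  have hyli : LinearIndependent ℂ y := hli.comp E E.injective
  have hyr : Set.range y = b := by
    change Set.range (Subtype.val ∘ E) = b
    rw [E.surjective.range_comp, Subtype.range_coe]
  refine ⟨mult, LinearEquiv.ofBijective (ladderSum R Sigma.fst y)
    ⟨ladderSum_injective hy3 hyp hyli,
      ladderSum_surjective hy3 hyp hnil (by rw [hyr]; exact hspan')⟩, fun p => ?_, fun p => ?_,
    fun ν v hv0 hv hvp => ?_⟩
  · have h1 : ladderSum R Sigma.fst y ∘ₗ DirectSum.lof ℂ _ (fun _ => ℕ →₀ ℂ) p =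
        ladderMap R p.1 (y p) := LinearMap.ext fun z => ladderSum_lof _ _ _ _
    change (discreteMinus p.1).IsHom R
      (ladderSum R Sigma.fst y ∘ₗ DirectSum.lof ℂ _ (fun _ => ℕ →₀ ℂ) p)
    rw [h1]
    exact isHom_ladderMap p.1 (hy3 p) (hyp p)
  · refine ⟨μ (E p), fun i => ?_, by rw [← hσ, hE]⟩
    have h1 := ladderSum_lof_single (R := R) Sigma.fst y p 1
    rw [one_smul] at h1
    change T i (ladderSum R Sigma.fst y _) = _ • ladderSum R Sigma.fst y _
    rw [h1]
    exact hμ (E p) i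
  · obtain ⟨s, hs⟩ := hpos ν v hv0 hv
    have hv3 : R.J3 v = - ((s : ℝ) : ℂ) • v := by rw [hJ3 ν v hv, hs]
    refine ⟨s, hs, ?_, ladderMap R s v, isHom_ladderMap s hv3 hvp,
      ladderMap_injective s hv3 hvp hv0, ?_⟩
    -- A weight vector in `ker J⁺` is a combination of basis vectors of the same weight, so some
    -- basis vector has that weight and hence the same parameter.
    · have h1 := mem_span_of_weight T (Subtype.val : b → V) μ hμ
        (by rw [Subtype.range_coe]; exact hspan' hvp) hv
      have h2 : ∃ u : b, μ u = ν := by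
        by_contra! hcon
        rw [Set.eq_empty_of_forall_notMem (s := {u : b | μ u = ν}) hcon, Set.image_empty,
          Submodule.span_empty] at h1
        exact hv0 h1
      obtain ⟨u, rfl⟩ := h2
      have h3 : σ u = s := Subtype.ext (Complex.ofReal_injective (by rw [hσ, hs]))
      have : Nonempty {u : b // σ u = s} := ⟨⟨u, h3⟩⟩
      exact Nat.card_pos
    · rw [ladderMap_single, one_smul, ladderVec]

end Decomposition

/-! ### Application to highest weight modules -/

section HighestWeightDecomposition

variable {ι : Type*} [Fintype ι] [DecidableEq ι] {L : Type*} [LieRing L] [LieAlgebra ℂ L]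
  {A : Matrix ι ι ℤ} {h e f : ι → L}
  {V : Type*} [AddCommGroup V] [Module ℂ V] [LieRingModule L V] [LieModule ℂ L V]

/-- The action of `so(2,1)` on a module through a triple. -/
def So21Triple.toRep (J : So21Triple L) (V : Type*) [AddCommGroup V] [Module ℂ V]
    [LieRingModule L V] [LieModule ℂ L V] : So21Rep V where
  J3 := LieModule.toEnd ℂ L V J.J3
  Jp := LieModule.toEnd ℂ L V J.Jp
  Jm := LieModule.toEnd ℂ L V J.Jm
  lie_Jp_Jm w := by
    simp only [LieModule.toEnd_apply_apply]
    rw [← lie_lie, J.lie_Jp_Jm, neg_lie]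
  lie_J3_Jp w := by
    simp only [LieModule.toEnd_apply_apply]
    rw [← lie_lie, J.lie_J3_Jp]
  lie_J3_Jm w := by
    simp only [LieModule.toEnd_apply_apply]
    rw [← lie_lie, J.lie_J3_Jm, neg_lie]

namespace IsHighestWeightModule

variable {Λ : ι → ℕ} {v₀ : V}

/-- Each application of `x` raises the weight by `α`, and weights are bounded above by `Λ`. -/
theorem root_nilpotent (M : IsHighestWeightModule h e Λ v₀) (K : IsKacMoody A h e f) {α : ι → ℤ}
    (hα : 0 < α) {x : L} (hx : x ∈ wtSpace L h (rootWeight A α)) (v : V) :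
    ∃ n : ℕ, ((LieModule.toEnd ℂ L V x) ^ n) v = 0 := by
  have hv : v ∈ Submodule.span ℂ (Set.range fun l => word f l v₀) := by
    rw [M.span_words K M.mem M.ne_zero M.lie_e]; trivial
  induction hv using Submodule.span_induction with
  | zero => exact ⟨0, rfl⟩
  | add a b _ _ ha hb => exact exists_pow_add_eq_zero ha hb
  | smul c a _ ha =>
    obtain ⟨n, hn⟩ := ha
    exact ⟨n, by rw [map_smul, hn, smul_zero]⟩
  | mem _ hl =>
    obtain ⟨l, rfl⟩ := hl
    have hpow : ∀ n : ℕ, ((LieModule.toEnd ℂ L V x) ^ n) (word f l v₀) ∈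
        wtSpace V h ((fun i => (Λ i : ℂ)) - rootWeight A (content l - n • α)) := fun n => by
      induction n with
      | zero =>
        rw [zero_smul, sub_zero]
        exact K.word_f_mem M.mem l
      | succ n ih =>
        rw [pow_succ', Module.End.mul_apply]
        have h1 := lie_mem_wtSpace hx ih
        change ⁅x, ((LieModule.toEnd ℂ L V x) ^ n) (word f l v₀)⁆ ∈ _
        convert h1 using 2
        rw [succ_nsmul, ← sub_sub, rootWeight_sub]
        abel
    -- Each application lowers the height of the difference to `Λ` by at least one, so one step more
    -- than that height makes it negative.
    refine ⟨(∑ i, content l i).toNat + 1, ?_⟩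
    by_contra h0
    have h1 := Finset.sum_nonneg fun i (_ : i ∈ Finset.univ) => M.nonneg_of_mem K (hpow _) h0 i
    have h2 : 0 < ∑ i, α i := Fintype.sum_pos hα
    have h3 : 0 ≤ ∑ i, content l i := Finset.sum_nonneg fun i _ => content_nonneg l i
    have h4 : ∀ n : ℕ, ∑ i, (content l - n • α) i = ∑ i, content l i - n * ∑ i, α i := fun n => by
      simp [Finset.sum_sub_distrib, Finset.mul_sum]
    rw [h4] at h1
    push_cast at h1
    rw [Int.toNat_of_nonneg h3] at h1
    nlinarith

theorem decomposes (M : IsHighestWeightModule h e Λ v₀) (K : IsKacMoody A h e f)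
    (hA : IsHyperbolic A) (hΛ : Λ ≠ 0) {α : ι → ℤ} (hα : 0 < α) (hαα : ip A α α < 0) {x : L}
    (hx : x ∈ wtSpace L h (rootWeight A α)) {R : So21Rep V}
    (h3 : R.J3 = LieModule.toEnd ℂ L V ((ip A α α : ℂ)⁻¹ • hVec h α)) {c : ℂ} (hc : c ≠ 0)
    (hp : R.Jp = LieModule.toEnd ℂ L V (c • x)) :
    R.Decomposes R.Jp discreteMinus (fun μ v => ∀ i, ⁅h i, v⁆ = μ i • v)
      fun μ => - (∑ i, (α i : ℂ) * μ i) / (ip A α α : ℂ) := by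
  have ha : (ip A α α : ℂ) ≠ 0 := Int.cast_ne_zero.mpr hαα.ne
  refine R.decomposes_discreteMinus (fun i => LieModule.toEnd ℂ L V (h i))
    (fun l => K.word_f_mem M.mem l) (M.span_words K M.mem M.ne_zero M.lie_e)
    (fun i v hv => ?_) (fun v => ?_) _ (fun μ v hv => ?_) (fun μ v hv0 hv => ?_) fun d => ?_
  · rw [hp, LieModule.toEnd_apply_apply, smul_lie, smul_eq_zero] at hv
    have hv' := hv.resolve_left hc
    rw [hp, LieModule.toEnd_apply_apply, LieModule.toEnd_apply_apply, smul_lie, leibniz_lie, hv',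
      lie_zero, ← lie_skew, hx i, neg_lie, smul_lie, hv', smul_zero, neg_zero, add_zero, smul_zero]
  · rw [hp]
    exact M.root_nilpotent K hα (Submodule.smul_mem _ c hx) v
  · rw [h3, LieModule.toEnd_apply_apply, smul_lie, hVec_lie (V := V) (μ := μ) hv, smul_smul]
    congr 1
    field_simp
  · obtain ⟨p, hp0, hp1⟩ := M.exists_level K hA hΛ hα.le hαα (μ := μ) hv hv0
    refine ⟨⟨(p : ℝ) / (- ip A α α : ℤ), div_pos (by exact_mod_cast hp0)
      (by exact_mod_cast neg_pos.mpr hαα)⟩, ?_⟩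
    rw [hp1]
    push_cast
    rw [neg_div, div_neg]
  · obtain ⟨W, hW, hW'⟩ := M.exists_finiteDimensional K hA hα.le hαα (- (d * (ip A α α : ℂ)))
    refine ⟨W, hW, fun μ v hμ hv => hW' μ ?_ hv⟩
    rw [← hμ]
    field_simp

end IsHighestWeightModule

theorem So21Rep.IsHom.of_swap {R : So21Rep V} {s : {s : ℝ // 0 < s}} {φ : (ℕ →₀ ℂ) →ₗ[ℂ] V}
    (hφ : (discreteMinus s).IsHom R.swap φ) : (discretePlus s).IsHom R φ := fun x => by
  obtain ⟨h1, h2, h3⟩ := hφ x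
  refine ⟨?_, h3, h2⟩
  change φ ((- ladderWeight s) x) = (- R.J3) (φ x) at h1
  rwa [LinearMap.neg_apply, LinearMap.neg_apply, map_neg, neg_inj] at h1

/-- Exchanging `J⁺` and `J⁻` negates `J₃` and turns `𝒟_s⁻` into `𝒟_s⁺`; the signs of the weights
change because the exchange of `e` and `f` replaces `h_i` by `-h_i`. -/
theorem So21Rep.Decomposes.of_swap {R : So21Rep V} {top : V →ₗ[ℂ] V} {wt : (ι → ℂ) → V → Prop}
    {param : (ι → ℂ) → ℂ} (hR : R.swap.Decomposes top discreteMinus wt param) :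
    R.Decomposes top discretePlus (fun μ v => wt (-μ) v) fun μ => param (-μ) := by
  obtain ⟨mult, Φ, h1, h2, h3⟩ := hR
  refine ⟨mult, Φ, fun p => (h1 p).of_swap, fun p => ?_, fun μ v hv0 hv hvt => ?_⟩
  · obtain ⟨μ, hμ⟩ := h2 p
    exact ⟨-μ, by simpa only [neg_neg] using hμ⟩
  · obtain ⟨s, hs, hm, φ, hφ⟩ := h3 (-μ) v hv0 hv hvt
    exact ⟨s, hs, hm, φ, hφ.1.of_swap, hφ.2⟩

end HighestWeightDecomposition

/-! ### The triple spanning `so(2,1)_α` and the two kinds of modules -/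

section RootTriple

variable {ι : Type*} [Fintype ι] [DecidableEq ι] {A : Matrix ι ι ℤ} {n : ι → ℕ}

/-- A tuple of natural numbers as an element of the root lattice. -/
def rootVec (n : ι → ℕ) : ι → ℤ := fun i => n i

theorem isChevalleyInvolution_omega :
    IsChevalleyInvolution (genH A) (genE A) (genF A) (omega A) where
  lie := omega_lie A
  map_h := omega_genH A
  map_e := omega_genE A
  map_f := omega_genF A

theorem ip_rootVec : ip A (rootVec n) (rootVec n) = normSq A n := by
  simp only [ip, normSq, dotProduct, Matrix.mulVec, Finset.mul_sum, rootVec, mul_assoc]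

theorem ip_neg_right (β γ : ι → ℤ) : ip A β (-γ) = - ip A β γ := by
  simp [ip, Matrix.mulVec_neg]

theorem hVec_rootVec : hVec (genH A) (rootVec n) = rootH A n := by
  simp [hVec_apply, rootH, rootVec]

theorem mem_wtSpace_of_mem_rootSpace {x : KMAlgebra A} (hx : x ∈ rootSpace A n) :
    x ∈ wtSpace (KMAlgebra A) (genH A) (rootWeight A (rootVec n)) := fun i => hx i

theorem rootVec_pos (hn : normSq A n < 0) : 0 < rootVec n := by
  refine lt_of_le_of_ne (fun i => Int.natCast_nonneg _) fun h0 => ?_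
  rw [← ip_rootVec, ← h0] at hn
  simp [ip] at hn

theorem rootH_lie {β : ι → ℤ} {x : KMAlgebra A}
    (hx : x ∈ wtSpace (KMAlgebra A) (genH A) (rootWeight A β)) :
    ⁅rootH A n, x⁆ = (ip A (rootVec n) β : ℂ) • x := by
  rw [← hVec_rootVec, hVec_lie_root hx]

/-- Invariance gives `α(h_i) ⟨x|y⟩ = ⟨[x, y] | h_i⟩ = c α(h_i)`, and some `α(h_i)` is nonzero since
`A` is nondegenerate. Thus every standard form takes the value already found from the bracket. -/
theorem IsStandardForm.apply_eq {B : LinearMap.BilinForm ℂ (KMAlgebra A)}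
    (hB : IsStandardForm A B) (symm : A.IsSymm) (hdet : A.det ≠ 0) (hn : normSq A n < 0)
    {x y : KMAlgebra A} (hy : y ∈ wtSpace (KMAlgebra A) (genH A) (rootWeight A (-rootVec n)))
    {c : ℂ} (hc : ⁅x, y⁆ = c • rootH A n) : B x y = c := by
  obtain ⟨i, hi⟩ : ∃ i, rootWeight A (rootVec n) i ≠ 0 := by
    by_contra! hcon
    have h0 : rootWeight A (rootVec n) = rootWeight A 0 := by
      rw [rootWeight_zero]; exact funext hcon
    exact (rootVec_pos hn).ne' (rootWeight_injective hdet h0)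
  refine mul_left_cancel₀ hi ?_
  have h1 := hB.invariant x y (genH A i)
  rw [← lie_skew y, hy i, rootWeight_neg, Pi.neg_apply, neg_smul, neg_neg, map_smul, hc, map_smul,
    LinearMap.smul_apply, smul_eq_mul, smul_eq_mul] at h1
  rw [← h1, mul_comm]
  congr 1
  simp only [rootH, map_sum, LinearMap.sum_apply, map_smul, LinearMap.smul_apply, hB.h_h,
    smul_eq_mul, rootWeight, Matrix.mulVec, dotProduct, rootVec, Int.cast_sum, Int.cast_mul,
    Int.cast_natCast]
  exact Finset.sum_congr rfl fun j _ => by rw [mul_comm, symm.apply]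

theorem exists_isRootTriple (hn : normSq A n < 0) {x : KMAlgebra A} (hx : x ∈ rootSpace A n) {N : ℝ}
    (hN : 0 < N) (hlie : ⁅x, - omega A x⁆ = (N : ℂ) • rootH A n) :
    ∃ J : So21Triple (KMAlgebra A), IsRootTriple A n x N J := by
  have hx' := mem_wtSpace_of_mem_rootSpace hx
  have hy' := neg_mem (isChevalleyInvolution_omega.map_mem hx')
  have ha : (normSq A n : ℂ) ≠ 0 := Int.cast_ne_zero.mpr hn.ne
  have hNa : 0 < - N * (normSq A n : ℝ) :=
    mul_pos_of_neg_of_neg (neg_neg_of_pos hN) (Int.cast_lt_zero.mpr hn)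
  -- The normalization makes the product of the two coefficients `(-N α²)⁻¹`, so that `[J⁺, J⁻] =
  -- -(α²)⁻¹ H(α)`; the square root is genuine because `-N α² > 0`.
  have hcc : ((((√(-N * (normSq A n : ℝ)))⁻¹ : ℝ) : ℂ) * (((√(-N * (normSq A n : ℝ)))⁻¹ : ℝ) : ℂ)) *
      N = - (normSq A n : ℂ)⁻¹ := by
    rw [← Complex.ofReal_mul, ← mul_inv, Real.mul_self_sqrt hNa.le]
    have : (N : ℂ) ≠ 0 := Complex.ofReal_ne_zero.mpr hN.ne'
    push_cast
    field_simp
  refine ⟨⟨(normSq A n : ℂ)⁻¹ • rootH A n, (((√(-N * (normSq A n : ℝ)))⁻¹ : ℝ) : ℂ) • x,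
    (((√(-N * (normSq A n : ℝ)))⁻¹ : ℝ) : ℂ) • (- omega A x), ?_, ?_, ?_⟩, rfl, rfl, rfl⟩
  · rw [smul_lie, lie_smul, hlie, smul_smul, smul_smul, hcc, neg_smul]
  · rw [smul_lie, lie_smul, rootH_lie hx', ip_rootVec, smul_comm _ (normSq A n : ℂ),
      inv_smul_smul₀ ha]
  · rw [smul_lie, lie_smul, rootH_lie hy', ip_neg_right, ip_rootVec, Int.cast_neg, neg_smul,
      smul_neg, smul_neg, smul_comm _ (normSq A n : ℂ), inv_smul_smul₀ ha]

theorem param_eq : (fun μ : ι → ℂ => - (∑ i, (rootVec n i : ℂ) * μ i) /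
    (ip A (rootVec n) (rootVec n) : ℂ)) = fun μ => - pairing μ n / (normSq A n : ℂ) := by
  simp [ip_rootVec, pairing, rootVec]

variable {N : ℝ} {J : So21Triple (KMAlgebra A)} {x : KMAlgebra A}

theorem IsRootTriple.coeff_ne_zero (hn : normSq A n < 0) (hN : 0 < N) :
    (((√(-N * (normSq A n : ℝ)))⁻¹ : ℝ) : ℂ) ≠ 0 := by
  have hNa : 0 < - N * (normSq A n : ℝ) :=
    mul_pos_of_neg_of_neg (neg_neg_of_pos hN) (Int.cast_lt_zero.mpr hn)
  exact Complex.ofReal_ne_zero.mpr (inv_ne_zero (Real.sqrt_pos.mpr hNa).ne')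

variable {V : Type*} [AddCommGroup V] [Module ℂ V] [LieRingModule (KMAlgebra A) V]
  [LieModule ℂ (KMAlgebra A) V]

theorem IsRootTriple.decomposes_highest (hJ : IsRootTriple A n x N J) (hA : IsHyperbolic A)
    (hdet : A.det ≠ 0) (hn : normSq A n < 0) (hx : x ∈ rootSpace A n) (hN : 0 < N)
    (irr : LieModule.IsIrreducible ℂ (KMAlgebra A) V) {Λ : ι → ℕ} (hΛ : Λ ≠ 0) {v : V}
    (hv : IsHighestWeightVector A (fun i => (Λ i : ℂ)) v) :
    DecomposesInto A J J.Jp discreteMinus (fun μ => - pairing μ n / (normSq A n : ℂ)) V := by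
  have K := isKacMoody_kmAlgebra hA hdet
  have M : IsHighestWeightModule (genH A) (genE A) Λ v := ⟨irr, hv.1, hv.2.1, hv.2.2⟩
  have h1 := M.decomposes K hA hΛ (rootVec_pos hn) (ip_rootVec.trans_lt hn)
    (mem_wtSpace_of_mem_rootSpace hx) (R := J.toRep V)
    (by rw [ip_rootVec, hVec_rootVec, ← hJ.1]; rfl)
    (IsRootTriple.coeff_ne_zero hn hN) (by rw [← hJ.2.1]; rfl)
  rw [param_eq] at h1
  exact h1

theorem IsRootTriple.decomposes_lowest (hJ : IsRootTriple A n x N J) (hA : IsHyperbolic A)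
    (hdet : A.det ≠ 0) (hn : normSq A n < 0) (hx : x ∈ rootSpace A n) (hN : 0 < N)
    (irr : LieModule.IsIrreducible ℂ (KMAlgebra A) V) {Λ : ι → ℕ} (hΛ : Λ ≠ 0) {v : V}
    (hv : IsLowestWeightVector A (fun i => - (Λ i : ℂ)) v) :
    DecomposesInto A J J.Jm discretePlus (fun μ => pairing μ n / (normSq A n : ℂ)) V := by
  have K := isKacMoody_kmAlgebra hA hdet
  have M : IsHighestWeightModule (fun i => - genH A i) (genF A) Λ v :=
    ⟨irr, hv.1, by rw [wtSpace_neg]; exact hv.2.1, hv.2.2⟩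
  have h1 := M.decomposes K.swap hA hΛ (rootVec_pos hn) (ip_rootVec.trans_lt hn)
    (x := - omega A x) (R := (J.toRep V).swap)
    (by
      rw [IsChevalley.wtSpace_swap]
      exact neg_mem (isChevalleyInvolution_omega.map_mem (mem_wtSpace_of_mem_rootSpace hx)))
    (by
      rw [ip_rootVec, hVec_negGen, hVec_neg, hVec_rootVec, smul_neg, ← hJ.1, map_neg]
      rfl)
    (IsRootTriple.coeff_ne_zero hn hN) (by rw [← hJ.2.2]; rfl)
  rw [param_eq] at h1
  have h2 := h1.of_swap
  have h3 : (fun (μ : ι → ℂ) (v : V) => ∀ i, ⁅- genH A i, v⁆ = (-μ) i • v) =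
      fun μ v => ∀ i, ⁅genH A i, v⁆ = μ i • v := by
    simp only [neg_lie, Pi.neg_apply, neg_smul, neg_inj]
  have h4 : (fun μ : ι → ℂ => - pairing (-μ) n / (normSq A n : ℂ)) =
      fun μ => pairing μ n / (normSq A n : ℂ) := by
    simp [pairing]
  rw [h3, h4] at h2
  exact h2

end RootTriple

end KacMoody

end

theorem mainTheorem3 {ι : Type*} [Fintype ι] [DecidableEq ι]
    -- `𝔤(A)` is a hyperbolic Kac-Moody algebra with nondegenerate symmetric Cartan matrix
    (A : Matrix ι ι ℤ) (hA : IsHyperbolic A) (hdet : A.det ≠ 0)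
    -- `α = ∑ n_i α_i` is a positive timelike root, and `E` a nonzero element of its root space
    (n : ι → ℕ) (hα : normSq A n < 0)
    (E : KMAlgebra A) (hE : E ∈ rootSpace A n) (hE0 : E ≠ 0) :
    ∃ (N : ℝ) (J : So21Triple (KMAlgebra A)),
      -- `N = ⟨E | F⟩ > 0` with `F = - ω(E)`, and `J` spans `so(2,1)_α`
      0 < N ∧ ⁅E, - omega A E⁆ = (N : ℂ) • rootH A n ∧
      (∀ B : LinearMap.BilinForm ℂ (KMAlgebra A), IsStandardForm A B →
        B E (- omega A E) = (N : ℂ)) ∧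
      IsRootTriple A n E N J ∧
      ∀ (V : Type*) [AddCommGroup V] [Module ℂ V] [LieRingModule (KMAlgebra A) V]
        [LieModule ℂ (KMAlgebra A) V], LieModule.IsIrreducible ℂ (KMAlgebra A) V →
        -- `Λ ≠ 0` is a dominant integral weight
        ∀ Λ : ι → ℕ, Λ ≠ 0 →
          -- highest weight `Λ`: sum of `𝒟_s⁻` with `s = - μ · α / α²`
          ((∃ v : V, IsHighestWeightVector A (fun i => (Λ i : ℂ)) v) →
            DecomposesInto A J J.Jp discreteMinus
              (fun μ => - pairing μ n / (normSq A n : ℂ)) V) ∧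
          -- lowest weight `-Λ`: sum of `𝒟_s⁺` with `s = μ · α / α²`
          ((∃ v : V, IsLowestWeightVector A (fun i => - (Λ i : ℂ)) v) →
            DecomposesInto A J J.Jm discretePlus
              (fun μ => pairing μ n / (normSq A n : ℂ)) V) := by
  have K := isKacMoody_kmAlgebra hA hdet
  obtain ⟨N, hN, hlie⟩ := isChevalleyInvolution_omega.exists_lie_eq K (rootVec_pos hα)
    (mem_wtSpace_of_mem_rootSpace hE) hE0
  rw [hVec_rootVec] at hlie
  obtain ⟨J, hJ⟩ := exists_isRootTriple hα hE hN hlie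
  refine ⟨N, J, hN, hlie, fun B hB => hB.apply_eq hA.symm hdet hα
    (neg_mem (isChevalleyInvolution_omega.map_mem (mem_wtSpace_of_mem_rootSpace hE))) hlie, hJ, ?_⟩
  intro V _ _ _ _ irr Λ hΛ
  exact ⟨fun ⟨v, hv⟩ => hJ.decomposes_highest hA hdet hα hE hN irr hΛ hv,
    fun ⟨v, hv⟩ => hJ.decomposes_lowest hA hdet hα hE hN irr hΛ hv⟩
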